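/- Let $\mathcal M_1(\mathbb Z)$ be the set of probability measures on $\mathbb Z$ with the topology of weak convergence, and let $\Omega=\prod_{x\in\mathbb Z}\mathcal M_1(\mathbb Z)$ be the space of environments $\omega=(\omega^x)_{x\in\mathbb Z}$ on $\mathbb Z$, with its Borel $\sigma$-field; write $\omega(x,y)=\omega^x(y-x)$. For $\omega\in\Omega$ and $x\in\mathbb Z$, let $P_\omega^x$ be the law on $\mathbb Z^{\mathbb N}$ of the Markov chain $(X_n)_{n\ge 0}$ on $\mathbb Z$ started at $x$ with transition probabilities $\omega(\cdot,\cdot)$. For a probability measure $P$ on $\Omega$, let $\mathbb P^x$ be the annealed measure on $\Omega\times\mathbb Z^{\mathbb N}$ given by $\mathbb P^x(A\times B)=\int_A P_\omega^x(B)\,P(d\omega)$. For $x\in\mathbb Z$, let $H_{\ge x}=\inf\{n\ge 0: X_n\ge x\}\in\mathbb N\cup\{\infty\}$, where $\inf\emptyset=\infty$. Let $P$ be a probability measure on $\Omega$ such that (C1) the $(\omega^x)_{x\in\mathbb Z}$ are i.i.d. under $P$; (C2) for $P$-a.e. $\omega$, the Markov chain on $\mathbb Z$ with transition probabilities $\omega(\cdot,\cdot)$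 is irreducible; (C3) there exist $L$ and $R$ such that, for $P$-a.e. $\omega$, $\omega(a,b)=0$ whenever $b\notin[a-L,a+R]$. Then there is a deterministic constant $v\in\mathbb R$ such that $\lim_{n\to\infty}\frac{X_n}{n}=v$, $\mathbb P^0$-almost surely. Moreover, $\mathbb P^0$-almost surely, $\lim_{x\to\infty}\frac{H_{\ge x}}{x}=\frac1v$, where $\frac1v$ is understood to be $\infty$ if $v\le 0$. -/

import Mathlib

open MeasureTheory ProbabilityTheory Filter Topology
open scoped ENNReal NNReal

namespace RWRE

/-- An environment on `ℤ`, identified with the tuple `(ω^x)_{x ∈ ℤ}` of its jump laws: `ω x` is the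
probability measure `y ↦ ω(x, x + y)`. It carries the product `σ`-algebra, which is the Borel
`σ`-algebra of the product of the weak topologies (see `environment_borel` below). -/
abbrev Environment : Type := ℤ → ProbabilityMeasure ℤ

/-- Trajectories `(X_n)_{n ≥ 0}` of a walk on `ℤ`. -/
abbrev Path : Type := ℕ → ℤ

/-- The transition law out of the site `a`: the measure with mass `ω(a, b)` at `b`. -/
noncomputable def transition (ω : Environment) (a : ℤ) : Measure ℤ :=
  ((ω a : ProbabilityMeasure ℤ) : Measure ℤ).map (fun y => a + y)

instance (ω : Environment) (a : ℤ) : IsProbabilityMeasure (transition ω a) :=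
  Measure.isProbabilityMeasure_map (measurable_of_countable _).aemeasurable

/-- The transition law of the walk at time `n`, as a kernel from the history `(X_0, …, X_n)`. -/
noncomputable def stepKernel (ω : Environment) (n : ℕ) :
    Kernel (Π _ : Finset.Iic n, ℤ) ℤ where
  toFun h := transition ω (h ⟨n, Finset.mem_Iic.2 le_rfl⟩)
  measurable' := measurable_of_countable _

instance (ω : Environment) (n : ℕ) : IsMarkovKernel (stepKernel ω n) :=
  ⟨fun h => inferInstanceAs
    (IsProbabilityMeasure (transition ω (h ⟨n, Finset.mem_Iic.2 le_rfl⟩)))⟩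

/-- The quenched measure `P_ω^x`: the law of the Markov chain on `ℤ` with transition probabilities
given by `ω`, started at `x`. -/
noncomputable def quenched (ω : Environment) (x : ℤ) : Measure Path :=
  Kernel.trajMeasure (X := fun _ => ℤ) (Measure.dirac x) (stepKernel ω)

instance (ω : Environment) (x : ℤ) : IsProbabilityMeasure (quenched ω x) :=
  inferInstanceAs (IsProbabilityMeasure
    (Kernel.trajMeasure (X := fun _ => ℤ) (Measure.dirac x) (stepKernel ω)))

theorem measurable_transition_apply (a : ℤ) (S : Set ℤ) :
    Measurable fun ω : Environment => transition ω a S := by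
  have h : (fun ω : Environment => transition ω a S)
      = fun ω => ((ω a : ProbabilityMeasure ℤ) : Measure ℤ) ((fun y => a + y) ⁻¹' S) := by
    funext ω
    exact Measure.map_apply (measurable_of_countable _) (Set.to_countable S).measurableSet
  rw [h]
  exact (Measure.measurable_coe (Set.to_countable _).measurableSet).comp
    (measurable_subtype_coe.comp (measurable_pi_apply a))

theorem measurable_quenched_singleton (x : ℤ) (n : ℕ) (p : Π _ : Finset.Iic n, ℤ) :
    Measurable fun ω : Environment =>
      (quenched ω x).map (Preorder.frestrictLe (π := fun _ : ℕ => ℤ) n) {p} := by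
  induction n with
  | zero =>
    have h : ∀ ω : Environment,
        (quenched ω x).map (Preorder.frestrictLe (π := fun _ : ℕ => ℤ) 0)
          = (Measure.dirac x).map
              (MeasurableEquiv.piUnique (fun _ : Finset.Iic 0 => ℤ)).symm := by
      intro ω
      rw [quenched, Kernel.trajMeasure, Measure.map_comp _ _ (by fun_prop),
        Kernel.traj_map_frestrictLe, Kernel.partialTraj_self, Measure.id_comp]
    simp only [h]
    exact measurable_const
  | succ n ih =>
    let q : Π _ : Finset.Iic n, ℤ :=
      fun i => p ⟨i.1, Finset.mem_Iic.2 ((Finset.mem_Iic.1 i.2).trans n.le_succ)⟩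
    let z : ℤ := p ⟨n + 1, Finset.mem_Iic.2 le_rfl⟩
    have h : ∀ ω : Environment,
        (quenched ω x).map (Preorder.frestrictLe (π := fun _ : ℕ => ℤ) (n + 1)) {p}
          = (quenched ω x).map (Preorder.frestrictLe (π := fun _ : ℕ => ℤ) n) {q}
            * transition ω (q ⟨n, Finset.mem_Iic.2 le_rfl⟩) {z} := by
      intro ω
      have key := Kernel.map_frestrictLe_trajMeasure_compProd_eq_map_trajMeasure
        (X := fun _ => ℤ) (μ₀ := Measure.dirac x) (κ := stepKernel ω) (a := n)
      have h1 := congrArg (fun μ => μ ({q} ×ˢ {z})) key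
      rw [Measure.compProd_apply_prod (measurableSet_singleton _) (measurableSet_singleton _),
        lintegral_singleton, Measure.map_apply (by fun_prop)
          ((measurableSet_singleton _).prod (measurableSet_singleton _))] at h1
      rw [Measure.map_apply (by fun_prop) (measurableSet_singleton _), mul_comm]
      refine Eq.trans (congrArg (quenched ω x) ?_) h1.symm
      ext X
      simp only [Set.mem_preimage, Set.mem_singleton_iff, Set.mem_prod]
      constructor
      · rintro rfl
        exact ⟨rfl, rfl⟩
      · rintro ⟨h2, h3⟩
        funext ⟨i, hi⟩
        rcases Nat.lt_or_ge n i with hlt | hge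
        · have : i = n + 1 := le_antisymm (Finset.mem_Iic.1 hi) hlt
          subst this
          exact h3
        · exact congrFun h2 ⟨i, Finset.mem_Iic.2 hge⟩
    simp only [h]
    exact (ih q).mul (measurable_transition_apply _ _)

theorem measurable_quenched (x : ℤ) : Measurable fun ω : Environment => quenched ω x := by
  refine Measurable.measure_of_isPiSystem_of_isProbabilityMeasure
    (generateFrom_measurableCylinders (α := fun _ : ℕ => ℤ)).symm
    isPiSystem_measurableCylinders ?_
  intro C hC
  rw [measurableCylinders_nat] at hC
  simp only [Set.mem_iUnion, Set.mem_singleton_iff] at hC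
  obtain ⟨n, S, hS, rfl⟩ := hC
  have h : ∀ ω : Environment, quenched ω x (cylinder (Finset.Iic n) S)
      = ∑' p : S, (quenched ω x).map
          (Preorder.frestrictLe (π := fun _ : ℕ => ℤ) n) {(p : Π _ : Finset.Iic n, ℤ)} := by
    intro ω
    rw [← measure_biUnion S.to_countable
      (fun a _ b _ hab => Set.disjoint_singleton.2 hab) fun _ _ => measurableSet_singleton _,
      Set.biUnion_of_singleton, Measure.map_apply (by fun_prop) hS]
    rfl
  simp only [h]
  exact Measurable.tsum fun p => measurable_quenched_singleton x n p

/-- `ω ↦ P_ω^x` as a Markov kernel. -/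
noncomputable def quenchedKernel (x : ℤ) : Kernel Environment Path where
  toFun ω := quenched ω x
  measurable' := measurable_quenched x

instance (x : ℤ) : IsMarkovKernel (quenchedKernel x) :=
  ⟨fun ω => inferInstanceAs (IsProbabilityMeasure (quenched ω x))⟩

/-- The annealed measure `ℙ^x = P × P_ω^x` on `Ω × ℤ^ℕ`:
`ℙ^x (A × B) = ∫_A P_ω^x(B) P(dω)`. -/
noncomputable def annealed (P : Measure Environment) (x : ℤ) : Measure (Environment × Path) :=
  P ⊗ₘ quenchedKernel x

theorem isInducing_masses :
    IsInducing fun (μ : ProbabilityMeasure ℤ) (n : ℤ) => μ {n} := by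
  refine isInducing_iff_nhds.2 fun μ => le_antisymm ?_ ?_
  · refine Filter.map_le_iff_le_comap.1 (tendsto_pi_nhds.2 fun n => ?_)
    exact ProbabilityMeasure.tendsto_measure_of_isClopen_of_tendsto tendsto_id
      (isClopen_discrete {n})
  · have hS : IsPiSystem {s : Set ℤ | s.Subsingleton} :=
      fun s hs t _ _ => hs.anti Set.inter_subset_left
    refine hS.tendsto_probabilityMeasure_of_tendsto_of_mem (μ := id)
      (l := Filter.comap (fun (μ : ProbabilityMeasure ℤ) (n : ℤ) => μ {n}) (𝓝 fun n => μ {n}))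
      (fun s _ => s.to_countable.measurableSet)
      (fun u _ y hy => ⟨{y}, Set.subsingleton_singleton, by simp, by simpa using hy⟩) ?_
    intro s hs
    rcases hs.eq_empty_or_singleton with rfl | ⟨n, rfl⟩
    · simpa using tendsto_const_nhds
    · have h := ((continuous_apply (A := fun _ : ℤ => ℝ≥0) n).tendsto fun m => μ {m}).comp
        (tendsto_comap (f := fun (ν : ProbabilityMeasure ℤ) (m : ℤ) => ν {m}))
      exact h

theorem borelSpace_probabilityMeasure : BorelSpace (ProbabilityMeasure ℤ) := by
  have hb : borel (ProbabilityMeasure ℤ) = MeasurableSpace.comap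
      (fun (μ : ProbabilityMeasure ℤ) (n : ℤ) => μ {n}) MeasurableSpace.pi := by
    rw [isInducing_masses.eq_induced, borel_comap, ← BorelSpace.measurable_eq]
  refine ⟨le_antisymm ?_ ?_⟩
  · rw [hb]
    refine Measurable.comap_le
      (m₁ := MeasurableSpace.comap (fun (μ : ProbabilityMeasure ℤ) (n : ℤ) => μ {n})
        MeasurableSpace.pi) ?_
    refine @Measure.measurable_of_measurable_coe _ _ _ (_) _ fun S hS => ?_
    have h : ∀ μ : ProbabilityMeasure ℤ, (μ : Measure ℤ) S
        = ∑' n : S, ((μ {(n : ℤ)} : ℝ≥0) : ℝ≥0∞) := by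
      intro μ
      simp only [ProbabilityMeasure.ennreal_coeFn_eq_coeFn_toMeasure]
      rw [← measure_biUnion S.to_countable
        (fun a _ b _ hab => Set.disjoint_singleton.2 hab) fun _ _ => measurableSet_singleton _,
        Set.biUnion_of_singleton]
    have h' : Measurable fun f : ℤ → ℝ≥0 => ∑' n : S, ((f n : ℝ≥0) : ℝ≥0∞) :=
      Measurable.tsum fun n => (measurable_pi_apply (n : ℤ)).coe_nnreal_ennreal
    exact (funext h).symm ▸ h'.comp (comap_measurable _)
  · rw [hb]
    refine Measurable.comap_le (measurable_pi_lambda _ fun n => ?_)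
    exact ((Measure.measurable_coe (measurableSet_singleton n)).comp
      measurable_subtype_coe).ennreal_toNNReal

/-- The `σ`-algebra on the space of environments is the Borel `σ`-algebra of the product topology,
where the probability measures on `ℤ` carry the topology of weak convergence. -/
theorem environment_borel : BorelSpace Environment := by
  have := borelSpace_probabilityMeasure
  have : SecondCountableTopology (ProbabilityMeasure ℤ) :=
    isInducing_masses.secondCountableTopology
  infer_instance

/-- The `ω^x`, `x ∈ ℤ`, are i.i.d. under `P`. -/
def IsIID (P : Measure Environment) : Prop :=
  iIndepFun (fun (x : ℤ) (ω : Environment) => ω x) P ∧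
    ∀ x y : ℤ, IdentDistrib (fun ω : Environment => ω x) (fun ω : Environment => ω y) P P

/-- For `P`-a.e. `ω`, the Markov chain on `ℤ` with transition probabilities `ω` is
irreducible. -/
def IsIrreducible (P : Measure Environment) : Prop :=
  ∀ᵐ ω ∂P, ∀ x y : ℤ, ∃ n : ℕ, 0 < quenched ω x {X | X n = y}

/-- Jumps are bounded: there are `L` and `R` such that, for `P`-a.e. `ω`, `ω(a, b) = 0`
whenever `b` is outside `[a - L, a + R]`. -/
def HasBoundedJumps (P : Measure Environment) : Prop :=
  ∃ L R : ℕ, ∀ᵐ ω ∂P, ∀ a b : ℤ, b ∉ Set.Icc (a - L) (a + R) → transition ω a {b} = 0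

/-- `H_x = inf {n : X_n = x}`, with `inf ∅ = ∞`. -/
noncomputable def hitting (x : ℤ) (X : Path) : ℕ∞ := ⨅ (n : ℕ) (_ : X n = x), (n : ℕ∞)

/-- `H_S = min_{x ∈ S} H_x`. -/
noncomputable def hittingSet (S : Set ℤ) (X : Path) : ℕ∞ := ⨅ x ∈ S, hitting x X

/-- `H_{≥ x}`, the hitting time of `[x, ∞)`. -/
noncomputable def hittingGE (x : ℤ) (X : Path) : ℕ∞ := hittingSet (Set.Ici x) X

end RWRE

/-! The law of the environment is a product measure, so translation invariant events have
probability zero or one. With irreducibility and Lévy's zero-one law this leaves three cases for the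
averaged walk: it tends to `+∞`, it tends to `-∞`, or it returns to `0` infinitely often
(`Admissible.trichotomy`).

Suppose that it tends to `+∞`, and condition it to stay in `[0, ∞)`. At a cut time the past has used
only the sites strictly to the left of the present position, and the future uses only the remaining
ones. Since these two parts of the environment are independent, the path seen from a cut time is
independent of the past and has the conditioned law again (`Admissible.renewal`,
`Admissible.firstCut_mul`). The mean displacement between cut times is finite: jumps are bounded, so
among any `J` consecutive sites the expected number of cut positions is bounded below
(`Admissible.tsum_noCut_ne_top`). The strong law, applied to displacements and durations, gives the
speed; durations of infinite mean give speed zero. The conditioning is removed by looking at the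
path from the time of its global minimum (`Admissible.null_of_confined`). The case of `-∞` follows
by reflection.

In the recurrent case the speed is zero. Before it gets far to the right of a site, a recurrent walk
is likely to have visited that site many times. Counting these visits shows that, for any `C` and
suitable `K`, the walk needs at least time of order `C K` to advance by `K`, with probability close
to one (`Admissible.exists_quickPassage_le`). To make this almost sure, the generating functions of
quenched hitting times are bounded by a product over blocks of length `K` (`passageGen_le_prod`).
Its factors are local functions of the environment, hence obey a strong law, and a Chernoff bound
with Borel-Cantelli yields upper speed at most `1 / C` (`Admissible.slow_of_recurrent`). The
reflected walk gives the lower bound.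

The asymptotics of the hitting times follow path by path by inverting the speed
(`tendsto_hittingGE_div`). -/

namespace RWRE

/-! ### The quenched law: cylinders, Markov property, locality, Lévy's zero-one law. -/

/-- The cylinder of paths agreeing with `p` up to time `n`. -/
def cyl (n : ℕ) (p : Path) : Set Path := {X | ∀ i ≤ n, X i = p i}

/-- The path observed from time `n` on. -/
def pathShift (n : ℕ) (X : Path) : Path := fun i => X (n + i)

/-- The event `A` is determined by the path up to time `n`. -/
def PastDet (n : ℕ) (A : Set Path) : Prop :=
  ∀ X Y : Path, (∀ i ≤ n, X i = Y i) → X ∈ A → Y ∈ A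

@[fun_prop]
theorem measurable_pathShift (n : ℕ) : Measurable (pathShift n) :=
  measurable_pi_lambda _ fun _ => measurable_pi_apply _

theorem measurable_map_path {β : Type*} [MeasurableSpace β] (f : ℤ → β) (n : ℕ) :
    Measurable fun X : Path => f (X n) :=
  (measurable_of_countable f).comp (measurable_pi_apply n)

theorem PastDet.preimage {n : ℕ} {A : Set Path} (h : PastDet n A) :
    A = Preorder.frestrictLe (π := fun _ : ℕ => ℤ) n ⁻¹'
      (Preorder.frestrictLe (π := fun _ : ℕ => ℤ) n '' A) := by
  refine Set.Subset.antisymm (Set.subset_preimage_image _ _) ?_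
  rintro X ⟨Y, hY, hXY⟩
  exact h Y X (fun i hi => congrFun hXY ⟨i, Finset.mem_Iic.2 hi⟩) hY

theorem PastDet.measurableSet {n : ℕ} {A : Set Path} (h : PastDet n A) : MeasurableSet A := by
  rw [h.preimage]
  exact (Preorder.measurable_frestrictLe n) (Set.to_countable _).measurableSet

theorem PastDet.mono {n m : ℕ} {A : Set Path} (h : PastDet n A) (hnm : n ≤ m) : PastDet m A :=
  fun X Y hXY => h X Y fun i hi => hXY i (hi.trans hnm)

theorem PastDet.inter {n : ℕ} {A B : Set Path} (hA : PastDet n A) (hB : PastDet n B) :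
    PastDet n (A ∩ B) :=
  fun X Y hXY h => ⟨hA X Y hXY h.1, hB X Y hXY h.2⟩

theorem pastDet_cyl (n : ℕ) (p : Path) : PastDet n (cyl n p) :=
  fun _ _ hXY h i hi => (hXY i hi).symm.trans (h i hi)

theorem measurableSet_cyl (n : ℕ) (p : Path) : MeasurableSet (cyl n p) :=
  (pastDet_cyl n p).measurableSet

theorem pastDet_eval {n i : ℕ} (hi : i ≤ n) (S : Set ℤ) : PastDet n {X : Path | X i ∈ S} := by
  intro X Y hXY h
  have h' : X i ∈ S := h
  rw [hXY i hi] at h'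
  exact h'

theorem measurableSet_eval (i : ℕ) (S : Set ℤ) : MeasurableSet {X : Path | X i ∈ S} :=
  (pastDet_eval le_rfl S).measurableSet

/-- Since `ℤ` is countable, an event determined up to time `n` is a countable disjoint union of
cylinders of level `n`. -/
theorem eq_of_cyl_eq {μ ν : Measure Path} {n : ℕ} (h : ∀ p, μ (cyl n p) = ν (cyl n p))
    {A : Set Path} (hA : PastDet n A) : μ A = ν A := by
  have key : ∀ ρ : Measure Path, ρ A =
      ∑' q : (Preorder.frestrictLe (π := fun _ : ℕ => ℤ) n '' A),
        ρ (Preorder.frestrictLe (π := fun _ : ℕ => ℤ) n ⁻¹' {(q : Π _ : Finset.Iic n, ℤ)}) := by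
    intro ρ
    conv_lhs => rw [hA.preimage, ← Set.biUnion_preimage_singleton]
    exact measure_biUnion (Set.to_countable _)
      (fun a _ b _ hab => (Set.disjoint_singleton.2 hab).preimage _)
      fun q _ => (Preorder.measurable_frestrictLe n) (measurableSet_singleton q)
  rw [key μ, key ν]
  refine tsum_congr fun q => ?_
  obtain ⟨Y, -, hY⟩ := q.2
  have : Preorder.frestrictLe (π := fun _ : ℕ => ℤ) n ⁻¹' {(q : Π _ : Finset.Iic n, ℤ)}
      = cyl n Y := by
    ext X
    rw [Set.mem_preimage, Set.mem_singleton_iff, ← hY]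
    constructor
    · intro hX i hi
      exact congrFun hX ⟨i, Finset.mem_Iic.2 hi⟩
    · intro hX
      funext i
      exact hX i.1 (Finset.mem_Iic.1 i.2)
  rw [this, h]

theorem path_ext {μ ν : Measure Path} [IsFiniteMeasure μ]
    (h : ∀ n p, μ (cyl n p) = ν (cyl n p)) : μ = ν := by
  refine ext_of_generate_finite _ (generateFrom_measurableCylinders (α := fun _ : ℕ => ℤ)).symm
    isPiSystem_measurableCylinders ?_
    (eq_of_cyl_eq (h 0) (A := Set.univ) fun _ _ _ _ => Set.mem_univ _)
  intro C hC
  rw [measurableCylinders_nat] at hC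
  simp only [Set.mem_iUnion, Set.mem_singleton_iff] at hC
  obtain ⟨n, S, hS, rfl⟩ := hC
  refine eq_of_cyl_eq (h n) ?_
  intro X Y hXY hX
  have : (Finset.Iic n).restrict X = (Finset.Iic n).restrict Y := by
    funext i
    exact hXY i.1 (Finset.mem_Iic.1 i.2)
  rw [mem_cylinder] at hX ⊢
  rwa [← this]

theorem quenched_cyl_zero (ω : Environment) (x : ℤ) (p : Path) :
    quenched ω x (cyl 0 p) = if p 0 = x then 1 else 0 := by
  have h : (quenched ω x).map (Preorder.frestrictLe (π := fun _ : ℕ => ℤ) 0)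
      = (Measure.dirac x).map (MeasurableEquiv.piUnique (fun _ : Finset.Iic 0 => ℤ)).symm := by
    rw [quenched, Kernel.trajMeasure, Measure.map_comp _ _ (by fun_prop),
      Kernel.traj_map_frestrictLe, Kernel.partialTraj_self, Measure.id_comp]
  have h1 : cyl 0 p = Preorder.frestrictLe (π := fun _ : ℕ => ℤ) 0 ⁻¹' {fun _ => p 0} := by
    ext X
    constructor
    · intro hX
      funext ⟨i, hi⟩
      obtain rfl : i = 0 := by simpa using hi
      exact hX 0 le_rfl
    · intro hX i hi
      obtain rfl : i = 0 := by simpa using hi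
      exact congrFun hX ⟨0, Finset.mem_Iic.2 le_rfl⟩
  rw [h1, ← Measure.map_apply (Preorder.measurable_frestrictLe 0) (measurableSet_singleton _), h,
    Measure.map_apply (MeasurableEquiv.measurable _) (measurableSet_singleton _),
    Measure.dirac_apply' _ ((MeasurableEquiv.measurable _) (measurableSet_singleton _))]
  by_cases hx : p 0 = x
  · rw [if_pos hx, Set.indicator_of_mem]
    · rfl
    · rw [Set.mem_preimage, Set.mem_singleton_iff]
      funext i
      exact hx.symm
  · rw [if_neg hx, Set.indicator_of_notMem]
    intro hmem
    exact hx (congrFun hmem ⟨0, Finset.mem_Iic.2 le_rfl⟩).symm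

/-- Together with `quenched_cyl_zero` this determines the quenched law on cylinders; the Markov
property, relabelling and locality are read off from the two formulas by induction. -/
theorem quenched_cyl_succ (ω : Environment) (x : ℤ) (n : ℕ) (p : Path) :
    quenched ω x (cyl (n + 1) p) = quenched ω x (cyl n p) * transition ω (p n) {p (n + 1)} := by
  have key := Kernel.map_frestrictLe_trajMeasure_compProd_eq_map_trajMeasure
    (X := fun _ => ℤ) (μ₀ := Measure.dirac x) (κ := stepKernel ω) (a := n)
  have h1 := congrArg
    (fun μ => μ ({Preorder.frestrictLe (π := fun _ : ℕ => ℤ) n p} ×ˢ {p (n + 1)})) key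
  rw [Measure.compProd_apply_prod (measurableSet_singleton _) (measurableSet_singleton _),
    lintegral_singleton, Measure.map_apply (by fun_prop)
      ((measurableSet_singleton _).prod (measurableSet_singleton _)),
    Measure.map_apply (by fun_prop) (measurableSet_singleton _), mul_comm] at h1
  have h2 : ∀ m, cyl m p = Preorder.frestrictLe (π := fun _ : ℕ => ℤ) m ⁻¹'
      {Preorder.frestrictLe (π := fun _ : ℕ => ℤ) m p} := by
    intro m
    ext X
    constructor
    · intro hX
      funext i
      exact hX i.1 (Finset.mem_Iic.1 i.2)
    · intro hX i hi
      exact congrFun hX ⟨i, Finset.mem_Iic.2 hi⟩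
  rw [h2 n]
  refine Eq.trans (congrArg (quenched ω x) ?_) h1.symm
  ext X
  constructor
  · intro hX
    refine ⟨?_, hX (n + 1) le_rfl⟩
    funext i
    exact hX i.1 ((Finset.mem_Iic.1 i.2).trans n.le_succ)
  · rintro ⟨h3, h4⟩ i hi
    rcases Nat.lt_or_ge n i with hlt | hge
    · obtain rfl : i = n + 1 := le_antisymm hi hlt
      exact h4
    · exact congrFun h3 ⟨i, Finset.mem_Iic.2 hge⟩

theorem quenched_start (ω : Environment) (x : ℤ) : ∀ᵐ X ∂(quenched ω x), X 0 = x := by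
  have h := quenched_cyl_zero ω x fun _ => x
  rw [if_pos rfl] at h
  have h2 : (cyl 0 fun _ => x) = {X : Path | X 0 = x} := by
    ext X
    exact ⟨fun hX => hX 0 le_rfl, fun hX i hi => by
      obtain rfl : i = 0 := by simpa using hi
      exact hX⟩
  rw [h2] at h
  exact (mem_ae_iff_prob_eq_one (h2 ▸ measurableSet_cyl 0 _)).2 h

/-- Concatenation of `p` up to time `n` with `p'` from time `n` on. -/
def glue (n : ℕ) (p p' : Path) : Path := fun i => if i < n then p i else p' (i - n)

theorem cyl_inter_shift (n m : ℕ) (p p' : Path) (h : p' 0 = p n) :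
    cyl n p ∩ pathShift n ⁻¹' cyl m p' = cyl (n + m) (glue n p p') := by
  ext X
  constructor
  · rintro ⟨h1, h2⟩ i hi
    by_cases hin : i < n
    · rw [glue, if_pos hin]
      exact h1 i hin.le
    · rw [glue, if_neg hin]
      have := h2 (i - n) (by omega)
      rwa [pathShift, Nat.add_sub_cancel' (by omega)] at this
  · intro hX
    constructor
    · intro i hi
      rcases hi.lt_or_eq with hlt | rfl
      · have := hX i (by omega)
        rwa [glue, if_pos hlt] at this
      · have := hX i (by omega)
        rwa [glue, if_neg (lt_irrefl _), Nat.sub_self, h] at this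
    · intro i hi
      have := hX (n + i) (by omega)
      rwa [glue, if_neg (by omega), Nat.add_sub_cancel_left] at this

theorem quenched_cyl_glue (ω : Environment) (x : ℤ) (n m : ℕ) (p p' : Path) (h : p' 0 = p n) :
    quenched ω x (cyl (n + m) (glue n p p'))
      = quenched ω x (cyl n p) * quenched ω (p n) (cyl m p') := by
  induction m with
  | zero =>
    rw [quenched_cyl_zero, if_pos h, mul_one, ← cyl_inter_shift n 0 p p' h]
    congr 1
    refine Set.inter_eq_left.2 fun X hX i hi => ?_
    obtain rfl : i = 0 := by simpa using hi
    exact (hX n le_rfl).trans h.symm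
  | succ m ih =>
    rw [← add_assoc, quenched_cyl_succ, ih, quenched_cyl_succ, mul_assoc]
    have h1 : glue n p p' (n + m) = p' m := by simp [glue]
    have h2 : glue n p p' (n + m + 1) = p' (m + 1) := by
      rw [glue, if_neg (by omega)]
      congr 1
      omega
    rw [h1, h2]

/-- Both sides are finite measures in `B`, so it suffices to let `B` be a cylinder; there the gluing
of two path segments multiplies their weights. -/
theorem quenched_cyl_markov (ω : Environment) (x : ℤ) (n : ℕ) (p : Path) {B : Set Path}
    (hB : MeasurableSet B) :
    quenched ω x (cyl n p ∩ pathShift n ⁻¹' B)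
      = quenched ω x (cyl n p) * quenched ω (p n) B := by
  have key : ((quenched ω x).restrict (cyl n p)).map (pathShift n)
      = quenched ω x (cyl n p) • quenched ω (p n) := by
    refine path_ext fun m p' => ?_
    rw [Measure.map_apply (measurable_pathShift n) (measurableSet_cyl _ _),
      Measure.restrict_apply (measurable_pathShift n (measurableSet_cyl _ _)), Set.inter_comm,
      Measure.smul_apply, smul_eq_mul]
    by_cases h : p' 0 = p n
    · rw [cyl_inter_shift n m p p' h, quenched_cyl_glue ω x n m p p' h]
    · have h1 : cyl n p ∩ pathShift n ⁻¹' cyl m p' = ∅ := by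
        refine Set.eq_empty_of_forall_notMem fun X hX => h ?_
        rw [← hX.1 n le_rfl]
        exact (hX.2 0 (Nat.zero_le _)).symm
      have h2 : quenched ω (p n) (cyl m p') = 0 := by
        refine measure_mono_null ?_ (ae_iff.1 (quenched_start ω (p n)))
        intro X hX hX'
        exact h ((hX 0 (Nat.zero_le _)).symm.trans hX')
      rw [h1, h2, measure_empty, mul_zero]
  have := congrArg (fun μ => μ B) key
  simp only [Measure.smul_apply, smul_eq_mul] at this
  rw [← this, Measure.map_apply (measurable_pathShift n) hB,
    Measure.restrict_apply (measurable_pathShift n hB), Set.inter_comm]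

/-- The Markov property of the quenched walk at a fixed time. -/
theorem quenched_markov (ω : Environment) (x : ℤ) {n : ℕ} {A : Set Path} (hA : PastDet n A)
    (y : ℤ) (hAy : A ⊆ {X | X n = y}) {B : Set Path} (hB : MeasurableSet B) :
    quenched ω x (A ∩ pathShift n ⁻¹' B) = quenched ω x A * quenched ω y B := by
  have hE := measurableSet_eval n {y}
  -- After restriction to `X n = y` both sides are measures of the past event, which can be compared
  -- on cylinders.
  have key : ∀ p, ((quenched ω x).restrict ({X | X n ∈ ({y} : Set ℤ)} ∩ pathShift n ⁻¹' B))
      (cyl n p) = (quenched ω y B • (quenched ω x).restrict {X | X n ∈ ({y} : Set ℤ)})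
        (cyl n p) := by
    intro p
    rw [Measure.smul_apply, smul_eq_mul, Measure.restrict_apply (measurableSet_cyl _ _),
      Measure.restrict_apply (measurableSet_cyl _ _)]
    by_cases h : p n = y
    · have h1 : cyl n p ∩ {X | X n ∈ ({y} : Set ℤ)} = cyl n p :=
        Set.inter_eq_left.2 fun X hX => (hX n le_rfl).trans h
      rw [← Set.inter_assoc, h1, quenched_cyl_markov ω x n p hB, h, mul_comm]
    · have h1 : cyl n p ∩ {X | X n ∈ ({y} : Set ℤ)} = ∅ :=
        Set.eq_empty_of_forall_notMem fun X hX => h ((hX.1 n le_rfl).symm.trans hX.2)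
      rw [← Set.inter_assoc, h1, Set.empty_inter, measure_empty, mul_zero]
  have h2 := eq_of_cyl_eq key hA
  have h3 : A ∩ {X | X n ∈ ({y} : Set ℤ)} = A := Set.inter_eq_left.2 hAy
  rw [Measure.smul_apply, smul_eq_mul, Measure.restrict_apply hA.measurableSet,
    Measure.restrict_apply hA.measurableSet, ← Set.inter_assoc, h3] at h2
  rw [h2, mul_comm]

/-- Relabelling the sites by `e` relabels the walk. -/
theorem quenched_relabel {ω ω' : Environment} (e : ℤ ≃ ℤ)
    (h : ∀ a b, transition ω' (e a) {e b} = transition ω a {b}) (x : ℤ) :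
    quenched ω' (e x) = (quenched ω x).map fun X n => e (X n) := by
  have hm : Measurable fun (X : Path) (n : ℕ) => e (X n) :=
    measurable_pi_lambda _ fun n => measurable_map_path e n
  refine path_ext fun n p => ?_
  rw [Measure.map_apply hm (measurableSet_cyl _ _)]
  have h1 : ∀ n, (fun (X : Path) (n : ℕ) => e (X n)) ⁻¹' cyl n p = cyl n fun i => e.symm (p i) := by
    intro n
    ext X
    exact forall₂_congr fun i _ => by rw [Equiv.eq_symm_apply]
  rw [h1]
  induction n with
  | zero => rw [quenched_cyl_zero, quenched_cyl_zero]; simp only [Equiv.symm_apply_eq]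
  | succ n ih => rw [quenched_cyl_succ, quenched_cyl_succ, ih, ← h]; simp

/-- The walk up to time `n` only sees the environment at the sites it has visited before `n`. -/
theorem quenched_local {ω ω' : Environment} {S : Set ℤ} (h : ∀ a ∈ S, ω a = ω' a) (x : ℤ) {n : ℕ}
    {A : Set Path} (hA : PastDet n A) (hAS : ∀ X ∈ A, ∀ i < n, X i ∈ S) :
    quenched ω x A = quenched ω' x A := by
  have cyls : ∀ m p, (∀ i < m, p i ∈ S) → quenched ω x (cyl m p) = quenched ω' x (cyl m p) := by
    intro m p
    induction m with
    | zero => intro _; rw [quenched_cyl_zero, quenched_cyl_zero]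
    | succ m ih =>
      intro hp
      rw [quenched_cyl_succ, quenched_cyl_succ, ih fun i hi => hp i (by omega), transition,
        transition, h _ (hp m (by omega))]
  have hS : PastDet n {X : Path | ∀ i < n, X i ∈ S} := by
    intro X Y hXY hX i hi
    rw [← hXY i hi.le]
    exact hX i hi
  have key : ∀ p, (quenched ω x).restrict {X : Path | ∀ i < n, X i ∈ S} (cyl n p)
      = (quenched ω' x).restrict {X : Path | ∀ i < n, X i ∈ S} (cyl n p) := by
    intro p
    rw [Measure.restrict_apply (measurableSet_cyl _ _),
      Measure.restrict_apply (measurableSet_cyl _ _)]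
    by_cases hp : ∀ i < n, p i ∈ S
    · have : cyl n p ∩ {X : Path | ∀ i < n, X i ∈ S} = cyl n p :=
        Set.inter_eq_left.2 fun X hX i hi => by rw [hX i hi.le]; exact hp i hi
      rw [this, cyls n p hp]
    · have : cyl n p ∩ {X : Path | ∀ i < n, X i ∈ S} = ∅ :=
        Set.eq_empty_of_forall_notMem fun X hX => hp fun i hi => by
          rw [← hX.1 i hi.le]; exact hX.2 i hi
      rw [this, measure_empty, measure_empty]
  have h2 := eq_of_cyl_eq key hA
  rw [Measure.restrict_apply hA.measurableSet, Measure.restrict_apply hA.measurableSet] at h2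
  have h3 : A ∩ {X : Path | ∀ i < n, X i ∈ S} = A := Set.inter_eq_left.2 hAS
  rwa [h3] at h2

/-- The walk confined to `S` only sees the environment on `S`. -/
theorem quenched_local_confined {ω ω' : Environment} {S : Set ℤ} (h : ∀ a ∈ S, ω a = ω' a) (x : ℤ)
    {B : Set Path} (hB : MeasurableSet B) :
    quenched ω x (B ∩ {X | ∀ i, X i ∈ S}) = quenched ω' x (B ∩ {X | ∀ i, X i ∈ S}) := by
  have hS : ∀ n, PastDet n {X : Path | ∀ i ≤ n, X i ∈ S} := by
    intro n X Y hXY hX i hi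
    rw [← hXY i hi]
    exact hX i hi
  have hSeq : {X : Path | ∀ i, X i ∈ S} = ⋂ n : ℕ, {X : Path | ∀ i ≤ n, X i ∈ S} := by
    ext X
    simp only [Set.mem_iInter]
    exact ⟨fun hX n i _ => hX i, fun hX i => hX i i le_rfl⟩
  have hSm : MeasurableSet {X : Path | ∀ i, X i ∈ S} := by
    rw [hSeq]
    exact MeasurableSet.iInter fun n => (hS n).measurableSet
  have key : (quenched ω x).restrict {X : Path | ∀ i, X i ∈ S}
      = (quenched ω' x).restrict {X : Path | ∀ i, X i ∈ S} := by
    refine path_ext fun n p => ?_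
    rw [Measure.restrict_apply (measurableSet_cyl _ _),
      Measure.restrict_apply (measurableSet_cyl _ _)]
    have h1 : cyl n p ∩ {X : Path | ∀ i, X i ∈ S}
        = ⋂ m : ℕ, cyl n p ∩ {X : Path | ∀ i ≤ n + m, X i ∈ S} := by
      rw [← Set.inter_iInter]
      congr 1
      ext X
      simp only [Set.mem_iInter]
      exact ⟨fun hX n i _ => hX i, fun hX i => hX i i (by omega)⟩
    -- Confinement for all times is the decreasing limit of confinement up to time `n + m`, to which
    -- `quenched_local` applies.
    have hd : Antitone fun m : ℕ => cyl n p ∩ {X : Path | ∀ i ≤ n + m, X i ∈ S} :=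
      fun a b hab => Set.inter_subset_inter_right _ fun X hX i hi => hX i (by omega)
    have hdet : ∀ m, PastDet (n + m) (cyl n p ∩ {X : Path | ∀ i ≤ n + m, X i ∈ S}) :=
      fun m => ((pastDet_cyl n p).mono (by omega)).inter (hS _)
    rw [h1, hd.measure_iInter (fun m => (hdet m).measurableSet.nullMeasurableSet)
      ⟨0, measure_ne_top _ _⟩, hd.measure_iInter
      (fun m => (hdet m).measurableSet.nullMeasurableSet) ⟨0, measure_ne_top _ _⟩]
    exact iInf_congr fun m => quenched_local h x (hdet m) fun X hX i hi => hX.2 i hi.le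
  rw [← Measure.restrict_apply hB, key, Measure.restrict_apply hB]

theorem lintegral_eval (μ : Measure Path) (n : ℕ) (f : ℤ → ℝ≥0∞) :
    ∫⁻ X, f (X n) ∂μ = ∑' y, f y * μ {X | X n = y} := by
  have h := lintegral_map (μ := μ) (measurable_of_countable f) (measurable_pi_apply n)
  rw [← h, lintegral_countable']
  exact tsum_congr fun y => by
    rw [Measure.map_apply (measurable_pi_apply n) (measurableSet_singleton _)]
    rfl

theorem measure_eq_tsum_eval (μ : Measure Path) (n : ℕ) (G : Set Path) :
    μ G = ∑' y, μ (G ∩ {X | X n = y}) := by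
  have h := lintegral_eval (μ.restrict G) n fun _ => 1
  simp only [lintegral_const, one_mul, Measure.restrict_apply_univ] at h
  rw [h]
  exact tsum_congr fun y => by
    rw [Set.inter_comm]
    exact Measure.restrict_apply (measurableSet_eval n {y})

/-- The Markov property at a fixed time, in integrated form. -/
theorem quenched_markov_lintegral (ω : Environment) (x : ℤ) {n : ℕ} {A : Set Path}
    (hA : PastDet n A) {B : Set Path} (hB : MeasurableSet B) :
    quenched ω x (A ∩ pathShift n ⁻¹' B) = ∫⁻ X in A, quenched ω (X n) B ∂(quenched ω x) := by
  rw [lintegral_eval _ n fun y => quenched ω y B,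
    measure_eq_tsum_eval _ n (A ∩ pathShift n ⁻¹' B)]
  refine tsum_congr fun y => ?_
  have hy := pastDet_eval (le_refl n) {y}
  have h1 := Measure.restrict_apply (μ := quenched ω x) (s := A) hy.measurableSet
  rw [Set.inter_comm] at h1
  rw [mul_comm, Set.inter_right_comm]
  refine Eq.trans ?_ (congrArg (· * quenched ω y B) h1.symm)
  exact quenched_markov ω x (hA.inter hy) y Set.inter_subset_right hB

/-- Lévy's zero-one law for the quenched walk. -/
theorem quenched_levy (ω : Environment) (x : ℤ) {E B : Set Path} (hE : MeasurableSet E)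
    (hB : MeasurableSet B) {m : ℕ} (hEB : ∀ n, m ≤ n → pathShift n ⁻¹' B ⊆ E) :
    ∀ᵐ X ∂(quenched ω x), X ∉ E → Tendsto (fun n => quenched ω (X n) B) atTop (𝓝 0) := by
  set μ := quenched ω x
  let ℱ : Filtration ℕ (MeasurableSpace.pi : MeasurableSpace Path) := Filtration.piLE
  have hℱ : ∀ n (s : Set Path), MeasurableSet[ℱ n] s → PastDet n s := by
    rintro n s ⟨t, -, rfl⟩ X Y hXY hX
    have : Preorder.restrictLe (π := fun _ : ℕ => ℤ) n X
        = Preorder.restrictLe (π := fun _ : ℕ => ℤ) n Y := by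
      funext i
      exact hXY i.1 i.2
    rw [Set.mem_preimage] at hX ⊢
    rwa [← this]
  have heval : ∀ n, Measurable[ℱ n] fun X : Path => X n := by
    rintro n t ht
    have h1 : Measurable fun z : Set.Iic n → ℤ => z ⟨n, Set.mem_Iic.2 le_rfl⟩ :=
      measurable_pi_apply _
    exact ⟨_, h1 ht, rfl⟩
  have hsup : ⨆ n, ℱ n = (MeasurableSpace.pi : MeasurableSpace Path) := by
    refine le_antisymm (iSup_le fun n => ℱ.le n) ?_
    refine iSup_le fun n => le_trans ?_ (le_iSup (fun n => (ℱ n)) n)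
    rintro s ⟨t, ht, rfl⟩
    exact heval n ht
  have hEint : Integrable (E.indicator fun _ => (1 : ℝ)) μ :=
    (integrable_const 1).indicator hE
  have hlim := hEint.tendsto_ae_condExp (ℱ := ℱ)
    (by rw [hsup]; exact stronglyMeasurable_const.indicator hE)
  -- By the Markov property the left side is the conditional probability of `pathShift n ⁻¹' B`, an
  -- event contained in `E`. The right side converges to the indicator of `E`, which vanishes off
  -- `E`.
  have hle : ∀ n, m ≤ n → ∀ᵐ X ∂μ, (quenched ω (X n) B).toReal
      ≤ (μ[E.indicator fun _ => (1 : ℝ)|ℱ n]) X := by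
    intro n hn
    have hBn := measurable_pathShift n hB
    have hBint : Integrable ((pathShift n ⁻¹' B).indicator fun _ => (1 : ℝ)) μ :=
      (integrable_const 1).indicator hBn
    have hmeas : Measurable[ℱ n] fun X : Path => (quenched ω (X n) B).toReal :=
      (measurable_of_countable fun y => (quenched ω y B).toReal).comp (heval n)
    have hgint : Integrable (fun X : Path => (quenched ω (X n) B).toReal) μ := by
      refine Integrable.of_bound (hmeas.mono (ℱ.le n) le_rfl).aestronglyMeasurable 1 ?_
      refine Eventually.of_forall fun X => ?_
      rw [Real.norm_of_nonneg ENNReal.toReal_nonneg]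
      exact measureReal_le_one
    have h2 : (fun X : Path => (quenched ω (X n) B).toReal)
        =ᵐ[μ] μ[(pathShift n ⁻¹' B).indicator fun _ => (1 : ℝ)|ℱ n] := by
      refine ae_eq_condExp_of_forall_setIntegral_eq (ℱ.le n) hBint
        (fun s _ _ => hgint.integrableOn) ?_ hmeas.stronglyMeasurable.aestronglyMeasurable
      intro s hs _
      have h3 := quenched_markov_lintegral ω x (hℱ n s hs) hB
      rw [integral_indicator hBn, setIntegral_const, smul_eq_mul, mul_one,
        integral_toReal (measurable_map_path (fun y => quenched ω y B) n).aemeasurable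
          (Eventually.of_forall fun X => measure_lt_top _ _), ← h3, measureReal_def,
        Measure.restrict_apply hBn, Set.inter_comm]
    have h4 : (pathShift n ⁻¹' B).indicator (fun _ => (1 : ℝ))
        ≤ᵐ[μ] E.indicator fun _ => (1 : ℝ) :=
      Eventually.of_forall fun X =>
        Set.indicator_le_indicator_of_subset (hEB n hn) (fun _ => zero_le_one) X
    filter_upwards [h2, condExp_mono hBint hEint h4 (m := ℱ n)] with X h5 h6
    exact h5.trans_le h6
  have hle' : ∀ᵐ X ∂μ, ∀ n, m ≤ n → (quenched ω (X n) B).toReal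
      ≤ (μ[E.indicator fun _ => (1 : ℝ)|ℱ n]) X :=
    ae_all_iff.2 fun n => by
      by_cases hn : m ≤ n
      · filter_upwards [hle n hn] with X hX _ using hX
      · exact Eventually.of_forall fun X h => absurd h hn
  filter_upwards [hlim, hle'] with X h1 h2 hX
  rw [Set.indicator_of_notMem hX] at h1
  have h3 : Tendsto (fun n => (quenched ω (X n) B).toReal) atTop (𝓝 0) :=
    tendsto_of_tendsto_of_tendsto_of_le_of_le' tendsto_const_nhds h1
      (Eventually.of_forall fun n => ENNReal.toReal_nonneg)
      ((eventually_ge_atTop m).mono fun n hn => h2 n hn)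
  exact (ENNReal.tendsto_toReal_zero_iff fun n => measure_ne_top _ _).1 h3

/-! ### Standing assumptions, translation, reflection, and the averaged law of the walk. -/

/-- The standing assumptions on the law of the environment, with jumps bounded by `J`. -/
structure Admissible (P : Measure Environment) (J : ℕ) : Prop where
  iid : ∃ μ : Measure (ProbabilityMeasure ℤ), IsProbabilityMeasure μ ∧
    P = Measure.infinitePi fun _ : ℤ => μ
  irreducible : IsIrreducible P
  jumps : ∀ᵐ ω ∂P, ∀ x, ∀ᵐ X ∂(quenched ω x), ∀ n, |X (n + 1) - X n| ≤ (J : ℤ)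
  pos : 0 < J

theorem Admissible.isProbabilityMeasure {P : Measure Environment} {J : ℕ} (h : Admissible P J) :
    IsProbabilityMeasure P := by
  obtain ⟨μ, _, hP⟩ := h.iid
  rw [hP]
  infer_instance

theorem IsIID.eq_infinitePi {P : Measure Environment} [IsProbabilityMeasure P] (h : IsIID P) :
    ∃ μ : Measure (ProbabilityMeasure ℤ), IsProbabilityMeasure μ ∧
      P = Measure.infinitePi fun _ : ℤ => μ := by
  refine ⟨P.map fun ω => ω 0, Measure.isProbabilityMeasure_map
    (measurable_pi_apply 0).aemeasurable, ?_⟩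
  have h1 := (iIndepFun_iff_map_fun_eq_infinitePi_map
    (fun x : ℤ => measurable_pi_apply x)).1 h.1
  have h2 : (fun x : ℤ => P.map fun ω : Environment => ω x) = fun _ => P.map fun ω => ω 0 :=
    funext fun x => (h.2 x 0).map_eq
  rw [h2] at h1
  exact (Measure.map_id).symm.trans h1

theorem jumps_of_transition {ω : Environment} {J : ℕ}
    (h : ∀ a b : ℤ, ¬ |b - a| ≤ (J : ℤ) → transition ω a {b} = 0) (x : ℤ) :
    ∀ᵐ X ∂(quenched ω x), ∀ n, |X (n + 1) - X n| ≤ (J : ℤ) := by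
  refine ae_all_iff.2 fun n => ?_
  have hA : PastDet (n + 1) {X : Path | ¬ |X (n + 1) - X n| ≤ (J : ℤ)} := by
    intro X Y hXY hX
    have hX' : ¬ |X (n + 1) - X n| ≤ (J : ℤ) := hX
    rwa [hXY _ le_rfl, hXY n n.le_succ] at hX'
  have key : ∀ p, (quenched ω x).restrict {X : Path | ¬ |X (n + 1) - X n| ≤ (J : ℤ)} (cyl (n + 1) p)
      = (0 : Measure Path) (cyl (n + 1) p) := by
    intro p
    rw [Measure.restrict_apply (measurableSet_cyl _ _), Measure.coe_zero, Pi.zero_apply]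
    by_cases hp : |p (n + 1) - p n| ≤ (J : ℤ)
    · have : cyl (n + 1) p ∩ {X : Path | ¬ |X (n + 1) - X n| ≤ (J : ℤ)} = ∅ :=
        Set.eq_empty_of_forall_notMem fun X hX => hX.2 <| by
          rw [hX.1 _ le_rfl, hX.1 n n.le_succ]
          exact hp
      rw [this, measure_empty]
    · refine measure_mono_null Set.inter_subset_left ?_
      rw [quenched_cyl_succ, h _ _ hp, mul_zero]
  have h2 := eq_of_cyl_eq key hA
  rw [Measure.restrict_apply hA.measurableSet, Set.inter_self] at h2
  exact ae_iff.2 h2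

theorem admissible_of_hypotheses {P : Measure Environment} [IsProbabilityMeasure P]
    (h1 : IsIID P) (h2 : IsIrreducible P) (h3 : HasBoundedJumps P) : ∃ J, Admissible P J := by
  obtain ⟨L, R, h⟩ := h3
  refine ⟨L + R + 1, h1.eq_infinitePi, h2, ?_, Nat.succ_pos _⟩
  filter_upwards [h] with ω hω x
  refine jumps_of_transition (fun a b hab => hω a b fun hb => hab ?_) x
  rw [abs_le]
  obtain ⟨h4, h5⟩ := hb
  push_cast
  constructor <;> omega

/-- Translation of the environment. -/
def envShift (k : ℤ) (ω : Environment) : Environment := fun x => ω (x + k)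

@[fun_prop]
theorem measurable_envShift (k : ℤ) : Measurable (envShift k) :=
  measurable_pi_lambda _ fun _ => measurable_pi_apply _

theorem Admissible.measurePreserving_envShift {P : Measure Environment} {J : ℕ}
    (h : Admissible P J) (k : ℤ) : MeasurePreserving (envShift k) P P := by
  refine ⟨measurable_envShift k, ?_⟩
  obtain ⟨μ, _, rfl⟩ := h.iid
  exact Measure.map_infinitePi_infinitePi_of_inj (f := fun x : ℤ => x + k)
    (add_left_injective k)

theorem transition_singleton (ω : Environment) (a b : ℤ) :
    transition ω a {b} = ((ω a : ProbabilityMeasure ℤ) : Measure ℤ) {b - a} := by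
  rw [transition, Measure.map_apply (measurable_of_countable _) (measurableSet_singleton _)]
  congr 1
  ext y
  simp only [Set.mem_preimage, Set.mem_singleton_iff]
  omega

theorem quenched_envShift (ω : Environment) (k x : ℤ) {B : Set Path} (hB : MeasurableSet B) :
    quenched (envShift k ω) x B = quenched ω (x + k) {X | (fun n => X n - k) ∈ B} := by
  have h := quenched_relabel (ω := ω) (ω' := envShift k ω) (Equiv.subRight k) (fun a b => by
    rw [transition_singleton, transition_singleton, envShift]
    simp) (x + k)
  have h0 : Equiv.subRight k (x + k) = x := by simp
  rw [h0] at h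
  rw [h, Measure.map_apply (measurable_pi_lambda _ fun n => measurable_map_path _ n) hB]
  rfl

/-- Reflection of the environment. -/
noncomputable def envFlip (ω : Environment) : Environment := fun x =>
  (ω (-x)).map (f := fun y : ℤ => -y) (measurable_of_countable _).aemeasurable

theorem measurable_probFlip : Measurable fun ν : ProbabilityMeasure ℤ =>
    ν.map (f := fun y : ℤ => -y) (measurable_of_countable _).aemeasurable :=
  ((Measure.measurable_map _ (measurable_of_countable _)).comp measurable_subtype_coe).subtype_mk

@[fun_prop]
theorem measurable_envFlip : Measurable envFlip :=
  measurable_pi_lambda _ fun x => measurable_probFlip.comp (measurable_pi_apply (-x))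

theorem quenched_envFlip (ω : Environment) (x : ℤ) {B : Set Path} (hB : MeasurableSet B) :
    quenched (envFlip ω) x B = quenched ω (-x) {X | (fun n => -X n) ∈ B} := by
  have h := quenched_relabel (ω := ω) (ω' := envFlip ω) (Equiv.neg ℤ) (fun a b => by
    rw [transition_singleton, transition_singleton, envFlip, ProbabilityMeasure.toMeasure_map,
      Measure.map_apply (measurable_of_countable _) (measurableSet_singleton _)]
    simp only [Equiv.neg_apply, neg_neg]
    congr 1
    ext y
    simp only [Set.mem_preimage, Set.mem_singleton_iff]
    omega) (-x)
  have h0 : Equiv.neg ℤ (-x) = x := by simp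
  rw [h0] at h
  rw [h, Measure.map_apply (measurable_pi_lambda _ fun n => measurable_map_path _ n) hB]
  rfl

theorem measurableSet_jumps (J : ℕ) : MeasurableSet {X : Path | ∀ n, |X (n + 1) - X n| ≤ (J : ℤ)} := by
  have : {X : Path | ∀ n, |X (n + 1) - X n| ≤ (J : ℤ)} = ⋂ n, {X : Path | |X (n + 1) - X n| ≤ (J : ℤ)} := by
    ext X
    simp only [Set.mem_iInter]
    rfl
  rw [this]
  refine MeasurableSet.iInter fun n => PastDet.measurableSet (n := n + 1) ?_
  intro X Y hXY hX
  have hX' : |X (n + 1) - X n| ≤ (J : ℤ) := hX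
  rwa [hXY _ le_rfl, hXY n n.le_succ] at hX'

/-- All assumptions are symmetric under reflection, which is why a single bound `J` serves for both
directions; statements about leftward motion then follow from the rightward ones. -/
theorem Admissible.flip {P : Measure Environment} {J : ℕ} (h : Admissible P J) :
    Admissible (P.map envFlip) J := by
  refine ⟨?_, ?_, ?_, h.pos⟩
  · obtain ⟨μ, hμ, rfl⟩ := h.iid
    refine ⟨μ.map fun ν => ν.map (f := fun y : ℤ => -y)
      (measurable_of_countable _).aemeasurable,
      Measure.isProbabilityMeasure_map measurable_probFlip.aemeasurable, ?_⟩
    have h1 := Measure.map_infinitePi_infinitePi_of_inj (P := fun _ : ℤ => μ)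
      (f := fun x : ℤ => -x) neg_injective
    have h2 := Measure.infinitePi_map_pi (μ := fun _ : ℤ => μ)
      (f := fun (_ : ℤ) (ν : ProbabilityMeasure ℤ) => ν.map (f := fun y : ℤ => -y)
        (measurable_of_countable _).aemeasurable) (fun _ => measurable_probFlip)
    rw [← h2]
    conv_rhs => rw [← h1]
    rw [Measure.map_map (by
      exact measurable_pi_lambda _ fun x => measurable_probFlip.comp (measurable_pi_apply x))
      (by exact measurable_pi_lambda _ fun x => measurable_pi_apply _)]
    rfl
  · refine (ae_map_iff measurable_envFlip.aemeasurable ?_).2 ?_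
    · have : {ω : Environment | ∀ x y : ℤ, ∃ n : ℕ, 0 < quenched ω x {X | X n = y}}
          = ⋂ x : ℤ, ⋂ y : ℤ, ⋃ n : ℕ, {ω | 0 < quenched ω x {X | X n = y}} := by
        ext ω
        simp only [Set.mem_iInter, Set.mem_iUnion]
        rfl
      rw [this]
      refine MeasurableSet.iInter fun x => MeasurableSet.iInter fun y => MeasurableSet.iUnion
        fun n => measurableSet_lt measurable_const
          ((Measure.measurable_coe (measurableSet_eval n {y})).comp (measurable_quenched x))
    · filter_upwards [h.irreducible] with ω hω x y
      obtain ⟨n, hn⟩ := hω (-x) (-y)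
      refine ⟨n, ?_⟩
      have := quenched_envFlip ω x (measurableSet_eval n {y})
      refine lt_of_lt_of_eq ?_ this.symm
      refine hn.trans_le (measure_mono fun X hX => ?_)
      have hX' : X n = -y := hX
      change -X n = y
      omega
  · have hm : Measurable fun (X : Path) (n : ℕ) => -X n :=
      measurable_pi_lambda _ fun n => measurable_map_path _ n
    refine (ae_map_iff measurable_envFlip.aemeasurable ?_).2 ?_
    · have : {ω : Environment | ∀ x, ∀ᵐ X ∂(quenched ω x), ∀ n, |X (n + 1) - X n| ≤ (J : ℤ)}
          = ⋂ x : ℤ, {ω | quenched ω x {X : Path | ∀ n, |X (n + 1) - X n| ≤ (J : ℤ)}ᶜ = 0} := by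
        ext ω
        simp only [Set.mem_iInter]
        rfl
      rw [this]
      exact MeasurableSet.iInter fun x => measurableSet_eq_fun
        ((Measure.measurable_coe (measurableSet_jumps J).compl).comp (measurable_quenched x))
          measurable_const
    · filter_upwards [h.jumps] with ω hω x
      have h1 := quenched_envFlip ω x (measurableSet_jumps J).compl
      refine h1.trans (measure_mono_null ?_ (hω (-x)))
      intro X hX hX'
      refine hX fun n => ?_
      have := hX' n
      rw [← abs_neg]
      convert this using 2
      ring

/-- The law of the walk started at `x`, averaged over the environment. -/
noncomputable def pathLaw (P : Measure Environment) (x : ℤ) : Measure Path :=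
  P.bind (quenchedKernel x)

theorem pathLaw_apply (P : Measure Environment) (x : ℤ) {B : Set Path} (hB : MeasurableSet B) :
    pathLaw P x B = ∫⁻ ω, quenched ω x B ∂P :=
  Measure.bind_apply hB (Kernel.aemeasurable _)

theorem measurable_quenched_apply (x : ℤ) {B : Set Path} (hB : MeasurableSet B) :
    Measurable fun ω => quenched ω x B :=
  (Measure.measurable_coe hB).comp (measurable_quenched x)

instance (P : Measure Environment) [IsProbabilityMeasure P] (x : ℤ) :
    IsProbabilityMeasure (pathLaw P x) :=
  ⟨by rw [pathLaw_apply P x MeasurableSet.univ]; simp⟩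

theorem pathLaw_eq_zero_iff {P : Measure Environment} {x : ℤ} {B : Set Path}
    (hB : MeasurableSet B) : pathLaw P x B = 0 ↔ ∀ᵐ ω ∂P, quenched ω x B = 0 := by
  rw [pathLaw_apply P x hB, lintegral_eq_zero_iff (measurable_quenched_apply x hB)]
  rfl

theorem ae_pathLaw_of_ae {P : Measure Environment} {x : ℤ} {B : Set Path}
    (hB : MeasurableSet B) (h : ∀ᵐ ω ∂P, ∀ᵐ X ∂(quenched ω x), X ∈ B) :
    ∀ᵐ X ∂(pathLaw P x), X ∈ B := by
  refine (pathLaw_eq_zero_iff hB.compl).2 ?_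
  filter_upwards [h] with ω hω using hω

theorem ae_annealed_of_ae {P : Measure Environment} [IsProbabilityMeasure P] {x : ℤ}
    {p : Path → Prop} (h : ∀ᵐ X ∂(pathLaw P x), p X) : ∀ᵐ q ∂(annealed P x), p q.2 := by
  have h1 : pathLaw P x = (annealed P x).map Prod.snd :=
    (Measure.snd_compProd P (quenchedKernel x)).symm
  rw [h1] at h
  exact ae_of_ae_map measurable_snd.aemeasurable h

/-- Stationarity of the environment: after averaging, the law of the displacement does not depend on
the starting site. -/
theorem pathLaw_translate {P : Measure Environment} {J : ℕ} (h : Admissible P J) (x : ℤ)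
    {B : Set Path} (hB : MeasurableSet B) :
    ∫⁻ ω, quenched ω x {X | (fun n => X n - x) ∈ B} ∂P = pathLaw P 0 B := by
  have h1 := (h.measurePreserving_envShift x).lintegral_comp (measurable_quenched_apply 0 hB)
  rw [pathLaw_apply P 0 hB, ← h1]
  refine lintegral_congr fun ω => ?_
  rw [quenched_envShift ω x 0 hB, zero_add]

theorem pathLaw_flip (P : Measure Environment) {B : Set Path} (hB : MeasurableSet B) :
    pathLaw (P.map envFlip) 0 B = pathLaw P 0 {X | (fun n => -X n) ∈ B} := by
  have hm : Measurable fun (X : Path) (n : ℕ) => -X n :=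
    measurable_pi_lambda _ fun n => measurable_map_path _ n
  have hm2 : MeasurableSet {X : Path | (fun n => -X n) ∈ B} := hm hB
  rw [pathLaw_apply _ 0 hB, pathLaw_apply P 0 hm2,
    lintegral_map (measurable_quenched_apply 0 hB) measurable_envFlip]
  exact lintegral_congr fun ω => by rw [quenched_envFlip ω 0 hB, neg_zero]

/-! ### Independence of disjoint parts of the environment and the zero-one law. -/

/-- `f` only depends on the environment on `S`. -/
def EnvDep {β : Type*} (S : Set ℤ) (f : Environment → β) : Prop :=
  ∀ ω ω' : Environment, (∀ a ∈ S, ω a = ω' a) → f ω = f ω'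

/-- Freezing the coordinates outside `U` at a fixed value does not change `k`, and the freezing map
is measurable for the coordinates in `U`. -/
theorem EnvDep.comap_le {δ : Type*} [MeasurableSpace δ] {k : Environment → δ} {U : Set ℤ}
    (hkU : EnvDep U k) (hk : Measurable k) : MeasurableSpace.comap k inferInstance
      ≤ ⨆ x ∈ U, MeasurableSpace.comap (fun ω : Environment => ω x) inferInstance := by
  classical
  let ω₀ : Environment := fun _ => ⟨Measure.dirac 0, inferInstance⟩
  let t : Environment → Environment := fun ω x => if x ∈ U then ω x else ω₀ x
  have hkt : k = k ∘ t := funext fun ω => hkU _ _ fun a ha => by simp [t, ha]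
  have ht : Measurable[⨆ x ∈ U, MeasurableSpace.comap (fun ω : Environment => ω x)
      inferInstance] t := by
    refine @measurable_pi_lambda _ _ _ (_) _ _ fun x => ?_
    by_cases hx : x ∈ U
    · simp only [t, hx, if_true]
      exact Measurable.mono (comap_measurable fun ω : Environment => ω x)
        (le_iSup₂ (f := fun x (_ : x ∈ U) => MeasurableSpace.comap
          (fun ω : Environment => ω x) inferInstance) x hx) le_rfl
    · simp only [t, hx, if_false]
      exact measurable_const
  rw [hkt]
  exact (hk.comp ht).comap_le

theorem Admissible.indepFun {P : Measure Environment} {J : ℕ} (h : Admissible P J)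
    {S T : Set ℤ} (hST : Disjoint S T) {β γ : Type*} [MeasurableSpace β] [MeasurableSpace γ]
    {f : Environment → β} {g : Environment → γ} (hf : Measurable f) (hg : Measurable g)
    (hfS : EnvDep S f) (hgT : EnvDep T g) : IndepFun f g P := by
  have hind : iIndepFun (fun (x : ℤ) (ω : Environment) => ω x) P := by
    obtain ⟨μ, hμ, rfl⟩ := h.iid
    exact iIndepFun_infinitePi (X := fun _ => id) fun _ => measurable_id
  have h1 := indep_iSup_of_disjoint (fun x => (measurable_pi_apply x).comap_le) hind hST
  exact indep_of_indep_of_le_left (indep_of_indep_of_le_right h1 (hgT.comap_le hg)) (hfS.comap_le hf)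

theorem Admissible.lintegral_mul {P : Measure Environment} {J : ℕ} (h : Admissible P J)
    {S T : Set ℤ} (hST : Disjoint S T) {f g : Environment → ℝ≥0∞} (hf : Measurable f)
    (hg : Measurable g) (hfS : EnvDep S f) (hgT : EnvDep T g) :
    ∫⁻ ω, f ω * g ω ∂P = (∫⁻ ω, f ω ∂P) * ∫⁻ ω, g ω ∂P :=
  lintegral_mul_eq_lintegral_mul_lintegral_of_indepFun hf hg (h.indepFun hST hf hg hfS hgT)

/-- Zero-one law for translation invariant events. -/
theorem Admissible.zero_one {P : Measure Environment} {J : ℕ} (h : Admissible P J)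
    {A : Set Environment} (hA : MeasurableSet A)
    (hinv : ∀ k : ℕ, envShift k ⁻¹' A =ᵐ[P] A) : P A = 0 ∨ P A = 1 := by
  have := h.isProbabilityMeasure
  -- Approximate `A` within `ε` by a cylinder `C`, and shift so far that `C` and its translate are
  -- independent. Then `P A = P (A ∩ θ⁻¹ A)` is within `2 ε` of `(P C)²`, which is within `2 ε` of
  -- `(P A)²`.
  have key : ∀ ε : ℝ, 0 < ε → |P.real A - P.real A * P.real A| ≤ 4 * ε := by
    intro ε hε
    obtain ⟨C, hC, hCA⟩ := exists_measure_symmDiff_lt_of_generateFrom_isSetRing (μ := P)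
      (isSetRing_measurableCylinders (α := fun _ : ℤ => ProbabilityMeasure ℤ))
      ⟨{Set.univ}, Set.countable_singleton _, by
        simpa using univ_mem_measurableCylinders (fun _ : ℤ => ProbabilityMeasure ℤ), by simp⟩
      (generateFrom_measurableCylinders (α := fun _ : ℤ => ProbabilityMeasure ℤ)).symm hA
      (ε := ENNReal.ofReal ε) (by simpa using hε)
    obtain ⟨s, S, hS, rfl⟩ := (mem_measurableCylinders C).1 hC
    set C : Set Environment := cylinder s S
    have hCm : MeasurableSet C := MeasurableSet.cylinder s hS
    have hCdep : ∀ ω ω' : Environment, (∀ a ∈ s, ω a = ω' a) → ω ∈ C → ω' ∈ C := by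
      intro ω ω' hω hC
      have : s.restrict ω = s.restrict ω' := funext fun i => hω i.1 i.2
      rw [mem_cylinder] at hC ⊢
      rwa [← this]
    obtain ⟨k, hk⟩ : ∃ k : ℕ, ∀ a ∈ s, a + (k : ℤ) ∉ s := by
      obtain ⟨N, hN⟩ : ∃ N : ℕ, ∀ a ∈ s, |a| < N := by
        refine ⟨∑ a ∈ s, a.natAbs + 1, fun a ha => ?_⟩
        have := Finset.single_le_sum (f := Int.natAbs) (fun _ _ => Nat.zero_le _) ha
        zify at this
        push_cast
        omega
      -- A shift by `2 N` moves `(-N, N)` off itself.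
      refine ⟨2 * N, fun a ha ha' => ?_⟩
      have h1 := abs_lt.1 (hN a ha)
      have h2 := abs_lt.1 (hN _ ha')
      push_cast at h2
      omega
    have hind : P (C ∩ envShift k ⁻¹' C) = P C * P C := by
      have h1 : IndepFun (C.indicator fun _ => (1 : ℕ))
          ((envShift k ⁻¹' C).indicator fun _ => (1 : ℕ)) P := by
        refine h.indepFun (S := s) (T := (fun a => a + (k : ℤ)) '' s) ?_
          (measurable_const.indicator hCm)
          (measurable_const.indicator (measurable_envShift k hCm)) ?_ ?_
        · rw [Set.disjoint_left]
          rintro _ hb ⟨a, ha, rfl⟩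
          exact hk a ha hb
        · intro ω ω' hω
          by_cases hc : ω ∈ C
          · rw [Set.indicator_of_mem hc, Set.indicator_of_mem (hCdep _ _ hω hc)]
          · rw [Set.indicator_of_notMem hc, Set.indicator_of_notMem fun h' =>
              hc (hCdep _ _ (fun a ha => (hω a ha).symm) h')]
        · intro ω ω' hω
          have hω' : ∀ a ∈ s, envShift k ω a = envShift k ω' a := fun a ha => hω _ ⟨a, ha, rfl⟩
          by_cases hc : ω ∈ envShift k ⁻¹' C
          · rw [Set.indicator_of_mem hc, Set.indicator_of_mem
              (show ω' ∈ envShift k ⁻¹' C from hCdep _ _ hω' hc)]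
          · rw [Set.indicator_of_notMem hc, Set.indicator_of_notMem
              (show ω' ∉ envShift k ⁻¹' C from fun h' =>
                hc (hCdep _ _ (fun a ha => (hω' a ha).symm) h'))]
      have h2 := h1.measure_inter_preimage_eq_mul {1} {1} (measurableSet_singleton _)
        (measurableSet_singleton _)
      have h3 : ∀ D : Set Environment, (D.indicator fun _ => (1 : ℕ)) ⁻¹' {1} = D := by
        intro D
        ext ω
        by_cases hω : ω ∈ D <;> simp [hω]
      rw [h3, h3, (h.measurePreserving_envShift k).measure_preimage hCm.nullMeasurableSet] at h2
      exact h2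
    have hr : ∀ D E : Set Environment, P.real D ≤ P.real E + P.real (symmDiff E D) := by
      intro D E
      refine (measureReal_mono (s₂ := E ∪ symmDiff E D) ?_).trans (measureReal_union_le _ _)
      intro ω hω
      by_cases hE : ω ∈ E
      · exact Or.inl hE
      · exact Or.inr (Or.inr ⟨hω, hE⟩)
    have hsmall : P.real (symmDiff C A) ≤ ε :=
      ENNReal.toReal_le_of_le_ofReal hε.le hCA.le
    have hA2 : P.real (A ∩ envShift k ⁻¹' A) = P.real A := by
      refine measureReal_congr ?_
      filter_upwards [hinv k] with ω hω
      have hω' : (ω ∈ envShift k ⁻¹' A) = (ω ∈ A) := hω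
      change (ω ∈ A ∧ ω ∈ envShift k ⁻¹' A) = (ω ∈ A)
      rw [hω', and_self]
    have hsd : P.real (symmDiff (C ∩ envShift k ⁻¹' C) (A ∩ envShift k ⁻¹' A)) ≤ 2 * ε := by
      have h4 : symmDiff (C ∩ envShift k ⁻¹' C) (A ∩ envShift k ⁻¹' A)
          ⊆ symmDiff C A ∪ envShift k ⁻¹' (symmDiff C A) := by
        rintro ω (⟨⟨h1, h2⟩, h3⟩ | ⟨⟨h1, h2⟩, h3⟩)
        · by_cases hω : ω ∈ A
          · exact Or.inr (Or.inl ⟨h2, fun h' => h3 ⟨hω, h'⟩⟩)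
          · exact Or.inl (Or.inl ⟨h1, hω⟩)
        · by_cases hω : ω ∈ C
          · exact Or.inr (Or.inr ⟨h2, fun h' => h3 ⟨hω, h'⟩⟩)
          · exact Or.inl (Or.inr ⟨h1, hω⟩)
      have hm : MeasurableSet (symmDiff C A) := hCm.symmDiff hA
      have h5 : P.real (envShift k ⁻¹' (symmDiff C A)) = P.real (symmDiff C A) := by
        rw [measureReal_def, measureReal_def,
          (h.measurePreserving_envShift k).measure_preimage hm.nullMeasurableSet]
      calc _ ≤ P.real (symmDiff C A ∪ envShift k ⁻¹' (symmDiff C A)) := measureReal_mono h4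
        _ ≤ _ := measureReal_union_le _ _
        _ ≤ 2 * ε := by rw [h5]; linarith
    have hindr : P.real (C ∩ envShift k ⁻¹' C) = P.real C * P.real C := by
      rw [measureReal_def, hind, ENNReal.toReal_mul, measureReal_def]
    have e1 := hr A C
    have e2 := hr C A
    have e3 := hr (A ∩ envShift k ⁻¹' A) (C ∩ envShift k ⁻¹' C)
    have e4 := hr (C ∩ envShift k ⁻¹' C) (A ∩ envShift k ⁻¹' A)
    rw [symmDiff_comm] at e2 e4
    rw [hA2, hindr] at e3 e4
    have a0 : 0 ≤ P.real A := measureReal_nonneg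
    have a1 : P.real A ≤ 1 := measureReal_le_one
    have c0 : 0 ≤ P.real C := measureReal_nonneg
    have c1 : P.real C ≤ 1 := measureReal_le_one
    have e5 : |P.real A - P.real C| ≤ ε := abs_le.2 ⟨by linarith, by linarith⟩
    have e6 : |P.real C * P.real C - P.real A * P.real A| ≤ 2 * ε := by
      have : P.real C * P.real C - P.real A * P.real A
          = -((P.real A - P.real C) * (P.real A + P.real C)) := by ring
      rw [this, abs_neg, abs_mul, mul_comm]
      exact mul_le_mul (abs_le.2 ⟨by linarith, by linarith⟩) e5 (abs_nonneg _) (by norm_num)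
    have e7 := abs_le.1 e6
    exact abs_le.2 ⟨by linarith, by linarith⟩
  have h0 : P.real A * (1 - P.real A) = 0 := by
    have h1 : |P.real A - P.real A * P.real A| ≤ 0 := by
      refine le_of_forall_pos_le_add fun ε hε => ?_
      have := key (ε / 4) (by linarith)
      linarith
    have h2 := abs_eq_zero.1 (le_antisymm h1 (abs_nonneg _))
    linarith
  rcases mul_eq_zero.1 h0 with h1 | h1
  · exact Or.inl ((measureReal_eq_zero_iff).1 h1)
  · right
    rw [← ENNReal.toReal_eq_one_iff]
    rw [measureReal_def] at h1
    linarith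

/-! ### Escape to one side or recurrence. -/

/-- The walk tends to `+∞`. -/
def escapesRight : Set Path := {X | Tendsto X atTop atTop}

/-- The walk tends to `-∞`. -/
def escapesLeft : Set Path := {X | Tendsto X atTop atBot}

theorem measurableSet_escapesRight : MeasurableSet escapesRight := by
  have : escapesRight = ⋂ M : ℤ, ⋃ N : ℕ, ⋂ n : ℕ, ⋂ _ : N ≤ n, {X : Path | X n ∈ Set.Ici M} := by
    ext X
    simp only [Set.mem_iInter, Set.mem_iUnion]
    exact tendsto_atTop_atTop
  rw [this]
  exact MeasurableSet.iInter fun M => MeasurableSet.iUnion fun N => MeasurableSet.iInter fun n =>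
    MeasurableSet.iInter fun _ => measurableSet_eval n _

theorem measurableSet_escapesLeft : MeasurableSet escapesLeft := by
  have : escapesLeft = ⋂ M : ℤ, ⋃ N : ℕ, ⋂ n : ℕ, ⋂ _ : N ≤ n, {X : Path | X n ∈ Set.Iic M} := by
    ext X
    simp only [Set.mem_iInter, Set.mem_iUnion]
    exact tendsto_atTop_atBot
  rw [this]
  exact MeasurableSet.iInter fun M => MeasurableSet.iUnion fun N => MeasurableSet.iInter fun n =>
    MeasurableSet.iInter fun _ => measurableSet_eval n _

theorem tendsto_pathShift_iff {X : Path} {l : Filter ℤ} (n : ℕ) :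
    Tendsto (pathShift n X) atTop l ↔ Tendsto X atTop l := by
  have : pathShift n X = fun i => X (i + n) := funext fun i => by rw [pathShift, add_comm]
  rw [this]
  exact tendsto_add_atTop_iff_nat n

theorem tendsto_sub_const_atTop_iff {X : Path} (k : ℤ) :
    Tendsto (fun n => X n - k) atTop atTop ↔ Tendsto X atTop atTop := by
  constructor
  · intro h
    have := tendsto_atTop_add_const_right _ k h
    simpa using this
  · intro h
    have := tendsto_atTop_add_const_right _ (-k) h
    simpa [sub_eq_add_neg] using this

theorem tendsto_sub_const_atBot_iff {X : Path} (k : ℤ) :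
    Tendsto (fun n => X n - k) atTop atBot ↔ Tendsto X atTop atBot := by
  constructor
  · intro h
    have := tendsto_atBot_add_const_right _ k h
    simpa using this
  · intro h
    have := tendsto_atBot_add_const_right _ (-k) h
    simpa [sub_eq_add_neg] using this

/-- If no site is visited infinitely often, then `|X n|` tends to infinity; once it exceeds `J` for
good, no jump can change the sign of `X n`. -/
theorem frequently_or_escapes {X : Path} {J : ℤ} (hJ : ∀ n, |X (n + 1) - X n| ≤ J) :
    X ∈ escapesRight ∨ X ∈ escapesLeft ∨ ∃ z, ∃ᶠ n in atTop, X n = z := by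
  by_cases hz : ∃ z, ∃ᶠ n in atTop, X n = z
  · exact Or.inr (Or.inr hz)
  have hz' : ∀ z, ∀ᶠ n in atTop, X n ≠ z := fun z =>
    not_frequently.1 fun h => hz ⟨z, h⟩
  have hout : ∀ M : ℤ, ∀ᶠ n in atTop, M < |X n| := by
    intro M
    have h1 : ∀ᶠ n in atTop, ∀ z ∈ Set.Icc (-M) M, X n ≠ z :=
      (eventually_all_finite (Set.finite_Icc _ _)).2 fun z _ => hz' z
    filter_upwards [h1] with n hn
    by_contra hcon
    exact hn (X n) (abs_le.1 (not_lt.1 hcon)) rfl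
  obtain ⟨N, hN⟩ := eventually_atTop.1 (hout J)
  have hJ0 : 0 ≤ J := (abs_nonneg _).trans (hJ 0)
  rcases le_total 0 (X N) with h0 | h0
  · left
    have hpos : ∀ n, N ≤ n → 0 ≤ X n := by
      intro n hn
      induction n, hn using Nat.le_induction with
      | base => exact h0
      | succ n hn ih =>
        have h1 := hN n hn
        rw [abs_of_nonneg ih] at h1
        have h2 := (abs_le.1 (hJ n)).1
        omega
    refine tendsto_atTop.2 fun M => ?_
    filter_upwards [hout M, eventually_ge_atTop N] with n h1 h2
    rw [abs_of_nonneg (hpos n h2)] at h1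
    exact h1.le
  · right; left
    have hneg : ∀ n, N ≤ n → X n ≤ 0 := by
      intro n hn
      induction n, hn using Nat.le_induction with
      | base => exact h0
      | succ n hn ih =>
        have h1 := hN n hn
        rw [abs_of_nonpos ih] at h1
        have h2 := (abs_le.1 (hJ n)).2
        omega
    refine tendsto_atBot.2 fun M => ?_
    filter_upwards [hout (-M), eventually_ge_atTop N] with n h1 h2
    rw [abs_of_nonpos (hneg n h2)] at h1
    omega

/-- From `y` the walk reaches `x` with positive probability and then realises `B`; stability under
the time shift discards the initial segment. -/
theorem quenched_pos_of_pos {ω : Environment}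
    (hω : ∀ x y : ℤ, ∃ n : ℕ, 0 < quenched ω x {X | X n = y}) {B : Set Path}
    (hB : MeasurableSet B) (hshift : ∀ n, pathShift n ⁻¹' B ⊆ B) {x : ℤ}
    (hx : 0 < quenched ω x B) (y : ℤ) : 0 < quenched ω y B := by
  obtain ⟨n, hn⟩ := hω y x
  have h := quenched_markov ω y (pastDet_eval (le_refl n) {x}) x (fun X hX => hX) hB
  have h1 : 0 < quenched ω y {X | X n ∈ ({x} : Set ℤ)} * quenched ω x B :=
    ENNReal.mul_pos hn.ne' hx.ne'
  rw [← h] at h1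
  exact h1.trans_le (measure_mono (Set.inter_subset_right.trans (hshift n)))

/-- A translation invariant tail event has positive probability in almost every environment, or
in almost no environment. -/
theorem Admissible.pos_or_zero {P : Measure Environment} {J : ℕ} (h : Admissible P J)
    {B : Set Path} (hB : MeasurableSet B) (hshift : ∀ n, pathShift n ⁻¹' B ⊆ B)
    (htrans : ∀ k : ℤ, {X : Path | (fun n => X n - k) ∈ B} = B) :
    (∀ᵐ ω ∂P, ∀ x, 0 < quenched ω x B) ∨ (∀ᵐ ω ∂P, ∀ x, quenched ω x B = 0) := by
  have := h.isProbabilityMeasure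
  have hA : MeasurableSet {ω | 0 < quenched ω 0 B} :=
    measurableSet_lt measurable_const (measurable_quenched_apply 0 hB)
  -- Shifting the environment amounts to moving the starting point, and irreducibility makes
  -- positivity independent of that point.
  have hinv : ∀ k : ℕ, envShift k ⁻¹' {ω | 0 < quenched ω 0 B} =ᵐ[P] {ω | 0 < quenched ω 0 B} := by
    intro k
    filter_upwards [h.irreducible] with ω hirr
    refine propext ?_
    change 0 < quenched (envShift k ω) 0 B ↔ 0 < quenched ω 0 B
    rw [quenched_envShift ω k 0 hB, htrans]
    exact ⟨fun hk => quenched_pos_of_pos hirr hB hshift hk 0,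
      fun hk => quenched_pos_of_pos hirr hB hshift hk _⟩
  rcases h.zero_one hA hinv with h0 | h1
  · right
    have h2 : ∀ᵐ ω ∂P, ¬ 0 < quenched ω 0 B := by
      rw [ae_iff]
      simpa only [not_not] using h0
    filter_upwards [h2, h.irreducible] with ω hω hirr x
    by_contra hx
    exact hω (quenched_pos_of_pos hirr hB hshift (pos_iff_ne_zero.2 hx) 0)
  · left
    have h2 : ∀ᵐ ω ∂P, 0 < quenched ω 0 B := (mem_ae_iff_prob_eq_one hA).2 h1
    filter_upwards [h2, h.irreducible] with ω hω hirr x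
    exact quenched_pos_of_pos hirr hB hshift hω x

/-- The first entrance below `-N + J` overshoots by at most `J`. Taking `N` beyond the range of the
first `n₀` steps makes this entrance late. -/
theorem exists_visit_block {X : Path} {J : ℕ} (hJ : ∀ n, |X (n + 1) - X n| ≤ (J : ℤ))
    (hX : X ∈ escapesLeft) (n₀ : ℕ) :
    ∀ᶠ N : ℕ in atTop, ∃ n, n₀ ≤ n ∧ -(N : ℤ) ≤ X n ∧ X n < -(N : ℤ) + J := by
  obtain ⟨b, hb⟩ : ∃ b : ℕ, ∀ n ≤ n₀, -(b : ℤ) ≤ X n := by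
    refine ⟨∑ i ∈ Finset.range (n₀ + 1), (X i).natAbs, fun n hn => ?_⟩
    have := Finset.single_le_sum (f := fun i => (X i).natAbs) (fun _ _ => Nat.zero_le _)
      (Finset.mem_range.2 (Nat.lt_succ_of_le hn))
    zify at this
    push_cast
    have h2 := neg_abs_le (X n)
    linarith
  filter_upwards [eventually_ge_atTop (b + J)] with N hN
  have hex : ∃ n, X n < -(N : ℤ) + J := by
    obtain ⟨n, hn⟩ := (tendsto_atBot.1 hX (-(N : ℤ) + J - 1)).exists
    exact ⟨n, by omega⟩
  classical
  have h1 := Nat.find_spec hex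
  have h2 : n₀ < Nat.find hex := by
    by_contra hcon
    have := hb _ (not_lt.1 hcon)
    omega
  refine ⟨Nat.find hex, h2.le, ?_, h1⟩
  have h3 := Nat.find_min hex (m := Nat.find hex - 1) (by omega)
  have h4 := (abs_le.1 (hJ (Nat.find hex - 1))).1
  rw [Nat.sub_add_cancel (by omega)] at h4
  omega

/-- Let `m k` be the product of the probabilities of escaping right from the sites of `[k, k + J)`.
Along a path that escapes left, Lévy's law sends the probability of escaping right from `X n` to
`0`, and the path meets every far block `[-N, -N + J)` at a late time. So `m (-N)` tends to `0`
almost surely; by stationarity its mean is constant, hence zero, although `m 0` is positive. -/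
theorem Admissible.not_both_escape {P : Measure Environment} {J : ℕ} (h : Admissible P J)
    (hR : ∀ᵐ ω ∂P, ∀ x, 0 < quenched ω x escapesRight)
    (hL : ∀ᵐ ω ∂P, ∀ x, 0 < quenched ω x escapesLeft) : False := by
  have := h.isProbabilityMeasure
  let m : ℤ → Environment → ℝ≥0∞ := fun k ω =>
    ∏ j ∈ Finset.range J, quenched ω (k + (j : ℤ)) escapesRight
  have hm : ∀ k, Measurable (m k) := fun k => Finset.measurable_prod _ fun j _ =>
    measurable_quenched_apply _ measurableSet_escapesRight
  have hm1 : ∀ k ω, m k ω ≤ 1 := fun k ω => Finset.prod_le_one' fun j _ => prob_le_one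
  have hmle : ∀ k ω (y : ℤ), k ≤ y → y < k + J → m k ω ≤ quenched ω y escapesRight := by
    intro k ω y h1 h2
    have hmem : (y - k).toNat ∈ Finset.range J := Finset.mem_range.2 (by omega)
    have h3 : quenched ω y escapesRight
        = quenched ω (k + ((y - k).toNat : ℤ)) escapesRight := by
      congr 1
      congr 1
      omega
    rw [h3, show m k ω = _ from (Finset.mul_prod_erase _ (fun j : ℕ =>
      quenched ω (k + (j : ℤ)) escapesRight) hmem).symm]
    exact mul_le_of_le_one_right' (Finset.prod_le_one' fun j _ => prob_le_one)
  have hlim : ∀ᵐ ω ∂P, Tendsto (fun N : ℕ => m (-(N : ℤ)) ω) atTop (𝓝 0) := by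
    filter_upwards [hL, h.jumps] with ω h1 h2
    have h3 := quenched_levy ω 0 (E := escapesRight) (m := 0) measurableSet_escapesRight
      measurableSet_escapesRight fun n _ X hX => (tendsto_pathShift_iff n).1 hX
    obtain ⟨X, hX, hXJ, hXlim⟩ := Measure.exists_mem_of_measure_ne_zero_of_ae (h1 0).ne'
      (ae_restrict_of_ae ((h2 0).and h3))
    have hXR : X ∉ escapesRight := fun hX' => hX'.not_tendsto disjoint_atTop_atBot hX
    have h4 := hXlim hXR
    rw [ENNReal.tendsto_atTop_zero] at h4 ⊢
    intro ε hε
    obtain ⟨n₀, hn₀⟩ := h4 ε hε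
    obtain ⟨N₀, hN₀⟩ := eventually_atTop.1 (exists_visit_block hXJ hX n₀)
    refine ⟨N₀, fun N hN => ?_⟩
    obtain ⟨n, h5, h6, h7⟩ := hN₀ N hN
    exact (hmle _ ω (X n) h6 h7).trans (hn₀ n h5)
  have hint : ∀ k, ∫⁻ ω, m k ω ∂P = ∫⁻ ω, m 0 ω ∂P := by
    intro k
    rw [← (h.measurePreserving_envShift k).lintegral_comp (hm 0)]
    refine lintegral_congr fun ω => Finset.prod_congr rfl fun j _ => ?_
    rw [quenched_envShift ω k _ measurableSet_escapesRight]
    have : {X : Path | (fun n => X n - k) ∈ escapesRight} = escapesRight :=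
      Set.ext fun X => tendsto_sub_const_atTop_iff k
    rw [this, zero_add, add_comm]
  have hlim2 := tendsto_lintegral_of_dominated_convergence (μ := P) (fun _ => 1)
    (fun N : ℕ => hm (-(N : ℤ))) (fun N => Eventually.of_forall (hm1 _)) (by simp) hlim
  simp only [hint, lintegral_const, zero_mul] at hlim2
  have h0 : ∫⁻ ω, m 0 ω ∂P = 0 := tendsto_nhds_unique tendsto_const_nhds hlim2
  rw [lintegral_eq_zero_iff (hm 0)] at h0
  obtain ⟨ω, h1, h2⟩ := (hR.and h0).exists
  have h3 : m 0 ω ≠ 0 := Finset.prod_ne_zero_iff.2 fun j _ => (h1 _).ne'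
  exact h3 h2

/-- Infinitely many visits to `z` would keep the sequence equal to a fixed positive number
infinitely often. -/
theorem not_frequently_of_pos {ω : Environment} {B : Set Path} (hpos : ∀ x, 0 < quenched ω x B)
    {X : Path} (h : Tendsto (fun n => quenched ω (X n) B) atTop (𝓝 0)) (z : ℤ) :
    ¬ ∃ᶠ n in atTop, X n = z := by
  intro hz
  obtain ⟨n, h1, h2⟩ := (hz.and_eventually (h.eventually (gt_mem_nhds (hpos z)))).exists
  rw [h1] at h2
  exact lt_irrefl _ h2

theorem measurableSet_frequently (z : ℤ) : MeasurableSet {X : Path | ∃ᶠ n in atTop, X n = z} := by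
  have : {X : Path | ∃ᶠ n in atTop, X n = z}
      = ⋂ m : ℕ, ⋃ n : ℕ, ⋃ _ : m ≤ n, {X : Path | X n ∈ ({z} : Set ℤ)} := by
    ext X
    simp only [Set.mem_iInter, Set.mem_iUnion]
    refine frequently_atTop.trans (forall_congr' fun a => exists_congr fun b => ?_)
    exact ⟨fun h => ⟨h.1, h.2⟩, fun ⟨h1, h2⟩ => ⟨h1, h2⟩⟩
  rw [this]
  exact MeasurableSet.iInter fun _ => MeasurableSet.iUnion fun n => MeasurableSet.iUnion fun _ =>
    measurableSet_eval n _

/-- The walk tends to `+∞`, or to `-∞`, or visits its starting point infinitely often. -/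
theorem Admissible.trichotomy {P : Measure Environment} {J : ℕ} (h : Admissible P J) :
    (∀ᵐ X ∂(pathLaw P 0), X ∈ escapesRight) ∨ (∀ᵐ X ∂(pathLaw P 0), X ∈ escapesLeft) ∨
      (∀ᵐ X ∂(pathLaw P 0), ∃ᶠ n in atTop, X n = 0) := by
  have hRm := measurableSet_escapesRight
  have hLm := measurableSet_escapesLeft
  have hRs : ∀ n, pathShift n ⁻¹' escapesRight ⊆ escapesRight :=
    fun n X hX => (tendsto_pathShift_iff n).1 hX
  have hLs : ∀ n, pathShift n ⁻¹' escapesLeft ⊆ escapesLeft :=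
    fun n X hX => (tendsto_pathShift_iff n).1 hX
  have dR := h.pos_or_zero hRm hRs fun k => Set.ext fun X => tendsto_sub_const_atTop_iff k
  have dL := h.pos_or_zero hLm hLs fun k => Set.ext fun X => tendsto_sub_const_atBot_iff k
  rcases dR with hR | hR
  · rcases dL with hL | hL
    · exact (h.not_both_escape hR hL).elim
    · left
      refine ae_pathLaw_of_ae hRm ?_
      filter_upwards [hR, hL, h.jumps] with ω h1 h2 h3
      filter_upwards [h3 0, quenched_levy ω 0 (m := 0) hRm hRm fun n _ => hRs n,
        measure_eq_zero_iff_ae_notMem.1 (h2 0)] with X h4 h5 h6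
      by_contra hX
      rcases frequently_or_escapes h4 with h7 | h7 | ⟨z, hz⟩
      · exact hX h7
      · exact h6 h7
      · exact not_frequently_of_pos h1 (h5 hX) z hz
  · rcases dL with hL | hL
    · right; left
      refine ae_pathLaw_of_ae hLm ?_
      filter_upwards [hR, hL, h.jumps] with ω h1 h2 h3
      filter_upwards [h3 0, quenched_levy ω 0 (m := 0) hLm hLm fun n _ => hLs n,
        measure_eq_zero_iff_ae_notMem.1 (h1 0)] with X h4 h5 h6
      by_contra hX
      rcases frequently_or_escapes h4 with h7 | h7 | ⟨z, hz⟩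
      · exact h6 h7
      · exact hX h7
      · exact not_frequently_of_pos h2 (h5 hX) z hz
    · right; right
      refine ae_pathLaw_of_ae (measurableSet_frequently 0) ?_
      filter_upwards [hR, hL, h.jumps, h.irreducible] with ω h1 h2 h3 h4
      have hEm : ∀ m : ℕ, MeasurableSet {X : Path | ∃ n, m ≤ n ∧ X n = 0} := by
        intro m
        have : {X : Path | ∃ n, m ≤ n ∧ X n = 0}
            = ⋃ n : ℕ, ⋃ _ : m ≤ n, {X : Path | X n ∈ ({0} : Set ℤ)} := by
          ext X
          simp only [Set.mem_iUnion]
          exact exists_congr fun n => ⟨fun h => ⟨h.1, h.2⟩, fun ⟨h1, h2⟩ => ⟨h1, h2⟩⟩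
        rw [this]
        exact MeasurableSet.iUnion fun n => MeasurableSet.iUnion fun _ => measurableSet_eval n _
      -- The event is now a visit to `0` at or after time `m`. By irreducibility `0` can be reached
      -- from every site, so missing this event is incompatible with infinitely many visits to any
      -- `z`.
      have hlevy := ae_all_iff.2 fun m : ℕ => quenched_levy ω 0 (m := m) (hEm m) (hEm 0)
        fun n hn X ⟨i, _, hi⟩ => ⟨n + i, by omega, hi⟩
      have hpos : ∀ x, 0 < quenched ω x {X : Path | ∃ n, 0 ≤ n ∧ X n = 0} := by
        intro x
        obtain ⟨n, hn⟩ := h4 x 0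
        exact hn.trans_le (measure_mono fun X hX => ⟨n, Nat.zero_le _, hX⟩)
      filter_upwards [h3 0, hlevy, measure_eq_zero_iff_ae_notMem.1 (h1 0),
        measure_eq_zero_iff_ae_notMem.1 (h2 0)] with X h5 h6 h7 h8
      obtain ⟨z, hz⟩ := ((frequently_or_escapes h5).resolve_left h7).resolve_left h8
      refine frequently_atTop.2 fun m => ?_
      by_contra hX
      exact not_frequently_of_pos hpos (h6 m hX) z hz

/-! ### Cut times and the renewal identity. -/

/-- The path stays at or above its level `x`. -/
def stayAbove (x : ℤ) : Set Path := {X | ∀ i, X i ∈ Set.Ici x}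

theorem measurableSet_stayAbove (x : ℤ) : MeasurableSet (stayAbove x) := by
  have : stayAbove x = ⋂ i : ℕ, {X : Path | X i ∈ Set.Ici x} := by
    ext X
    simp only [Set.mem_iInter]
    rfl
  rw [this]
  exact MeasurableSet.iInter fun i => measurableSet_eval i _

theorem measurable_path_sub (k : ℤ) : Measurable fun (X : Path) (n : ℕ) => X n - k :=
  measurable_pi_lambda _ fun n => measurable_map_path (fun z => z - k) n

/-- The path seen from its position at time `s`. -/
def recenter (s : ℕ) (X : Path) : Path := fun i => X (s + i) - X s

theorem measurable_recenter (s : ℕ) : Measurable (recenter s) := by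
  refine measurable_pi_lambda _ fun i => ?_
  have h : Measurable fun X : Path => (X (s + i), X s) :=
    (measurable_pi_apply _).prodMk (measurable_pi_apply _)
  exact (measurable_of_countable fun z : ℤ × ℤ => z.1 - z.2).comp h

theorem recenter_recenter (s t : ℕ) (X : Path) :
    recenter t (recenter s X) = recenter (s + t) X := by
  funext i
  simp only [recenter, add_assoc]
  ring

/-- The time `s` is a cut time: the path is below `X s` before `s`, and not below it afterwards. -/
def IsCut (s : ℕ) (X : Path) : Prop := (∀ j < s, X j < X s) ∧ ∀ j, X s ≤ X (s + j)

theorem IsCut.recenter_iff {s t : ℕ} {X : Path} (h : IsCut s X) :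
    IsCut t (recenter s X) ↔ IsCut (s + t) X := by
  constructor
  · rintro ⟨h1, h2⟩
    have h0 : X s ≤ X (s + t) := h.2 t
    refine ⟨fun j hj => ?_, fun j => ?_⟩
    · rcases lt_or_ge j s with hjs | hjs
      · exact (h.1 j hjs).trans_le h0
      · have := h1 (j - s) (by omega)
        simp only [recenter, Nat.add_sub_cancel' hjs] at this
        omega
    · have := h2 j
      simp only [recenter, ← add_assoc] at this
      omega
  · rintro ⟨h1, h2⟩
    refine ⟨fun j hj => ?_, fun j => ?_⟩
    · have := h1 (s + j) (by omega)
      simp only [recenter]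
      omega
    · have := h2 j
      simp only [recenter, ← add_assoc]
      omega

theorem IsCut.lt {s t : ℕ} {X : Path} (h : IsCut t X) (hst : s < t) : X s < X t := h.1 s hst

/-- The time `s` is a cut time with position `a`. -/
def cutAt (s : ℕ) (a : ℤ) : Set Path := {X | IsCut s X ∧ X s = a}

/-- The path runs in `[0, a)` before time `s` and is at `a` at time `s`. -/
def firstPassage (s : ℕ) (a : ℤ) : Set Path := {X | (∀ j < s, 0 ≤ X j ∧ X j < a) ∧ X s = a}

theorem pastDet_firstPassage (s : ℕ) (a : ℤ) : PastDet s (firstPassage s a) := by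
  rintro X Y hXY ⟨h1, h2⟩
  refine ⟨fun j hj => ?_, ?_⟩
  · rw [← hXY j hj.le]
    exact h1 j hj
  · rw [← hXY s le_rfl]
    exact h2

theorem measurableSet_cutAt (s : ℕ) (a : ℤ) : MeasurableSet (cutAt s a) := by
  have h : cutAt s a = {X : Path | (∀ j < s, X j < X s) ∧ X s = a} ∩
      ⋂ j : ℕ, {X : Path | X s ≤ X (s + j)} := by
    ext X
    simp only [Set.mem_inter_iff, Set.mem_iInter]
    exact ⟨fun h => ⟨⟨h.1.1, h.2⟩, h.1.2⟩, fun h => ⟨⟨h.1.1, h.2⟩, h.1.2⟩⟩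
  rw [h]
  refine MeasurableSet.inter (PastDet.measurableSet (n := s) ?_) (MeasurableSet.iInter fun j =>
    PastDet.measurableSet (n := s + j) ?_)
  · rintro X Y hXY ⟨h1, h2⟩
    refine ⟨fun j hj => ?_, ?_⟩
    · rw [← hXY j hj.le, ← hXY s le_rfl]
      exact h1 j hj
    · rw [← hXY s le_rfl]
      exact h2
  · intro X Y hXY hX
    have hX' : X s ≤ X (s + j) := hX
    rwa [hXY s (by omega), hXY _ le_rfl] at hX'

/-- For a confined path, a cut at `s` separates into a condition on the past, spent in `[0, a)`, and
a condition on the future, spent in `[a, ∞)`. The two use disjoint sets of sites. -/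
theorem stayAbove_inter_cutAt {s : ℕ} {a : ℤ} (ha : 0 ≤ a) (E B : Set Path) :
    stayAbove 0 ∩ (E ∩ cutAt s a ∩ recenter s ⁻¹' B)
      = (E ∩ firstPassage s a) ∩ pathShift s ⁻¹' {X | (fun n => X n - a) ∈ stayAbove 0 ∩ B} := by
  ext X
  constructor
  · rintro ⟨h1, ⟨h2, h3, h4⟩, h5⟩
    refine ⟨⟨h2, fun j hj => ⟨h1 j, ?_⟩, h4⟩, ?_, ?_⟩
    · rw [← h4]
      exact h3.1 j hj
    · intro i
      have := h3.2 i
      change 0 ≤ X (s + i) - a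
      omega
    · rw [← h4]
      exact h5
  · rintro ⟨⟨h2, h3, h4⟩, h5, h6⟩
    have h7 : ∀ i, a ≤ X (s + i) := fun i => by
      have : 0 ≤ X (s + i) - a := h5 i
      omega
    refine ⟨fun i => ?_, ⟨h2, ⟨fun j hj => ?_, fun j => ?_⟩, h4⟩, ?_⟩
    · change 0 ≤ X i
      rcases lt_or_ge i s with hi | hi
      · exact (h3 i hi).1
      · have := h7 (i - s)
        rw [Nat.add_sub_cancel' hi] at this
        omega
    · rw [h4]
      exact (h3 j hj).2
    · rw [h4]
      exact h7 j
    · rw [← h4] at h6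
      exact h6

/-- The renewal structure at a cut time. -/
theorem Admissible.renewal {P : Measure Environment} {J : ℕ} (h : Admissible P J) {s : ℕ} {a : ℤ}
    (ha : 0 ≤ a) {E : Set Path} (hE : PastDet s E) {B : Set Path} (hB : MeasurableSet B) :
    pathLaw P 0 (stayAbove 0 ∩ (E ∩ cutAt s a ∩ recenter s ⁻¹' B))
      = pathLaw P 0 (E ∩ firstPassage s a) * pathLaw P 0 (stayAbove 0 ∩ B) := by
  have hEF := hE.inter (pastDet_firstPassage s a)
  have hDB := (measurableSet_stayAbove 0).inter hB
  have hG : MeasurableSet {X : Path | (fun n => X n - a) ∈ stayAbove 0 ∩ B} :=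
    measurable_path_sub a hDB
  rw [stayAbove_inter_cutAt ha, ← pathLaw_translate h a hDB,
    pathLaw_apply P 0 (hEF.measurableSet.inter (measurable_pathShift s hG)),
    pathLaw_apply P 0 hEF.measurableSet]
  -- The jump law at `a` itself is first used at time `s`, so it belongs to the second factor.
  rw [← h.lintegral_mul (S := Set.Iio a) (T := Set.Ici a)
    (Set.disjoint_left.2 fun x (h1 : x < a) (h2 : a ≤ x) => absurd h1 (not_lt.2 h2))
    (measurable_quenched_apply 0 hEF.measurableSet) (measurable_quenched_apply a hG)]
  · exact lintegral_congr fun ω => quenched_markov ω 0 hEF a (fun X hX => hX.2.2) hG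
  · intro ω ω' hω
    exact quenched_local hω 0 hEF fun X hX i hi => (hX.2.1 i hi).2
  · intro ω ω' hω
    have h1 := quenched_local_confined hω a hG
    have h2 : {X : Path | (fun n => X n - a) ∈ stayAbove 0 ∩ B} ∩ {X | ∀ i, X i ∈ Set.Ici a}
        = {X : Path | (fun n => X n - a) ∈ stayAbove 0 ∩ B} := by
      refine Set.inter_eq_left.2 fun X hX i => ?_
      have : 0 ≤ X i - a := hX.1 i
      change a ≤ X i
      omega
    rwa [h2] at h1

theorem exists_forall_le_of_escapesRight {X : Path} (h : X ∈ escapesRight) :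
    ∃ n, ∀ i, X n ≤ X i := by
  have h' : Tendsto X cofinite atTop := by
    rw [Nat.cofinite_eq_atTop]
    exact h
  exact h'.exists_forall_le

/-- A translation invariant event that is stable under the time shift and is negligible for the
walk confined to the right of its starting point is negligible. -/
theorem Admissible.null_of_confined {P : Measure Environment} {J : ℕ} (h : Admissible P J)
    (hR : ∀ᵐ X ∂(pathLaw P 0), X ∈ escapesRight) {B : Set Path} (hB : MeasurableSet B)
    (htrans : ∀ (k : ℤ) (X : Path), (fun n => X n - k) ∈ B ↔ X ∈ B)
    (hshift : ∀ (n : ℕ) (X : Path), X ∈ B → pathShift n X ∈ B)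
    (h0 : pathLaw P 0 (stayAbove 0 ∩ B) = 0) : pathLaw P 0 B = 0 := by
  have hDB := (measurableSet_stayAbove 0).inter hB
  have key : ∀ (n : ℕ) (y : ℤ), pathLaw P 0 ({X : Path | X n ∈ ({y} : Set ℤ)} ∩
      pathShift n ⁻¹' {X | (fun n => X n - y) ∈ stayAbove 0 ∩ B}) = 0 := by
    intro n y
    have hG : MeasurableSet {X : Path | (fun n => X n - y) ∈ stayAbove 0 ∩ B} :=
      measurable_path_sub y hDB
    have h1 := pathLaw_translate h y hDB
    rw [h0, lintegral_eq_zero_iff (measurable_quenched_apply y hG)] at h1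
    rw [pathLaw_eq_zero_iff ((measurableSet_eval n _).inter (measurable_pathShift n hG))]
    filter_upwards [h1] with ω hω
    rw [quenched_markov ω 0 (pastDet_eval le_rfl {y}) y (fun X hX => hX) hG]
    exact mul_eq_zero_of_right _ hω
  rw [measure_eq_zero_iff_ae_notMem]
  have key2 := ae_all_iff.2 fun n => ae_all_iff.2 fun y => measure_eq_zero_iff_ae_notMem.1 (key n y)
  filter_upwards [hR, key2] with X h1 h2 hX
  -- From a time of global minimum the path stays above its position; `key` disposes of the
  -- countably many possible times and positions.
  obtain ⟨n, hn⟩ := exists_forall_le_of_escapesRight h1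
  refine h2 n (X n) ⟨rfl, fun i => ?_, ?_⟩
  · have := hn (n + i)
    change 0 ≤ X (n + i) - X n
    omega
  · exact (htrans (X n) _).2 (hshift n X hX)

/-- Otherwise `Admissible.null_of_confined`, applied to the full event, would make the whole space
null. -/
theorem Admissible.confined_pos {P : Measure Environment} {J : ℕ} (h : Admissible P J)
    (hR : ∀ᵐ X ∂(pathLaw P 0), X ∈ escapesRight) : pathLaw P 0 (stayAbove 0) ≠ 0 := by
  intro h0
  have := h.isProbabilityMeasure
  have h1 := h.null_of_confined hR MeasurableSet.univ (fun _ _ => Iff.rfl) (fun _ _ hX => hX)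
    (by rwa [Set.inter_univ])
  rw [measure_univ] at h1
  exact one_ne_zero h1

/-! ### The conditioned walk and the finite mean distance between cut positions. -/

/-- The law of the walk conditioned to stay to the right of its starting point. -/
noncomputable def confinedLaw (P : Measure Environment) : Measure Path :=
  ProbabilityTheory.cond (pathLaw P 0) (stayAbove 0)

theorem confinedLaw_apply (P : Measure Environment) (B : Set Path) :
    confinedLaw P B = (pathLaw P 0 (stayAbove 0))⁻¹ * pathLaw P 0 (stayAbove 0 ∩ B) :=
  cond_apply (measurableSet_stayAbove 0) _ _

theorem confinedLaw_ae {P : Measure Environment} {p : Path → Prop}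
    (h : ∀ᵐ X ∂(pathLaw P 0), p X) : ∀ᵐ X ∂(confinedLaw P), p X :=
  cond_absolutelyContinuous.ae_le h

theorem confinedLaw_stayAbove (P : Measure Environment) :
    ∀ᵐ X ∂(confinedLaw P), X ∈ stayAbove 0 :=
  ae_cond_mem (measurableSet_stayAbove 0)

theorem pathLaw_start {P : Measure Environment} : ∀ᵐ X ∂(pathLaw P 0), X 0 = 0 := by
  have := ae_pathLaw_of_ae (P := P) (x := 0) (measurableSet_eval 0 {0})
    (Eventually.of_forall fun ω => quenched_start ω 0)
  exact this

theorem Admissible.pathLaw_jumps {P : Measure Environment} {J : ℕ} (h : Admissible P J) :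
    ∀ᵐ X ∂(pathLaw P 0), ∀ n, |X (n + 1) - X n| ≤ (J : ℤ) :=
  ae_pathLaw_of_ae (measurableSet_jumps J) (h.jumps.mono fun _ hω => hω 0)

/-- The probability that the future stays to the right of `a` equals that of the conditioning event,
so the two cancel and an unconditioned first passage remains. -/
theorem Admissible.confinedLaw_cutAt {P : Measure Environment} {J : ℕ} (h : Admissible P J)
    (hD : pathLaw P 0 (stayAbove 0) ≠ 0) {s : ℕ} {a : ℤ} (ha : 0 ≤ a) {E : Set Path}
    (hE : PastDet s E) :
    confinedLaw P (E ∩ cutAt s a) = pathLaw P 0 (E ∩ firstPassage s a) := by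
  have := h.isProbabilityMeasure
  have h1 := h.renewal ha hE MeasurableSet.univ
  rw [Set.preimage_univ, Set.inter_univ, Set.inter_univ] at h1
  rw [confinedLaw_apply, h1, mul_comm, mul_assoc,
    ENNReal.mul_inv_cancel hD (measure_ne_top _ _), mul_one]

theorem Admissible.confinedLaw_renewal {P : Measure Environment} {J : ℕ} (h : Admissible P J)
    (hD : pathLaw P 0 (stayAbove 0) ≠ 0) {s : ℕ} {a : ℤ} (ha : 0 ≤ a) {E : Set Path}
    (hE : PastDet s E) {B : Set Path} (hB : MeasurableSet B) :
    confinedLaw P (E ∩ cutAt s a ∩ recenter s ⁻¹' B)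
      = confinedLaw P (E ∩ cutAt s a) * confinedLaw P B := by
  rw [h.confinedLaw_cutAt hD ha hE, confinedLaw_apply, h.renewal ha hE hB, confinedLaw_apply]
  ring

/-- The probability that `j` is the position of a cut time. -/
noncomputable def cutProb (P : Measure Environment) (j : ℕ) : ℝ≥0∞ :=
  ∑' s : ℕ, confinedLaw P (cutAt s j)

/-- No cut time has a position in `[1, i]`. -/
def noCut (i : ℕ) : Set Path := {X | ∀ t, IsCut t X → ¬ (1 ≤ X t ∧ X t ≤ i)}

theorem measurableSet_noCut (i : ℕ) : MeasurableSet (noCut i) := by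
  have : noCut i = ⋂ t : ℕ, ⋂ a : ℤ, ⋂ _ : 1 ≤ a ∧ a ≤ i, (cutAt t a)ᶜ := by
    ext X
    simp only [Set.mem_iInter]
    exact ⟨fun h t a ha hX => h t hX.1 (by rw [hX.2]; exact ha),
      fun h t hX ha => h t (X t) ha ⟨hX, rfl⟩⟩
  rw [this]
  exact MeasurableSet.iInter fun t => MeasurableSet.iInter fun a => MeasurableSet.iInter fun _ =>
    (measurableSet_cutAt t a).compl

theorem Admissible.confinedLaw_prob {P : Measure Environment} {J : ℕ} (h : Admissible P J)
    (hD : pathLaw P 0 (stayAbove 0) ≠ 0) : IsProbabilityMeasure (confinedLaw P) :=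
  have := h.isProbabilityMeasure
  cond_isProbabilityMeasure hD

/-- By renewal, each summand is the probability that `p.1` is the last cut position in `[0, n]`;
these events are disjoint. -/
theorem Admissible.sum_cutProb_mul_le_one {P : Measure Environment} {J : ℕ} (h : Admissible P J)
    (hD : pathLaw P 0 (stayAbove 0) ≠ 0) (n : ℕ) :
    ∑ p ∈ Finset.HasAntidiagonal.antidiagonal n, cutProb P p.1 * confinedLaw P (noCut p.2) ≤ 1 := by
  have := h.confinedLaw_prob hD
  have h1 : ∀ p ∈ Finset.HasAntidiagonal.antidiagonal n, cutProb P p.1 * confinedLaw P (noCut p.2)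
      = confinedLaw P (⋃ s : ℕ, cutAt s p.1 ∩ recenter s ⁻¹' noCut p.2) := by
    intro p hp
    rw [measure_iUnion, cutProb, ← ENNReal.tsum_mul_right]
    · refine tsum_congr fun s => ?_
      have := h.confinedLaw_renewal hD (s := s) (a := p.1) (by positivity) (E := Set.univ)
        (fun _ _ _ _ => Set.mem_univ _) (measurableSet_noCut p.2)
      rw [Set.univ_inter] at this
      exact this.symm
    · intro s t hst
      refine Set.disjoint_left.2 fun X hX hX' => ?_
      rcases hst.lt_or_gt with hlt | hlt
      · have := hX'.1.1.lt hlt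
        rw [hX.1.2, hX'.1.2] at this
        exact lt_irrefl _ this
      · have := hX.1.1.lt hlt
        rw [hX.1.2, hX'.1.2] at this
        exact lt_irrefl _ this
    · exact fun s => (measurableSet_cutAt s _).inter
        (measurable_recenter s (measurableSet_noCut _))
  rw [Finset.sum_congr rfl h1, ← measure_biUnion_finset]
  · exact prob_le_one
  · have key : ∀ p ∈ Finset.HasAntidiagonal.antidiagonal n, ∀ q ∈ Finset.HasAntidiagonal.antidiagonal n, ∀ X s t,
        X ∈ cutAt s (p.1 : ℤ) → X ∈ recenter s ⁻¹' noCut p.2 → X ∈ cutAt t (q.1 : ℤ) →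
        ¬ s < t := by
      intro p hp q hq X s t hXs hXn hXt hst
      have h2 := hXt.1.lt hst
      have h3 : IsCut (t - s) (recenter s X) := by
        rw [hXs.1.recenter_iff, Nat.add_sub_cancel' hst.le]
        exact hXt.1
      refine hXn (t - s) h3 ?_
      have h4 := Finset.HasAntidiagonal.mem_antidiagonal.1 hp
      have h5 := Finset.HasAntidiagonal.mem_antidiagonal.1 hq
      have h6 := hXs.2
      have h7 := hXt.2
      simp only [recenter, Nat.add_sub_cancel' hst.le]
      constructor <;> omega
    intro p hp q hq hpq
    refine Set.disjoint_left.2 fun X hX hX' => hpq ?_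
    obtain ⟨s, hs⟩ := Set.mem_iUnion.1 hX
    obtain ⟨t, ht⟩ := Set.mem_iUnion.1 hX'
    have hst : s = t := by
      have h2 := key p hp q hq X s t hs.1 hs.2 ht.1
      have h3 := key q hq p hp X t s ht.1 ht.2 hs.1
      omega
    subst hst
    have h2 := hs.1.2
    have h3 := ht.1.2
    have h4 := Finset.HasAntidiagonal.mem_antidiagonal.1 hp
    have h5 := Finset.HasAntidiagonal.mem_antidiagonal.1 hq
    refine Prod.ext ?_ ?_ <;> omega
  · exact fun p _ => MeasurableSet.iUnion fun s => (measurableSet_cutAt s _).inter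
        (measurable_recenter s (measurableSet_noCut _))

theorem exists_first_ge {X : Path} {J : ℕ} (hJ : ∀ n, |X (n + 1) - X n| ≤ (J : ℤ))
    (hJ0 : 0 < J) {k : ℤ} (h0 : X 0 ≤ k) (hex : ∃ n, k ≤ X n) :
    ∃ n, k ≤ X n ∧ X n < k + J ∧ ∀ j < n, X j < k := by
  classical
  have h1 := Nat.find_spec hex
  have h2 : ∀ j < Nat.find hex, X j < k := fun j hj => not_le.1 (Nat.find_min hex hj)
  refine ⟨Nat.find hex, h1, ?_, h2⟩
  rcases Nat.eq_zero_or_pos (Nat.find hex) with h3 | h3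
  · rw [h3]
    omega
  · have h4 := h2 (Nat.find hex - 1) (by omega)
    have h5 := (abs_le.1 (hJ (Nat.find hex - 1))).2
    rw [Nat.sub_add_cancel (by omega)] at h5
    omega

/-- A confined path that escapes right enters `[k, ∞)` within `[k, k + J)`, by a first passage.
Summed over time, first passage probabilities are cut probabilities, by
`Admissible.confinedLaw_cutAt`. -/
theorem Admissible.confined_le_sum_cutProb {P : Measure Environment} {J : ℕ} (h : Admissible P J)
    (hR : ∀ᵐ X ∂(pathLaw P 0), X ∈ escapesRight) (k : ℕ) :
    pathLaw P 0 (stayAbove 0) ≤ ∑ i ∈ Finset.range J, cutProb P (k + i) := by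
  have hD := h.confined_pos hR
  have h1 : ∀ j : ℕ, cutProb P j = ∑' s : ℕ, pathLaw P 0 (firstPassage s j) := by
    intro j
    refine tsum_congr fun s => ?_
    have := h.confinedLaw_cutAt hD (s := s) (a := j) (by positivity) (E := Set.univ)
      (fun _ _ _ _ => Set.mem_univ _)
    rwa [Set.univ_inter, Set.univ_inter] at this
  calc pathLaw P 0 (stayAbove 0)
      ≤ pathLaw P 0 (⋃ i ∈ Finset.range J, ⋃ s : ℕ, firstPassage s ((k + i : ℕ) : ℤ)) := by
        refine measure_mono_ae ?_
        filter_upwards [hR, pathLaw_start, h.pathLaw_jumps] with X hXR hX0 hXJ hXD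
        obtain ⟨n, h2, h3, h4⟩ := exists_first_ge hXJ h.pos (k := k) (by omega)
          (tendsto_atTop.1 hXR k).exists
        refine Set.mem_iUnion₂.2 ⟨(X n - k).toNat, Finset.mem_range.2 (by omega),
          Set.mem_iUnion.2 ⟨n, fun j hj => ⟨hXD j, ?_⟩, ?_⟩⟩
        · have := h4 j hj
          omega
        · omega
    _ ≤ ∑ i ∈ Finset.range J, pathLaw P 0 (⋃ s : ℕ, firstPassage s ((k + i : ℕ) : ℤ)) :=
        measure_biUnion_finset_le _ _
    _ ≤ ∑ i ∈ Finset.range J, cutProb P (k + i) :=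
        Finset.sum_le_sum fun i _ => (measure_iUnion_le _).trans_eq (h1 _).symm

theorem Admissible.mul_confined_le_sum_cutProb {P : Measure Environment} {J : ℕ}
    (h : Admissible P J) (hR : ∀ᵐ X ∂(pathLaw P 0), X ∈ escapesRight) (m : ℕ) :
    m * pathLaw P 0 (stayAbove 0) ≤ ∑ j ∈ Finset.range (m * J), cutProb P j := by
  induction m with
  | zero => simp
  | succ m ih =>
    rw [Nat.succ_mul, Finset.sum_range_add, Nat.cast_succ, add_mul, one_mul]
    exact add_le_add ih (h.confined_le_sum_cutProb hR _)

/-- Summing `Admissible.sum_cutProb_mul_le_one` over `n < 2 N` bounds the product of the two partial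
sums up to `N` by `2 N`. The partial sum of `cutProb` grows at least linearly, with slope `c / J`,
so the sum over `noCut` is at most `2 J / c`. -/
theorem Admissible.tsum_noCut_ne_top {P : Measure Environment} {J : ℕ} (h : Admissible P J)
    (hR : ∀ᵐ X ∂(pathLaw P 0), X ∈ escapesRight) :
    ∑' i, confinedLaw P (noCut i) ≠ ∞ := by
  have := h.isProbabilityMeasure
  have hD := h.confined_pos hR
  set c := pathLaw P 0 (stayAbove 0) with hc
  have hctop : c ≠ ∞ := measure_ne_top _ _
  have key : ∀ N : ℕ, (∑ j ∈ Finset.range N, cutProb P j) *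
      ∑ i ∈ Finset.range N, confinedLaw P (noCut i) ≤ (2 * N : ℕ) := by
    intro N
    rw [Finset.sum_mul_sum, ← Finset.sum_product']
    have hmaps : ∀ p ∈ Finset.range N ×ˢ Finset.range N, p.1 + p.2 ∈ Finset.range (2 * N) := by
      intro p hp
      have h1 := Finset.mem_product.1 hp
      have h2 := Finset.mem_range.1 h1.1
      have h3 := Finset.mem_range.1 h1.2
      exact Finset.mem_range.2 (by omega)
    rw [← Finset.sum_fiberwise_of_maps_to hmaps]
    calc _ ≤ ∑ n ∈ Finset.range (2 * N), (1 : ℝ≥0∞) := by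
          refine Finset.sum_le_sum fun n _ => ?_
          refine le_trans (Finset.sum_le_sum_of_subset ?_) (h.sum_cutProb_mul_le_one hD n)
          intro p hp
          exact Finset.HasAntidiagonal.mem_antidiagonal.2 (Finset.mem_filter.1 hp).2
      _ = _ := by simp
  have hJ : (J : ℝ≥0∞) ≠ 0 := by exact_mod_cast h.pos.ne'
  have bound : ∀ m : ℕ, ∑ i ∈ Finset.range m, confinedLaw P (noCut i) ≤ 2 * J / c := by
    intro m
    rcases Nat.eq_zero_or_pos m with rfl | hm
    · simp
    have hm0 : (m : ℝ≥0∞) ≠ 0 := by exact_mod_cast hm.ne'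
    have h1 := key (m * J)
    have h2 : (m * c) * ∑ i ∈ Finset.range m, confinedLaw P (noCut i) ≤ m * (2 * J) := by
      calc _ ≤ (∑ j ∈ Finset.range (m * J), cutProb P j) *
            ∑ i ∈ Finset.range (m * J), confinedLaw P (noCut i) := by
            refine mul_le_mul' (h.mul_confined_le_sum_cutProb hR m)
              (Finset.sum_le_sum_of_subset (Finset.range_mono ?_))
            exact Nat.le_mul_of_pos_right m h.pos
        _ ≤ _ := h1
        _ = _ := by push_cast; ring
    rw [mul_assoc, ENNReal.mul_le_mul_iff_right hm0 (ENNReal.natCast_ne_top m)] at h2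
    rw [ENNReal.le_div_iff_mul_le (Or.inl hD) (Or.inl hctop), mul_comm]
    exact h2
  have hle : ∑' i, confinedLaw P (noCut i) ≤ 2 * J / c :=
    ENNReal.tsum_le_of_sum_range_le bound
  refine ne_top_of_le_ne_top (ENNReal.div_ne_top ?_ hD) hle
  exact ENNReal.mul_ne_top (by simp) (ENNReal.natCast_ne_top J)

/-! ### Strong laws along a measure preserving map, and renewal interpolation. -/

section StrongLaw

variable {Ω : Type*} [MeasurableSpace Ω] {Q : Measure Ω} {Φ : Ω → Ω}

/-- Strong law of large numbers along the orbit of a measure preserving map `Φ`, for an observable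
that is independent of `Φ`. -/
theorem strong_law_iterate (hΦ : MeasurePreserving Φ Q Q) {ξ : Ω → ℝ} (hξ : Measurable ξ)
    (hint : Integrable ξ Q) (hind : IndepFun ξ Φ Q) :
    ∀ᵐ x ∂Q, Tendsto (fun n : ℕ => (∑ i ∈ Finset.range n, ξ (Φ^[i] x)) / n) atTop
      (𝓝 (∫ x, ξ x ∂Q)) := by
  have hit := fun i => hΦ.iterate i
  -- `ξ` is independent of `Φ`, hence of each later `ξ ∘ Φ^[d + 1]`; precomposing with the measure
  -- preserving `Φ^[i]` gives all pairs. The strong law needs only pairwise independence.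
  have hlt : ∀ i j, i < j → IndepFun (fun x => ξ (Φ^[i] x)) (fun x => ξ (Φ^[j] x)) Q := by
    intro i j hij
    obtain ⟨d, rfl⟩ := Nat.exists_eq_add_of_lt hij
    have h1 : IndepFun ξ (fun x => ξ (Φ^[d] (Φ x))) Q :=
      hind.comp measurable_id (hξ.comp (hit d).measurable)
    have h3 := (hit i).map_eq
    rw [indepFun_iff_measure_inter_preimage_eq_mul] at h1 ⊢
    intro S T hS hT
    have h2 := h1 S T hS hT
    have hS' := hξ hS
    have hT' : MeasurableSet ((fun x => ξ (Φ^[d] (Φ x))) ⁻¹' T) :=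
      (hξ.comp ((hit d).measurable.comp hΦ.measurable)) hT
    rw [← (hit i).measure_preimage hS'.nullMeasurableSet,
      ← (hit i).measure_preimage hT'.nullMeasurableSet,
      ← (hit i).measure_preimage (hS'.inter hT').nullMeasurableSet] at h2
    have h4 : (fun x => ξ (Φ^[i + d + 1] x)) ⁻¹' T
        = Φ^[i] ⁻¹' ((fun x => ξ (Φ^[d] (Φ x))) ⁻¹' T) := by
      ext x
      simp only [Set.mem_preimage]
      rw [← Function.iterate_succ_apply, ← Function.iterate_add_apply]
      congr! 3
      omega
    rw [h4]
    exact h2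
  have h := strong_law_ae_real (μ := Q) (fun i x => ξ (Φ^[i] x)) hint (fun i j hij => by
    rcases lt_or_gt_of_ne hij with h1 | h1
    · exact hlt i j h1
    · exact (hlt j i h1).symm) fun i =>
    ⟨(hξ.comp (hit i).measurable).aemeasurable, hξ.aemeasurable, by
      have : (fun x => ξ (Φ^[i] x)) = ξ ∘ Φ^[i] := rfl
      rw [this, ← Measure.map_map hξ (hit i).measurable, (hit i).map_eq]
      rfl⟩
  simpa only [Function.iterate_zero, id] using h

/-- Truncate at level `M`: the averages dominate those of the truncated observable, whose means
increase to infinity with `M`. -/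
theorem strong_law_iterate_top [IsProbabilityMeasure Q] (hΦ : MeasurePreserving Φ Q Q) {ξ : Ω → ℝ} (hξ : Measurable ξ)
    (hpos : ∀ x, 0 ≤ ξ x) (hint : ¬ Integrable ξ Q) (hind : IndepFun ξ Φ Q) :
    ∀ᵐ x ∂Q, Tendsto (fun n : ℕ => (∑ i ∈ Finset.range n, ξ (Φ^[i] x)) / n) atTop atTop := by
  have hm : ∀ M : ℕ, Measurable fun x => min (ξ x) M := fun M => hξ.min measurable_const
  have hmi : ∀ M : ℕ, Integrable (fun x => min (ξ x) M) Q := fun M =>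
    Integrable.of_bound (hm M).aestronglyMeasurable M (Eventually.of_forall fun x => by
      rw [Real.norm_of_nonneg (le_min (hpos x) (Nat.cast_nonneg M))]
      exact min_le_right _ _)
  have hlaw := ae_all_iff.2 fun M : ℕ => strong_law_iterate hΦ (hm M) (hmi M)
    (hind.comp (φ := fun y : ℝ => min y M) (measurable_id.min measurable_const) measurable_id)
  have htop : ∫⁻ x, ENNReal.ofReal (ξ x) ∂Q = ∞ := by
    by_contra hne
    exact hint ((lintegral_ofReal_ne_top_iff_integrable hξ.aestronglyMeasurable
      (Eventually.of_forall hpos)).1 hne)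
  have hlim : Tendsto (fun M : ℕ => ∫⁻ x, ENNReal.ofReal (min (ξ x) M) ∂Q) atTop (𝓝 ∞) := by
    rw [← htop]
    refine lintegral_tendsto_of_tendsto_of_monotone
      (fun M => (hm M).ennreal_ofReal.aemeasurable) (Eventually.of_forall fun x M N hMN => ?_)
      (Eventually.of_forall fun x => ?_)
    · exact ENNReal.ofReal_le_ofReal (min_le_min_left _ (Nat.cast_le.2 hMN))
    · refine tendsto_const_nhds.congr' ?_
      obtain ⟨N, hN⟩ := exists_nat_ge (ξ x)
      filter_upwards [eventually_ge_atTop N] with M hM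
      rw [min_eq_left (hN.trans (Nat.cast_le.2 hM))]
  filter_upwards [hlaw] with x hx
  refine tendsto_atTop.2 fun C => ?_
  obtain ⟨M, hM⟩ := (hlim.eventually (lt_mem_nhds (ENNReal.ofReal_lt_top (r := C)))).exists
  rw [← ofReal_integral_eq_lintegral_ofReal (hmi M)
    (Eventually.of_forall fun x => le_min (hpos x) (Nat.cast_nonneg M))] at hM
  have hM' : C < ∫ x, min (ξ x) M ∂Q := by
    by_contra hcon
    exact absurd hM (not_lt.2 (ENNReal.ofReal_le_ofReal (not_lt.1 hcon)))
  filter_upwards [(hx M).eventually (lt_mem_nhds hM')] with n hn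
  refine hn.le.trans ?_
  gcongr
  exact min_le_left _ _

end StrongLaw

theorem exists_renewal_index {τ : ℕ → ℕ} (hτ : StrictMono τ) (h0 : τ 0 = 0) (n : ℕ) :
    ∃ k, τ k ≤ n ∧ n < τ (k + 1) := by
  induction n with
  | zero => exact ⟨0, h0.le, by have := hτ (Nat.lt_add_one 0); omega⟩
  | succ n ih =>
    obtain ⟨k, h1, h2⟩ := ih
    rcases Nat.lt_or_ge (n + 1) (τ (k + 1)) with h3 | h3
    · exact ⟨k, by omega, h3⟩
    · exact ⟨k + 1, h3, by have := hτ (Nat.lt_add_one (k + 1)); omega⟩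

/-- A nonnegative sequence sandwiched between its values at renewal times has the speed seen at
the renewal times. -/
theorem tendsto_div_of_renewal {X : ℕ → ℝ} {τ : ℕ → ℕ} (hτ : StrictMono τ) (h0 : τ 0 = 0)
    (hX0 : ∀ n, 0 ≤ X n) (hlow : ∀ k n, τ k ≤ n → X (τ k) ≤ X n)
    (hup : ∀ k n, n < τ k → X n ≤ X (τ k)) {m r : ℝ}
    (hm : Tendsto (fun k : ℕ => X (τ k) / k) atTop (𝓝 m))
    (hr : Tendsto (fun k : ℕ => (k : ℝ) / τ k) atTop (𝓝 r)) :
    Tendsto (fun n : ℕ => X n / n) atTop (𝓝 (m * r)) := by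
  choose κ hκ1 hκ2 using exists_renewal_index hτ h0
  have hκ : Tendsto κ atTop atTop := by
    refine tendsto_atTop.2 fun K => ?_
    filter_upwards [eventually_ge_atTop (τ K)] with n hn
    by_contra hlt
    have := hτ.monotone (show κ n + 1 ≤ K by omega)
    have := hκ2 n
    omega
  have hq : Tendsto (fun k : ℕ => (k : ℝ) / ((k + 1 : ℕ) : ℝ)) atTop (𝓝 1) := by
    simpa using tendsto_natCast_div_add_atTop (1 : ℝ)
  have hτpos : ∀ k, 0 < k → (0 : ℝ) < τ k := fun k hk => by
    have := hτ hk
    exact_mod_cast (by omega : 0 < τ k)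
  -- The sandwich divides the position at one end of a renewal interval by the time at the other
  -- end; as `k / (k + 1)` tends to `1`, the limit is not affected, even for `r = 0`.
  have ha : Tendsto (fun k : ℕ => X (τ k) / τ (k + 1)) atTop (𝓝 (m * r)) := by
    have h1 := (hm.mul (hr.comp (tendsto_add_atTop_nat 1))).mul hq
    rw [mul_one] at h1
    refine h1.congr' ?_
    filter_upwards [eventually_gt_atTop 0] with k hk
    have hk' : (k : ℝ) ≠ 0 := by exact_mod_cast hk.ne'
    have hk1 : ((k + 1 : ℕ) : ℝ) ≠ 0 := by positivity
    have := (hτpos (k + 1) k.succ_pos).ne'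
    simp only [Function.comp]
    field_simp
  have hb : Tendsto (fun k : ℕ => X (τ (k + 1)) / τ k) atTop (𝓝 (m * r)) := by
    have h1 := ((hm.comp (tendsto_add_atTop_nat 1)).mul hr).mul (hq.inv₀ one_ne_zero)
    rw [inv_one, mul_one] at h1
    refine h1.congr' ?_
    filter_upwards [eventually_gt_atTop 0] with k hk
    have hk' : (k : ℝ) ≠ 0 := by exact_mod_cast hk.ne'
    have hk1 : ((k + 1 : ℕ) : ℝ) ≠ 0 := by positivity
    have := (hτpos k hk).ne'
    simp only [Function.comp]
    field_simp
  refine tendsto_of_tendsto_of_tendsto_of_le_of_le' (ha.comp hκ) (hb.comp hκ) ?_ ?_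
  · filter_upwards [eventually_gt_atTop 0] with n hn
    exact div_le_div₀ (hX0 n) (hlow _ _ (hκ1 n)) (by exact_mod_cast hn)
      (by exact_mod_cast (hκ2 n).le)
  · filter_upwards [hκ.eventually (eventually_gt_atTop 0)] with n hn
    exact div_le_div₀ (hX0 _) (hup _ _ (hκ2 n)) (hτpos _ hn) (by exact_mod_cast hκ1 n)

/-! ### Independent cycles between cut times and the speed of the transient walk. -/

/-- The first positive cut time (`0` if there is none). -/
noncomputable def cutTime (X : Path) : ℕ := sInf {s | 1 ≤ s ∧ IsCut s X}

/-- The path seen from the first positive cut time. -/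
noncomputable def afterCut (X : Path) : Path := recenter (cutTime X) X

theorem measurableSet_isCut (s : ℕ) : MeasurableSet {X | IsCut s X} := by
  have : {X | IsCut s X} = ⋃ a : ℤ, cutAt s a := by
    ext X
    simp only [Set.mem_iUnion]
    exact ⟨fun h => ⟨X s, h, rfl⟩, fun ⟨_, h, _⟩ => h⟩
  rw [this]
  exact MeasurableSet.iUnion fun a => measurableSet_cutAt s a

theorem cutTime_eq_iff {X : Path} {s : ℕ} (hs : 1 ≤ s) :
    cutTime X = s ↔ IsCut s X ∧ ∀ t, 1 ≤ t → t < s → ¬ IsCut t X := by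
  constructor
  · rintro rfl
    have hne : {s | 1 ≤ s ∧ IsCut s X}.Nonempty := by
      by_contra hcon
      rw [Set.not_nonempty_iff_eq_empty] at hcon
      rw [cutTime, hcon, Nat.sInf_empty] at hs
      omega
    refine ⟨(Nat.sInf_mem hne).2, fun t ht htlt hcut => ?_⟩
    exact absurd (Nat.sInf_le (⟨ht, hcut⟩ : t ∈ {s | 1 ≤ s ∧ IsCut s X})) (not_le.2 htlt)
  · rintro ⟨h1, h2⟩
    refine le_antisymm (Nat.sInf_le ⟨hs, h1⟩) ?_
    refine le_csInf ⟨s, hs, h1⟩ fun t ht => ?_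
    by_contra hlt
    exact h2 t ht.1 (not_le.1 hlt) ht.2

theorem measurable_cutTime : Measurable cutTime := by
  have hpos : ∀ s, 1 ≤ s → MeasurableSet (cutTime ⁻¹' {s}) := by
    intro s hs
    have : cutTime ⁻¹' {s} = {X | IsCut s X} ∩
        ⋂ t : ℕ, ⋂ _ : 1 ≤ t, ⋂ _ : t < s, {X | IsCut t X}ᶜ := by
      ext X
      simp only [Set.mem_inter_iff, Set.mem_iInter]
      exact cutTime_eq_iff hs
    rw [this]
    exact (measurableSet_isCut s).inter (MeasurableSet.iInter fun t => MeasurableSet.iInter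
      fun _ => MeasurableSet.iInter fun _ => (measurableSet_isCut t).compl)
  refine measurable_to_countable' fun s => ?_
  rcases Nat.eq_zero_or_pos s with rfl | hs
  · have : cutTime ⁻¹' {0} = (⋃ t : ℕ, ⋃ _ : 1 ≤ t, cutTime ⁻¹' {t})ᶜ := by
      ext X
      simp only [Set.mem_compl_iff, Set.mem_iUnion, not_exists]
      constructor
      · intro h t ht ht'
        have h1 : cutTime X = 0 := h
        have h2 : cutTime X = t := ht'
        omega
      · intro h
        by_contra hne
        exact h (cutTime X) (Nat.pos_of_ne_zero hne) rfl
    rw [this]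
    exact (MeasurableSet.iUnion fun t => MeasurableSet.iUnion fun ht => hpos t ht).compl
  · exact hpos s hs

theorem measurable_afterCut : Measurable afterCut := by
  have h : Measurable fun q : ℕ × Path => recenter q.1 q.2 :=
    measurable_from_prod_countable_right measurable_recenter
  exact h.comp (measurable_cutTime.prodMk measurable_id)

/-- The first positive cut time and its position. -/
noncomputable def firstCut (X : Path) : ℕ × ℤ := (cutTime X, X (cutTime X))

theorem measurable_firstCut : Measurable firstCut := by
  have h : Measurable fun q : ℕ × Path => q.2 q.1 :=
    measurable_from_prod_countable_right fun n => measurable_pi_apply n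
  exact measurable_cutTime.prodMk (h.comp (measurable_cutTime.prodMk measurable_id))

/-- Up to time `s`, no time in `[1, s)` looks like a cut time. -/
def noCutBefore (s : ℕ) : Set Path :=
  {X | ∀ t, 1 ≤ t → t < s → ¬ ((∀ j < t, X j < X t) ∧ ∀ j ≤ s, t ≤ j → X t ≤ X j)}

theorem pastDet_noCutBefore (s : ℕ) : PastDet s (noCutBefore s) := by
  rintro X Y hXY hX t ht hts ⟨h1, h2⟩
  refine hX t ht hts ⟨fun j hj => ?_, fun j hj htj => ?_⟩
  · rw [hXY j (by omega), hXY t hts.le]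
    exact h1 j hj
  · rw [hXY j hj, hXY t hts.le]
    exact h2 j hj htj

/-- If `s` is a cut time, the path stays above `X s` afterwards, so whether an earlier `t` is a cut
time is already decided at time `s`. This is what allows the renewal identity at the random time
`cutTime`. -/
theorem firstCut_preimage {s : ℕ} (hs : 1 ≤ s) (a : ℤ) :
    firstCut ⁻¹' {(s, a)} = noCutBefore s ∩ cutAt s a := by
  ext X
  constructor
  · intro hX
    obtain ⟨h1, h2⟩ := Prod.mk.inj (Set.mem_singleton_iff.1 hX)
    rw [h1] at h2
    obtain ⟨h3, h4⟩ := (cutTime_eq_iff hs).1 h1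
    refine ⟨fun t ht hts ⟨h5, h6⟩ => h4 t ht hts ⟨h5, fun j => ?_⟩, h3, h2⟩
    rcases le_or_gt (t + j) s with hj | hj
    · exact h6 _ hj (by omega)
    · have h7 := h6 s le_rfl hts.le
      have h8 := h3.2 (t + j - s)
      rw [Nat.add_sub_cancel' hj.le] at h8
      exact h7.trans h8
  · rintro ⟨h1, h2, h3⟩
    have h4 : cutTime X = s := (cutTime_eq_iff hs).2 ⟨h2, fun t ht hts hcut =>
      h1 t ht hts ⟨hcut.1, fun j _ htj => by
        have := hcut.2 (j - t)
        rwa [Nat.add_sub_cancel' htj] at this⟩⟩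
    refine Set.mem_singleton_iff.2 (Prod.ext h4 ?_)
    change X (cutTime X) = a
    rw [h4, h3]

/-- A path without a cut at a positive position lies in every `noCut i`, and these probabilities are
summable, hence tend to `0`. -/
theorem Admissible.firstCut_valid {P : Measure Environment} {J : ℕ} (h : Admissible P J)
    (hR : ∀ᵐ X ∂(pathLaw P 0), X ∈ escapesRight) :
    ∀ᵐ X ∂(confinedLaw P), 1 ≤ cutTime X ∧ IsCut (cutTime X) X ∧ 1 ≤ X (cutTime X) := by
  have h1 : confinedLaw P (⋂ i, noCut i) = 0 := by
    have h2 := ENNReal.tendsto_atTop_zero_of_tsum_ne_top (h.tsum_noCut_ne_top hR)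
    exact le_antisymm (ge_of_tendsto' h2 fun i => measure_mono (Set.iInter_subset _ i)) zero_le
  filter_upwards [measure_eq_zero_iff_ae_notMem.1 h1, confinedLaw_ae pathLaw_start] with X h2 h3
  simp only [Set.mem_iInter, not_forall] at h2
  obtain ⟨i, hi⟩ := h2
  have h4 : ∃ t, IsCut t X ∧ 1 ≤ X t := by
    by_contra hcon
    push Not at hcon
    exact hi fun t ht h5 => absurd h5.1 (not_le.2 (hcon t ht))
  obtain ⟨t, ht, ht'⟩ := h4
  have ht1 : 1 ≤ t := by
    rcases Nat.eq_zero_or_pos t with rfl | h5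
    · omega
    · exact h5
  have h5 : 1 ≤ cutTime X ∧ IsCut (cutTime X) X :=
    Nat.sInf_mem (⟨t, ht1, ht⟩ : {s | 1 ≤ s ∧ IsCut s X}.Nonempty)
  have h6 := h5.2.lt h5.1
  exact ⟨h5.1, h5.2, by omega⟩

/-- This is the tail sum formula: the first cut position is at most the number of `i` for which
`noCut i` holds. -/
theorem Admissible.integrable_firstCut {P : Measure Environment} {J : ℕ} (h : Admissible P J)
    (hR : ∀ᵐ X ∂(pathLaw P 0), X ∈ escapesRight) :
    Integrable (fun X : Path => ((firstCut X).2 : ℝ)) (confinedLaw P) := by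
  have hm : Measurable fun X : Path => ((firstCut X).2 : ℝ) :=
    (measurable_of_countable fun z : ℕ × ℤ => (z.2 : ℝ)).comp measurable_firstCut
  have hv := h.firstCut_valid hR
  refine (lintegral_ofReal_ne_top_iff_integrable hm.aestronglyMeasurable ?_).1 ?_
  · filter_upwards [hv] with X hX
    have h0 : 0 ≤ (firstCut X).2 := by
      change 0 ≤ X (cutTime X)
      linarith [hX.2.2]
    exact Int.cast_nonneg h0
  · refine ne_top_of_le_ne_top (h.tsum_noCut_ne_top hR) ?_
    have h1 : ∑' i, confinedLaw P (noCut i)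
        = ∫⁻ X, ∑' i, (noCut i).indicator 1 X ∂(confinedLaw P) := by
      rw [lintegral_tsum fun i => (measurable_one.indicator (measurableSet_noCut i)).aemeasurable]
      exact tsum_congr fun i => (lintegral_indicator_one (measurableSet_noCut i)).symm
    rw [h1]
    refine lintegral_mono_ae ?_
    filter_upwards [hv, confinedLaw_ae pathLaw_start] with X hX hX0
    refine le_trans ?_ (ENNReal.sum_le_tsum (Finset.range (X (cutTime X)).toNat))
    have h2 : ∀ i ∈ Finset.range (X (cutTime X)).toNat,
        (noCut i).indicator (1 : Path → ℝ≥0∞) X = 1 := by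
      intro i hi
      rw [Set.indicator_of_mem, Pi.one_apply]
      intro t ht ht'
      have h3 : i < (X (cutTime X)).toNat := Finset.mem_range.1 hi
      have ht1 : 1 ≤ t := by
        rcases Nat.eq_zero_or_pos t with rfl | h5
        · omega
        · exact h5
      have h4 : cutTime X ≤ t := Nat.sInf_le ⟨ht1, ht⟩
      have h5 := hX.2.1.2 (t - cutTime X)
      rw [Nat.add_sub_cancel' h4] at h5
      omega
    rw [Finset.sum_congr rfl h2, Finset.sum_const, Finset.card_range, nsmul_eq_mul, mul_one]
    rw [← ENNReal.ofReal_natCast]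
    refine ENNReal.ofReal_le_ofReal ?_
    have h3 : X (cutTime X) ≤ ((X (cutTime X)).toNat : ℤ) := Int.self_le_toNat _
    exact_mod_cast h3

/-- The renewal identity, applied on each of the countably many values of `firstCut`. -/
theorem Admissible.firstCut_mul {P : Measure Environment} {J : ℕ} (h : Admissible P J)
    (hR : ∀ᵐ X ∂(pathLaw P 0), X ∈ escapesRight) (A : Set (ℕ × ℤ)) {B : Set Path}
    (hB : MeasurableSet B) :
    confinedLaw P (firstCut ⁻¹' A ∩ afterCut ⁻¹' B)
      = confinedLaw P (firstCut ⁻¹' A) * confinedLaw P B := by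
  have hD := h.confined_pos hR
  have hA : MeasurableSet A := A.to_countable.measurableSet
  have key : ((confinedLaw P).restrict (afterCut ⁻¹' B)).map firstCut
      = confinedLaw P B • (confinedLaw P).map firstCut := by
    refine Measure.ext_of_singleton fun z => ?_
    obtain ⟨s, a⟩ := z
    have hz := measurable_firstCut (measurableSet_singleton (s, a))
    rw [Measure.smul_apply, smul_eq_mul, Measure.map_apply measurable_firstCut
      (measurableSet_singleton _), Measure.restrict_apply hz,
      Measure.map_apply measurable_firstCut (measurableSet_singleton _)]
    by_cases hsa : 1 ≤ s ∧ 0 ≤ a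
    · have h1 : firstCut ⁻¹' {(s, a)} ∩ afterCut ⁻¹' B
          = noCutBefore s ∩ cutAt s a ∩ recenter s ⁻¹' B := by
        rw [← firstCut_preimage hsa.1]
        ext X
        refine and_congr_right fun hX => ?_
        have h2 : cutTime X = s := (Prod.mk.inj (Set.mem_singleton_iff.1 hX)).1
        change recenter (cutTime X) X ∈ B ↔ _
        rw [h2]
        rfl
      rw [h1, h.confinedLaw_renewal hD hsa.2 (pastDet_noCutBefore s) hB,
        firstCut_preimage hsa.1, mul_comm]
    -- The default `cutTime X = 0` and negative positions occur with probability zero.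
    · have h0 : confinedLaw P (firstCut ⁻¹' {(s, a)}) = 0 := by
        rw [measure_eq_zero_iff_ae_notMem]
        filter_upwards [h.firstCut_valid hR] with X hX hX'
        obtain ⟨h1, h2⟩ := Prod.mk.inj (Set.mem_singleton_iff.1 hX')
        exact hsa ⟨by omega, by omega⟩
      rw [h0, mul_zero]
      exact measure_mono_null Set.inter_subset_left h0
  have h1 := congrArg (fun μ => μ A) key
  simp only [Measure.smul_apply, smul_eq_mul] at h1
  rw [Measure.map_apply measurable_firstCut hA, Measure.map_apply measurable_firstCut hA,
    Measure.restrict_apply (measurable_firstCut hA)] at h1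
  rw [h1, mul_comm]

theorem Admissible.measurePreserving_afterCut {P : Measure Environment} {J : ℕ}
    (h : Admissible P J) (hR : ∀ᵐ X ∂(pathLaw P 0), X ∈ escapesRight) :
    MeasurePreserving afterCut (confinedLaw P) (confinedLaw P) := by
  have := h.confinedLaw_prob (h.confined_pos hR)
  refine ⟨measurable_afterCut, Measure.ext fun B hB => ?_⟩
  have h1 := h.firstCut_mul hR Set.univ hB
  rw [Set.preimage_univ, Set.univ_inter, measure_univ, one_mul] at h1
  rw [Measure.map_apply measurable_afterCut hB, h1]

theorem Admissible.indepFun_afterCut {P : Measure Environment} {J : ℕ}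
    (h : Admissible P J) (hR : ∀ᵐ X ∂(pathLaw P 0), X ∈ escapesRight) :
    IndepFun firstCut afterCut (confinedLaw P) := by
  rw [indepFun_iff_measure_inter_preimage_eq_mul]
  intro A B _ hB
  rw [h.firstCut_mul hR A hB, (h.measurePreserving_afterCut hR).measure_preimage
    hB.nullMeasurableSet]

/-- Iterating `afterCut` runs through successive cut times of the original path; times and positions
are the partial sums of the cycle increments. -/
theorem cut_iterate {X : Path} (h0 : X 0 = 0) (hD : X ∈ stayAbove 0)
    (hv : ∀ k, IsCut (cutTime (afterCut^[k] X)) (afterCut^[k] X)) (k : ℕ) :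
    afterCut^[k] X = recenter (∑ i ∈ Finset.range k, (firstCut (afterCut^[i] X)).1) X ∧
      IsCut (∑ i ∈ Finset.range k, (firstCut (afterCut^[i] X)).1) X ∧
      X (∑ i ∈ Finset.range k, (firstCut (afterCut^[i] X)).1)
        = ∑ i ∈ Finset.range k, (firstCut (afterCut^[i] X)).2 := by
  induction k with
  | zero =>
    refine ⟨?_, ⟨fun j hj => absurd hj (Nat.not_lt_zero _), fun j => ?_⟩, h0⟩
    · funext i
      simp [recenter, h0]
    · simp only [Finset.range_zero, Finset.sum_empty, zero_add, h0]
      exact hD j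
  | succ k ih =>
    obtain ⟨h1, h2, h3⟩ := ih
    rw [Finset.sum_range_succ, Finset.sum_range_succ, Function.iterate_succ_apply']
    set T := ∑ i ∈ Finset.range k, (firstCut (afterCut^[i] X)).1
    have h4 := hv k
    refine ⟨?_, ?_, ?_⟩
    · rw [← recenter_recenter, ← h1]
      rfl
    · rw [h1] at h4 ⊢
      exact h2.recenter_iff.1 h4
    · rw [← h3]
      have h5 : (firstCut (afterCut^[k] X)).2
          = X (T + (firstCut (afterCut^[k] X)).1) - X T := by
        exact congrFun h1 _
      rw [h5]
      ring

theorem tendsto_div_sub_iff {X : ℕ → ℝ} (k v : ℝ) :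
    Tendsto (fun n : ℕ => (X n - k) / n) atTop (𝓝 v) ↔
      Tendsto (fun n : ℕ => X n / n) atTop (𝓝 v) := by
  have h0 : Tendsto (fun n : ℕ => k / (n : ℝ)) atTop (𝓝 0) :=
    tendsto_const_nhds.div_atTop tendsto_natCast_atTop_atTop
  constructor
  · intro h
    have := h.add h0
    rw [add_zero] at this
    exact this.congr fun n => by ring
  · intro h
    have := h.sub h0
    rw [sub_zero] at this
    exact this.congr fun n => by ring

theorem tendsto_div_of_shift {X : ℕ → ℝ} {v : ℝ} (n : ℕ)
    (h : Tendsto (fun i : ℕ => X (n + i) / i) atTop (𝓝 v)) :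
    Tendsto (fun i : ℕ => X i / i) atTop (𝓝 v) := by
  rw [← tendsto_add_atTop_iff_nat n]
  have hq : Tendsto (fun k : ℕ => (k : ℝ) / ((k : ℝ) + n)) atTop (𝓝 1) :=
    tendsto_natCast_div_add_atTop (n : ℝ)
  have h1 := h.mul hq
  rw [mul_one] at h1
  refine h1.congr' ?_
  filter_upwards [eventually_gt_atTop 0] with k hk
  have hk' : (k : ℝ) ≠ 0 := by exact_mod_cast hk.ne'
  have hk2 : (k : ℝ) + n ≠ 0 := by positivity
  rw [add_comm n k]
  push_cast
  field_simp

/-- The paths with asymptotic speed `v`. -/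
def hasSpeed (v : ℝ) : Set Path := {X | Tendsto (fun n : ℕ => (X n : ℝ) / n) atTop (𝓝 v)}

theorem measurableSet_hasSpeed (v : ℝ) : MeasurableSet (hasSpeed v) :=
  measurableSet_tendsto (𝓝 v) fun n => measurable_map_path (fun z => (z : ℝ) / n) n

/-- The speed is the mean displacement of a cycle divided by its mean duration, read as `0` if the
latter is infinite. -/
theorem Admissible.confined_speed {P : Measure Environment} {J : ℕ} (h : Admissible P J)
    (hR : ∀ᵐ X ∂(pathLaw P 0), X ∈ escapesRight) :
    ∃ v : ℝ, ∀ᵐ X ∂(confinedLaw P), X ∈ hasSpeed v := by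
  have := h.confinedLaw_prob (h.confined_pos hR)
  have hΦ := h.measurePreserving_afterCut hR
  have hind := h.indepFun_afterCut hR
  have hσm : Measurable fun X : Path => ((firstCut X).1 : ℝ) :=
    (measurable_of_countable fun z : ℕ × ℤ => (z.1 : ℝ)).comp measurable_firstCut
  have hYm : Measurable fun X : Path => ((firstCut X).2 : ℝ) :=
    (measurable_of_countable fun z : ℕ × ℤ => (z.2 : ℝ)).comp measurable_firstCut
  have hY := strong_law_iterate hΦ hYm (h.integrable_firstCut hR)
    (hind.comp (φ := fun z : ℕ × ℤ => (z.2 : ℝ)) (measurable_of_countable _) measurable_id)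
  have hσind := hind.comp (φ := fun z : ℕ × ℤ => (z.1 : ℝ)) (measurable_of_countable _)
    measurable_id
  have hvalid := h.firstCut_valid hR
  have hr : ∃ r : ℝ, ∀ᵐ X ∂(confinedLaw P), Tendsto (fun k : ℕ => (k : ℝ) /
      ((∑ i ∈ Finset.range k, (firstCut (afterCut^[i] X)).1 : ℕ) : ℝ)) atTop (𝓝 r) := by
    by_cases hint : Integrable (fun X : Path => ((firstCut X).1 : ℝ)) (confinedLaw P)
    · refine ⟨(∫ X, ((firstCut X).1 : ℝ) ∂(confinedLaw P))⁻¹, ?_⟩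
      have hne : ∫ X, ((firstCut X).1 : ℝ) ∂(confinedLaw P) ≠ 0 := by
        have h1 : ∫ _, (1 : ℝ) ∂(confinedLaw P) ≤ ∫ X, ((firstCut X).1 : ℝ) ∂(confinedLaw P) := by
          refine integral_mono_ae (integrable_const 1) hint ?_
          filter_upwards [hvalid] with X hX
          exact_mod_cast hX.1
        rw [integral_const, probReal_univ, smul_eq_mul, mul_one] at h1
        linarith
      filter_upwards [strong_law_iterate hΦ hσm hint hσind] with X hX
      refine (hX.inv₀ hne).congr fun k => ?_
      rw [inv_div]
      push_cast
      rfl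
    · refine ⟨0, ?_⟩
      filter_upwards [strong_law_iterate_top hΦ hσm (fun X => Nat.cast_nonneg _) hint hσind]
        with X hX
      refine hX.inv_tendsto_atTop.congr fun k => ?_
      rw [Pi.inv_apply, inv_div]
      push_cast
      rfl
  obtain ⟨r, hr⟩ := hr
  refine ⟨(∫ X, ((firstCut X).2 : ℝ) ∂(confinedLaw P)) * r, ?_⟩
  have hvit := ae_all_iff.2 fun k => (hΦ.iterate k).quasiMeasurePreserving.ae hvalid
  filter_upwards [hY, hr, hvit, confinedLaw_ae pathLaw_start, confinedLaw_stayAbove P]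
    with X h1 h2 h3 h4 h5
  have hcut := cut_iterate h4 h5 fun k => (h3 k).2.1
  refine tendsto_div_of_renewal (X := fun n => (X n : ℝ))
    (τ := fun k => ∑ i ∈ Finset.range k, (firstCut (afterCut^[i] X)).1)
    (strictMono_nat_of_lt_succ fun k => ?_) (by simp) (fun n => ?_) (fun k n hn => ?_)
    (fun k n hn => ?_) ?_ h2
  · rw [Finset.sum_range_succ]
    exact Nat.lt_add_of_pos_right (h3 k).1
  · have : 0 ≤ X n := h5 n
    exact_mod_cast this
  · have := (hcut k).2.1.2 (n - ∑ i ∈ Finset.range k, (firstCut (afterCut^[i] X)).1)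
    rw [Nat.add_sub_cancel' hn] at this
    exact_mod_cast this
  · exact_mod_cast ((hcut k).2.1.1 n hn).le
  · refine h1.congr fun k => ?_
    rw [(hcut k).2.2]
    push_cast
    rfl

/-- A walk that escapes to the right has a deterministic speed. -/
theorem Admissible.speed_of_escapesRight {P : Measure Environment} {J : ℕ} (h : Admissible P J)
    (hR : ∀ᵐ X ∂(pathLaw P 0), X ∈ escapesRight) :
    ∃ v : ℝ, ∀ᵐ X ∂(pathLaw P 0), X ∈ hasSpeed v := by
  have := h.isProbabilityMeasure
  obtain ⟨v, hv⟩ := h.confined_speed hR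
  -- Having speed `v` is unaffected by translation and by deleting an initial segment.
  refine ⟨v, h.null_of_confined hR (measurableSet_hasSpeed v).compl (fun k X => not_congr ?_)
    (fun n X hX hX' => hX ?_) ?_⟩
  · refine Iff.trans ?_ (tendsto_div_sub_iff (X := fun n => (X n : ℝ)) k v)
    simp only [hasSpeed, Set.mem_ofPred_eq, Int.cast_sub]
  · exact tendsto_div_of_shift (X := fun n => (X n : ℝ)) n hX'
  · have h1 : confinedLaw P (hasSpeed v)ᶜ = 0 := hv
    rw [confinedLaw_apply] at h1
    exact (mul_eq_zero.1 h1).resolve_left (ENNReal.inv_ne_zero.2 (measure_ne_top _ _))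

/-! ### The recurrent walk is slow in probability. -/

/-- The number of visits to `y` before time `t`. -/
def visits (y : ℤ) (t : ℕ) (X : Path) : ℕ := ((Finset.range t).filter fun j => X j = y).card

/-- The path reaches `[l, ∞)` after at most `M` visits to `0`. -/
def fewVisits (M l : ℕ) : Set Path := {X | ∃ t, (l : ℤ) ≤ X t ∧ visits 0 t X ≤ M}

/-- The path visits `y`, and reaches `[y + l, ∞)` after at most `M` visits to `y`, counted from the
first visit on. -/
def fewVisitsFrom (M l : ℕ) (y : ℤ) : Set Path :=
  {X | ∃ n, (X n = y ∧ ∀ j < n, X j ≠ y) ∧ (fun i => pathShift n X i - y) ∈ fewVisits M l}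

theorem visits_mono (y : ℤ) {s t : ℕ} (hst : s ≤ t) (X : Path) : visits y s X ≤ visits y t X :=
  Finset.card_le_card (Finset.filter_subset_filter _ (Finset.range_mono hst))

theorem measurableSet_fewVisits (M l : ℕ) : MeasurableSet (fewVisits M l) := by
  have : fewVisits M l = ⋃ t : ℕ, {X : Path | (l : ℤ) ≤ X t ∧ visits 0 t X ≤ M} := by
    ext X
    simp only [Set.mem_iUnion]
    rfl
  rw [this]
  refine MeasurableSet.iUnion fun t => PastDet.measurableSet (n := t) ?_
  rintro X Y hXY ⟨h1, h2⟩
  refine ⟨by rw [← hXY t le_rfl]; exact h1, ?_⟩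
  have : visits 0 t Y = visits 0 t X := by
    refine congrArg Finset.card (Finset.filter_congr fun j hj => ?_)
    rw [hXY j (Finset.mem_range.1 hj).le]
  rwa [this]

theorem pastDet_firstVisit (y : ℤ) (n : ℕ) : PastDet n {X : Path | X n = y ∧ ∀ j < n, X j ≠ y} := by
  rintro X Y hXY ⟨h1, h2⟩
  refine ⟨by rw [← hXY n le_rfl]; exact h1, fun j hj => ?_⟩
  rw [← hXY j hj.le]
  exact h2 j hj

theorem measurableSet_fewVisitsFrom (M l : ℕ) (y : ℤ) : MeasurableSet (fewVisitsFrom M l y) := by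
  have : fewVisitsFrom M l y = ⋃ n : ℕ, {X : Path | X n = y ∧ ∀ j < n, X j ≠ y} ∩
      pathShift n ⁻¹' {X | (fun i => X i - y) ∈ fewVisits M l} := by
    ext X
    simp only [Set.mem_iUnion]
    rfl
  rw [this]
  exact MeasurableSet.iUnion fun n => (pastDet_firstVisit y n).measurableSet.inter
    (measurable_pathShift n (measurable_path_sub y (measurableSet_fewVisits M l)))

/-- Apply the Markov property at the first visit to `y`, whose probability is at most one, and
average over the stationary environment. -/
theorem Admissible.pathLaw_fewVisitsFrom_le {P : Measure Environment} {J : ℕ} (h : Admissible P J)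
    (M l : ℕ) (y : ℤ) : pathLaw P 0 (fewVisitsFrom M l y) ≤ pathLaw P 0 (fewVisits M l) := by
  have hG : MeasurableSet {X : Path | (fun i => X i - y) ∈ fewVisits M l} :=
    measurable_path_sub y (measurableSet_fewVisits M l)
  rw [← pathLaw_translate h y (measurableSet_fewVisits M l),
    pathLaw_apply P 0 (measurableSet_fewVisitsFrom M l y)]
  refine lintegral_mono fun ω => ?_
  have h1 : fewVisitsFrom M l y ⊆ ⋃ n : ℕ, {X : Path | X n = y ∧ ∀ j < n, X j ≠ y} ∩
      pathShift n ⁻¹' {X | (fun i => X i - y) ∈ fewVisits M l} :=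
    fun X ⟨n, hn⟩ => Set.mem_iUnion.2 ⟨n, hn⟩
  refine (measure_mono h1).trans ((measure_iUnion_le _).trans ?_)
  have h2 : ∀ n, quenched ω 0 ({X : Path | X n = y ∧ ∀ j < n, X j ≠ y} ∩
      pathShift n ⁻¹' {X | (fun i => X i - y) ∈ fewVisits M l})
      = quenched ω 0 {X : Path | X n = y ∧ ∀ j < n, X j ≠ y} *
        quenched ω y {X | (fun i => X i - y) ∈ fewVisits M l} := fun n =>
    quenched_markov ω 0 (pastDet_firstVisit y n) y (fun X hX => hX.1) hG
  simp only [h2]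
  rw [ENNReal.tsum_mul_right, ← measure_iUnion]
  · exact mul_le_of_le_one_left' prob_le_one
  · intro n n' hn
    refine Set.disjoint_left.2 fun X hX hX' => ?_
    rcases hn.lt_or_gt with hlt | hlt
    · exact hX'.2 n hlt hX.1
    · exact hX.2 n' hlt hX'.1
  · exact fun n => (pastDet_firstVisit y n).measurableSet

theorem exists_visits_gt {X : Path} (hX : ∃ᶠ n in atTop, X n = 0) (M : ℕ) :
    ∃ t, M < visits 0 t X := by
  induction M with
  | zero =>
    obtain ⟨n, -, hn⟩ := frequently_atTop.1 hX 0
    exact ⟨n + 1, Finset.card_pos.2 ⟨n, Finset.mem_filter.2 ⟨Finset.self_mem_range_succ n, hn⟩⟩⟩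
  | succ M ih =>
    obtain ⟨t, ht⟩ := ih
    obtain ⟨n, hn1, hn2⟩ := frequently_atTop.1 hX t
    refine ⟨n + 1, lt_of_le_of_lt (Nat.succ_le_of_lt ht) (Finset.card_lt_card ?_)⟩
    refine (Finset.ssubset_iff_of_subset (Finset.filter_subset_filter _
      (Finset.range_mono (by omega)))).2 ⟨n, Finset.mem_filter.2
        ⟨Finset.self_mem_range_succ n, hn2⟩, fun hmem => ?_⟩
    have := Finset.mem_range.1 (Finset.mem_filter.1 hmem).1
    omega

/-- A recurrent path makes more than `M` visits to `0` by some finite time `t₀`, and its positions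
before `t₀` are bounded. -/
theorem tendsto_fewVisits {P : Measure Environment} [IsProbabilityMeasure P]
    (hrec : ∀ᵐ X ∂(pathLaw P 0), ∃ᶠ n in atTop, X n = 0) (M : ℕ) :
    Tendsto (fun l => pathLaw P 0 (fewVisits M l)) atTop (𝓝 0) := by
  have hanti : Antitone (fewVisits M) := by
    rintro a b hab X ⟨t, h1, h2⟩
    exact ⟨t, le_trans (by exact_mod_cast hab) h1, h2⟩
  have h1 := tendsto_measure_iInter_atTop (μ := pathLaw P 0)
    (fun l => (measurableSet_fewVisits M l).nullMeasurableSet) hanti ⟨0, measure_ne_top _ _⟩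
  have h2 : pathLaw P 0 (⋂ l, fewVisits M l) = 0 := by
    rw [measure_eq_zero_iff_ae_notMem]
    filter_upwards [hrec] with X hX hX'
    obtain ⟨t₀, ht₀⟩ := exists_visits_gt hX M
    obtain ⟨t, h3, h4⟩ := Set.mem_iInter.1 hX'
      (∑ i ∈ Finset.range t₀, (X i).natAbs + 1)
    have h5 : t < t₀ := by
      by_contra hcon
      have := visits_mono 0 (not_lt.1 hcon) X
      omega
    have h6 := Finset.single_le_sum (f := fun i => (X i).natAbs) (fun _ _ => Nat.zero_le _)
      (Finset.mem_range.2 h5)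
    have h7 : X t ≤ ((X t).natAbs : ℤ) := Int.le_natAbs
    have h8 : (((X t).natAbs : ℕ) : ℤ) ≤ ((∑ i ∈ Finset.range t₀, (X i).natAbs : ℕ) : ℤ) := by
      exact_mod_cast h6
    push_cast at h3 h8 h7
    omega
  rwa [h2] at h1

theorem lt_visits_of_notMem {X : Path} {M l : ℕ} {y : ℤ} (hX : X ∉ fewVisitsFrom M l y) {n t : ℕ}
    (hn : X n = y) (hnt : n ≤ t) (ht : y + l ≤ X t) : M < visits y t X := by
  classical
  have hex : ∃ n, X n = y := ⟨n, hn⟩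
  set k := Nat.find hex with hk
  have hk1 : X k = y := Nat.find_spec hex
  have hkt : k ≤ t := (Nat.find_min' hex hn).trans hnt
  have h1 : (fun i => pathShift k X i - y) ∉ fewVisits M l := fun hmem =>
    hX ⟨k, ⟨hk1, fun j hj => Nat.find_min hex hj⟩, hmem⟩
  have h2 : M < visits 0 (t - k) fun i => pathShift k X i - y := by
    by_contra hcon
    refine h1 ⟨t - k, ?_, not_lt.1 hcon⟩
    simp only [pathShift, Nat.add_sub_cancel' hkt]
    omega
  refine h2.trans_le (Finset.card_le_card_of_injOn (fun j => k + j) ?_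
    (fun a _ b _ hab => Nat.add_left_cancel hab))
  intro j hj
  obtain ⟨h3, h4⟩ := Finset.mem_filter.1 (Finset.mem_coe.1 hj)
  have h5 := Finset.mem_range.1 h3
  refine Finset.mem_coe.2 (Finset.mem_filter.2
    ⟨Finset.mem_range.2 (show k + j < t by omega), ?_⟩)
  simp only [pathShift] at h4
  change X (k + j) = y
  omega

-- On its way past `m * J + l` the path steps on a site in each of the `m` blocks of length `J`.
-- Each such site outside the exceptional set is visited at least `M + 1` times before `t`, and
-- visits to distinct sites take distinct times.
open Classical in
theorem mul_le_add_card_fewVisitsFrom {X : Path} {J : ℕ}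
    (hJ : ∀ n, |X (n + 1) - X n| ≤ (J : ℤ)) (hJ0 : 0 < J) (h0 : X 0 = 0) (M l m : ℕ) {t : ℕ}
    (ht : ((m * J + l : ℕ) : ℤ) ≤ X t) :
    (M + 1) * m ≤ t + (M + 1) *
      ((Finset.range (m * J)).filter fun y : ℕ => X ∈ fewVisitsFrom M l y).card := by
  have hex : ∀ i : ℕ, ∃ n y : ℕ, i < m → X n = y ∧ n ≤ t ∧ i * J ≤ y ∧ y < (i + 1) * J := by
    intro i
    by_cases hi : i < m
    · have hi' : i * J ≤ m * J := Nat.mul_le_mul_right J hi.le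
      obtain ⟨n, h1, h2, h3⟩ := exists_first_ge hJ hJ0 (k := ((i * J : ℕ) : ℤ))
        (by rw [h0]; positivity) ⟨t, by omega⟩
      refine ⟨n, (X n).toNat, fun _ => ⟨by omega, ?_, by omega, ?_⟩⟩
      · by_contra hcon
        have := h3 t (not_le.1 hcon)
        omega
      · rw [Nat.succ_mul]
        omega
    · exact ⟨0, 0, fun h => absurd h hi⟩
  choose n y hy using hex
  have hyJ : ∀ i < m, y i / J = i := fun i hi =>
    Nat.div_eq_of_lt_le (hy i hi).2.2.1 (hy i hi).2.2.2
  set bad := (Finset.range m).filter fun i => X ∈ fewVisitsFrom M l (y i) with hbad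
  set good := (Finset.range m).filter fun i => X ∉ fewVisitsFrom M l (y i) with hgood
  have hcard : bad.card + good.card = m := by
    rw [hbad, hgood, Finset.card_filter_add_card_filter_not, Finset.card_range]
  have hbadle : bad.card ≤
      ((Finset.range (m * J)).filter fun y : ℕ => X ∈ fewVisitsFrom M l y).card := by
    refine Finset.card_le_card_of_injOn y ?_ ?_
    · intro i hi
      obtain ⟨h1, h2⟩ := Finset.mem_filter.1 (Finset.mem_coe.1 hi)
      have h3 := Finset.mem_range.1 h1
      refine Finset.mem_coe.2 (Finset.mem_filter.2 ⟨Finset.mem_range.2 ?_, h2⟩)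
      exact (hy i h3).2.2.2.trans_le (Nat.mul_le_mul_right J h3)
    · intro a ha b hb hab
      have h1 := Finset.mem_range.1 (Finset.mem_filter.1 (Finset.mem_coe.1 ha)).1
      have h2 := Finset.mem_range.1 (Finset.mem_filter.1 (Finset.mem_coe.1 hb)).1
      rw [← hyJ a h1, ← hyJ b h2, hab]
  have hgoodle : (M + 1) * good.card ≤ t := by
    have h1 : ∀ i ∈ good, M + 1 ≤ visits (y i) t X := by
      intro i hi
      obtain ⟨h2, h3⟩ := Finset.mem_filter.1 hi
      have h4 := Finset.mem_range.1 h2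
      obtain ⟨h5, h6, -, h7⟩ := hy i h4
      refine lt_visits_of_notMem h3 h5 h6 ?_
      have h8 : (i + 1) * J ≤ m * J := Nat.mul_le_mul_right J h4
      omega
    have h2 : ∑ i ∈ good, visits (y i) t X ≤ t := by
      have h3 := Finset.card_biUnion (s := good)
        (t := fun i => (Finset.range t).filter fun j => X j = (y i : ℤ)) ?_
      · unfold visits
        rw [← h3]
        refine (Finset.card_le_card (Finset.biUnion_subset.2 fun i _ =>
          Finset.filter_subset _ _)).trans_eq (Finset.card_range t)
      · intro a ha b hb hab
        refine Finset.disjoint_left.2 fun j hj hj' => hab ?_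
        have h4 := (Finset.mem_filter.1 hj).2
        have h5 := (Finset.mem_filter.1 hj').2
        have h6 : y a = y b := by omega
        rw [← hyJ a (Finset.mem_range.1 (Finset.mem_filter.1 ha).1),
          ← hyJ b (Finset.mem_range.1 (Finset.mem_filter.1 hb).1), h6]
    calc (M + 1) * good.card = ∑ i ∈ good, (M + 1) := by
          rw [Finset.sum_const, smul_eq_mul, mul_comm]
      _ ≤ _ := Finset.sum_le_sum h1
      _ ≤ t := h2
  calc (M + 1) * m = (M + 1) * good.card + (M + 1) * bad.card := by rw [← hcard]; ring
    _ ≤ _ := add_le_add hgoodle (Nat.mul_le_mul_left _ hbadle)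

/-- The path gets to `[K - J, ∞)` before time `N`. -/
def quickPassage (N K J : ℕ) : Set Path := {X | ∃ t < N, (K : ℤ) ≤ X t + J}

/-- Markov's inequality for the number of exceptional sites in `[0, m * J)`: a fast passage makes at
least `m / 2` of them exceptional. -/
theorem Admissible.fast_le {P : Measure Environment} {J : ℕ} (h : Admissible P J)
    (M l m : ℕ) :
    m * pathLaw P 0 {X | ∃ t, 2 * t < (M + 1) * m ∧ ((m * J + l : ℕ) : ℤ) ≤ X t}
      ≤ 2 * ((m * J : ℕ) * pathLaw P 0 (fewVisits M l)) := by
  classical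
  have := h.isProbabilityMeasure
  set μ := pathLaw P 0
  let f : Path → ℝ≥0∞ := fun X =>
    ∑ y ∈ Finset.range (m * J), (fewVisitsFrom M l (y : ℤ)).indicator 1 X
  have hfm : Measurable f := Finset.measurable_sum _ fun y _ =>
    measurable_one.indicator (measurableSet_fewVisitsFrom M l y)
  have hf : ∀ X, f X =
      ((Finset.range (m * J)).filter fun y : ℕ => X ∈ fewVisitsFrom M l y).card := by
    intro X
    simp only [f, Set.indicator_apply, Pi.one_apply]
    rw [Finset.sum_boole]
  have hint : ∫⁻ X, 2 * f X ∂μ ≤ 2 * ((m * J : ℕ) * μ (fewVisits M l)) := by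
    rw [lintegral_const_mul _ hfm]
    refine mul_le_mul_right ?_ 2
    have hsum : ∫⁻ X, f X ∂μ = ∑ y ∈ Finset.range (m * J),
        ∫⁻ X, (fewVisitsFrom M l (y : ℤ)).indicator 1 X ∂μ :=
      lintegral_finsetSum _ fun y _ =>
        measurable_one.indicator (measurableSet_fewVisitsFrom M l y)
    rw [hsum]
    calc _ ≤ ∑ y ∈ Finset.range (m * J), μ (fewVisits M l) := by
          refine Finset.sum_le_sum fun y _ => ?_
          rw [lintegral_indicator_one (measurableSet_fewVisitsFrom M l y)]
          exact h.pathLaw_fewVisitsFrom_le M l y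
      _ = _ := by rw [Finset.sum_const, Finset.card_range, nsmul_eq_mul]
  refine le_trans ?_ ((mul_meas_ge_le_lintegral (μ := μ) (hfm.const_mul 2) m).trans hint)
  refine mul_le_mul_right ?_ _
  refine measure_mono_ae ?_
  filter_upwards [h.pathLaw_jumps, pathLaw_start] with X hXJ hX0
  rintro ⟨t, ht1, ht2⟩
  have h1 := mul_le_add_card_fewVisitsFrom hXJ h.pos hX0 M l m ht2
  change (m : ℝ≥0∞) ≤ 2 * f X
  rw [hf]
  set c := ((Finset.range (m * J)).filter fun y : ℕ => X ∈ fewVisitsFrom M l y).card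
  have h2 : m ≤ 2 * c := by
    by_contra hcon
    have h3 : (M + 1) * (2 * c) ≤ (M + 1) * m := Nat.mul_le_mul_left _ (not_le.1 hcon).le
    have h4 : (M + 1) * (2 * c + 1) ≤ (M + 1) * m := Nat.mul_le_mul_left _ (not_le.1 hcon)
    have h5 : (M + 1) * (2 * c) = 2 * ((M + 1) * c) := by ring
    omega
  exact_mod_cast h2

/-- A recurrent walk is slow in probability. -/
theorem Admissible.exists_quickPassage_le {P : Measure Environment} {J : ℕ} (h : Admissible P J)
    (hrec : ∀ᵐ X ∂(pathLaw P 0), ∃ᶠ n in atTop, X n = 0) (C : ℕ) {ε : ℝ≥0∞} (hε : 0 < ε) :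
    ∃ K, 0 < K ∧ pathLaw P 0 (quickPassage (2 * (C * K)) K J) ≤ ε := by
  have := h.isProbabilityMeasure
  -- With `m = l + J` the distance is `K = m * J + l + J = m * (J + 1)`, so that `4 * C * K = M *
  -- m`: a time below `2 * C * K` is fast in the sense of `fast_le`.
  set M := 4 * C * (J + 1)
  have hJ : (J : ℝ≥0∞) ≠ 0 := by exact_mod_cast h.pos.ne'
  have h1 := ENNReal.Tendsto.const_mul (a := 2 * J) (tendsto_fewVisits hrec M)
    (Or.inr (ENNReal.mul_ne_top (by simp) (ENNReal.natCast_ne_top J)))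
  rw [mul_zero] at h1
  obtain ⟨l, hl⟩ := (h1.eventually (gt_mem_nhds hε)).exists
  set m := l + J with hm
  have hm0 : 0 < m := by have := h.pos; omega
  refine ⟨m * J + l + J, by omega, ?_⟩
  have h2 := h.fast_le M l m
  have h3 : (m : ℝ≥0∞) * pathLaw P 0 {X | ∃ t, 2 * t < (M + 1) * m ∧
      ((m * J + l : ℕ) : ℤ) ≤ X t} ≤ m * (2 * J * pathLaw P 0 (fewVisits M l)) := by
    refine h2.trans_eq ?_
    push_cast
    ring
  rw [ENNReal.mul_le_mul_iff_right (by exact_mod_cast hm0.ne') (ENNReal.natCast_ne_top m)] at h3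
  refine (measure_mono ?_).trans (h3.trans hl.le)
  rintro X ⟨t, ht1, ht2⟩
  refine ⟨t, ?_, by push_cast at ht2 ⊢; omega⟩
  have h4 : 2 * t < 4 * (C * (m * J + l + J)) := by omega
  refine h4.trans_le ?_
  have h5 : m * J + l + J = m * (J + 1) := by rw [hm]; ring
  rw [h5]
  calc 4 * (C * (m * (J + 1))) = M * m := by simp only [M]; ring
    _ ≤ (M + 1) * m := Nat.mul_le_mul_right m (Nat.le_succ M)

/-! ### Generating functions of hitting times and almost sure slowness. -/

/-- The path is in `[L, ∞)` for the first time at time `n`. -/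
def firstGE (L : ℤ) (n : ℕ) : Set Path := {X | L ≤ X n ∧ ∀ j < n, X j < L}

theorem pastDet_firstGE (L : ℤ) (n : ℕ) : PastDet n (firstGE L n) := by
  rintro X Y hXY ⟨h1, h2⟩
  refine ⟨by rw [← hXY n le_rfl]; exact h1, fun j hj => ?_⟩
  rw [← hXY j hj.le]
  exact h2 j hj

theorem disjoint_firstGE (L : ℤ) : Pairwise (Function.onFun Disjoint (firstGE L)) := by
  intro n n' hn
  refine Set.disjoint_left.2 fun X hX hX' => ?_
  rcases hn.lt_or_gt with hlt | hlt
  · exact absurd hX.1 (not_le.2 (hX'.2 n hlt))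
  · exact absurd hX'.1 (not_le.2 (hX.2 n' hlt))

theorem exists_firstGE {X : Path} {L : ℤ} {t : ℕ} (ht : L ≤ X t) : ∃ n ≤ t, X ∈ firstGE L n := by
  classical
  have hex : ∃ n, L ≤ X n := ⟨t, ht⟩
  exact ⟨Nat.find hex, Nat.find_min' hex ht, Nat.find_spec hex,
    fun j hj => not_le.1 (Nat.find_min hex hj)⟩

/-- The generating function of the hitting time of `[L, ∞)` from `x`. -/
noncomputable def passageGen (z : ℝ≥0∞) (ω : Environment) (x L : ℤ) : ℝ≥0∞ :=
  ∑' n : ℕ, z ^ n * quenched ω x (firstGE L n)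

theorem tsum_firstGE_le_one (ω : Environment) (x L : ℤ) :
    ∑' n : ℕ, quenched ω x (firstGE L n) ≤ 1 := by
  rw [← measure_iUnion (disjoint_firstGE L) fun n => (pastDet_firstGE L n).measurableSet]
  exact prob_le_one

theorem passageGen_le_one {z : ℝ≥0∞} (hz : z ≤ 1) (ω : Environment) (x L : ℤ) :
    passageGen z ω x L ≤ 1 :=
  (ENNReal.tsum_le_tsum fun _ => mul_le_of_le_one_left' (pow_le_one₀ zero_le hz)).trans
    (tsum_firstGE_le_one ω x L)

/-- Split according to whether the hitting time is below `N`. -/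
theorem passageGen_le {z : ℝ≥0∞} (hz : z ≤ 1) (ω : Environment) (x L : ℤ) (N : ℕ) :
    passageGen z ω x L ≤ z ^ N + quenched ω x {X | ∃ t < N, L ≤ X t} := by
  have h1 : ∀ n, z ^ n * quenched ω x (firstGE L n) ≤ z ^ N * quenched ω x (firstGE L n) +
      if n ∈ Finset.range N then quenched ω x (firstGE L n) else 0 := by
    intro n
    by_cases hn : n ∈ Finset.range N
    · rw [if_pos hn]
      exact (mul_le_of_le_one_left' (pow_le_one₀ zero_le hz)).trans le_add_self
    · rw [if_neg hn, add_zero]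
      exact mul_le_mul_left (pow_le_pow_of_le_one zero_le hz (by simpa using hn)) _
  refine (ENNReal.tsum_le_tsum h1).trans ?_
  rw [ENNReal.tsum_add, ENNReal.tsum_mul_left]
  refine add_le_add (mul_le_of_le_one_right' (tsum_firstGE_le_one ω x L)) ?_
  rw [tsum_eq_sum (s := Finset.range N) fun n hn => if_neg hn,
    Finset.sum_congr rfl fun n hn => if_pos hn, ← measure_biUnion_finset
      (fun n _ n' _ hnn => disjoint_firstGE L hnn)
      fun n _ => (pastDet_firstGE L n).measurableSet]
  refine measure_mono fun X hX => ?_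
  obtain ⟨n, hn, hX⟩ := Set.mem_iUnion₂.1 hX
  exact ⟨n, Finset.mem_range.1 hn, hX.1⟩

/-- The Chernoff bound for the lower tail of the hitting time. -/
theorem pow_mul_le_passageGen {z : ℝ≥0∞} (hz : z ≤ 1) (ω : Environment) (x L : ℤ) (T : ℕ) :
    z ^ T * quenched ω x {X | ∃ t < T, L ≤ X t} ≤ passageGen z ω x L := by
  have h1 : quenched ω x {X | ∃ t < T, L ≤ X t}
      ≤ ∑ n ∈ Finset.range T, quenched ω x (firstGE L n) := by
    refine (measure_mono ?_).trans (measure_biUnion_finset_le _ _)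
    rintro X ⟨t, ht, hX⟩
    obtain ⟨n, hn, hX⟩ := exists_firstGE hX
    exact Set.mem_iUnion₂.2 ⟨n, Finset.mem_range.2 (by omega), hX⟩
  refine (mul_le_mul_right h1 _).trans ?_
  rw [Finset.mul_sum]
  refine le_trans (Finset.sum_le_sum fun n hn => ?_) (ENNReal.sum_le_tsum (Finset.range T))
  exact mul_le_mul_left (pow_le_pow_of_le_one zero_le hz (Finset.mem_range.1 hn).le) _

/-- Submultiplicativity of the generating functions of the hitting times. -/
theorem passageGen_le_mul {z : ℝ≥0∞} {ω : Environment} {x L L' : ℤ} {J : ℕ} {φ : ℝ≥0∞}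
    (hω : ∀ᵐ X ∂(quenched ω x), ∀ n, |X (n + 1) - X n| ≤ (J : ℤ)) (hJ : 0 < J) (hx : x ≤ L)
    (hL : L ≤ L') (hφ : ∀ y, L ≤ y → y < L + J → passageGen z ω y L' ≤ φ) :
    passageGen z ω x L' ≤ passageGen z ω x L * φ := by
  set μ := quenched ω x
  -- Split at the entrance time `n` into `[L, ∞)`. Bounded jumps put the entrance site in `[L, L +
  -- J)`, from where the remaining passage contributes at most `φ`.
  have step : ∀ n, ∑' N : ℕ, z ^ N * μ (firstGE L n ∩ firstGE L' N)
      ≤ z ^ n * μ (firstGE L n) * φ := by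
    intro n
    have hzero : ∀ N < n, z ^ N * μ (firstGE L n ∩ firstGE L' N) = 0 := by
      intro N hN
      have : firstGE L n ∩ firstGE L' N = ∅ :=
        Set.eq_empty_of_forall_notMem fun X hX =>
          absurd (hL.trans hX.2.1) (not_le.2 (hX.1.2 N hN))
      rw [this, measure_empty, mul_zero]
    rw [← Summable.sum_add_tsum_nat_add' (k := n) ENNReal.summable,
      Finset.sum_eq_zero fun N hN => hzero N (Finset.mem_range.1 hN), zero_add]
    calc ∑' m : ℕ, z ^ (m + n) * μ (firstGE L n ∩ firstGE L' (m + n))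
        ≤ ∑' m : ℕ, z ^ n * ∫⁻ X in firstGE L n, z ^ m * quenched ω (X n) (firstGE L' m) ∂μ := by
          refine ENNReal.tsum_le_tsum fun m => ?_
          rw [lintegral_const_mul _ (measurable_map_path (fun y => quenched ω y (firstGE L' m)) n),
            ← quenched_markov_lintegral ω x (pastDet_firstGE L n)
              (pastDet_firstGE L' m).measurableSet, ← mul_assoc, add_comm m n, pow_add]
          refine mul_le_mul_right (measure_mono ?_) _
          rintro X ⟨h1, h2, h3⟩
          exact ⟨h1, h2, fun j hj => h3 (n + j) (by omega)⟩
      _ = z ^ n * ∫⁻ X in firstGE L n, passageGen z ω (X n) L' ∂μ := by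
          rw [ENNReal.tsum_mul_left, ← lintegral_tsum fun m => (measurable_map_path
            (fun y => z ^ m * quenched ω y (firstGE L' m)) n).aemeasurable]
          rfl
      _ ≤ z ^ n * ∫⁻ X in firstGE L n, φ ∂μ := by
          refine mul_le_mul_right (setLIntegral_mono_ae measurable_const.aemeasurable ?_) _
          filter_upwards [hω, quenched_start ω x] with X h1 h2 h3
          refine hφ (X n) h3.1 ?_
          rcases Nat.eq_zero_or_pos n with rfl | hn
          · omega
          · have h4 := h3.2 (n - 1) (by omega)
            have h5 := (abs_le.1 (h1 (n - 1))).2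
            rw [Nat.sub_add_cancel (by omega)] at h5
            omega
      _ = z ^ n * μ (firstGE L n) * φ := by rw [setLIntegral_const]; ring
  calc passageGen z ω x L'
      ≤ ∑' N : ℕ, ∑' n : ℕ, z ^ N * μ (firstGE L n ∩ firstGE L' N) := by
        refine ENNReal.tsum_le_tsum fun N => ?_
        rw [ENNReal.tsum_mul_left]
        refine mul_le_mul_right (le_trans (measure_mono ?_) (measure_iUnion_le _)) _
        intro X hX
        obtain ⟨n, -, hn⟩ := exists_firstGE (hL.trans hX.1)
        exact Set.mem_iUnion.2 ⟨n, hn, hX⟩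
    _ = ∑' n : ℕ, ∑' N : ℕ, z ^ N * μ (firstGE L n ∩ firstGE L' N) := ENNReal.tsum_comm
    _ ≤ ∑' n : ℕ, z ^ n * μ (firstGE L n) * φ := ENNReal.tsum_le_tsum step
    _ = passageGen z ω x L * φ := ENNReal.tsum_mul_right

/-- The path gets to `[K - J, ∞)` before time `N`, and stays in `[-NJ, NJ]` before that time. -/
def quickPassageWithin (N K J : ℕ) : Set Path :=
  quickPassage N K J ∩ {X | ∀ i < N, X i ∈ Set.Icc (-(N * J : ℤ)) (N * J)}

theorem pastDet_quickPassageWithin (N K J : ℕ) : PastDet N (quickPassageWithin N K J) := by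
  rintro X Y hXY ⟨⟨t, ht, h1⟩, h2⟩
  refine ⟨⟨t, ht, ?_⟩, fun i hi => ?_⟩
  · rw [← hXY t ht.le]
    exact h1
  · rw [← hXY i hi.le]
    exact h2 i hi

theorem abs_sub_le_of_jumps {X : Path} {J : ℕ} (hJ : ∀ n, |X (n + 1) - X n| ≤ (J : ℤ)) (n : ℕ) :
    |X n - X 0| ≤ n * J := by
  induction n with
  | zero => simp
  | succ n ih =>
    have h1 := abs_sub_le (X (n + 1)) (X n) (X 0)
    have h2 := hJ n
    push_cast
    linarith

/-- Reaching `L` from `y` requires an advance of at least `K - J`. Bounded jumps confine the walk to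
distance `N * J` before time `N`, so passing to the local event loses nothing. -/
theorem quenched_quickPassage_le {ω : Environment} {J : ℕ} {y L : ℤ} (N K : ℕ)
    (hω : ∀ᵐ X ∂(quenched ω y), ∀ n, |X (n + 1) - X n| ≤ (J : ℤ)) (hy : y + K ≤ L + J) :
    quenched ω y {X | ∃ t < N, L ≤ X t}
      ≤ quenched (envShift y ω) 0 (quickPassageWithin N K J) := by
  rw [quenched_envShift ω y 0 (pastDet_quickPassageWithin N K J).measurableSet, zero_add]
  refine measure_mono_ae ?_
  filter_upwards [hω, quenched_start ω y] with X h1 h2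
  rintro ⟨t, ht, h3⟩
  refine ⟨⟨t, ht, ?_⟩, fun i hi => ?_⟩
  · change (K : ℤ) ≤ X t - y + J
    omega
  · have h4 := abs_sub_le_of_jumps h1 i
    rw [h2] at h4
    have h5 : (i : ℤ) * J ≤ N * J := by
      exact_mod_cast Nat.mul_le_mul_right J hi.le
    exact abs_le.1 (h4.trans h5)

/-- Strong law of large numbers for a local observable along an arithmetic progression of
translates whose supports are disjoint. -/
theorem Admissible.strong_law_envShift {P : Measure Environment} {J : ℕ} (h : Admissible P J)
    {G : Environment → ℝ} (hG : Measurable G) (hint : Integrable G P) {r d : ℕ}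
    (hdep : EnvDep (Set.Icc (-(r : ℤ)) r) G) (hd : 2 * r < d) (x : ℤ) :
    ∀ᵐ ω ∂P, Tendsto (fun n : ℕ => (∑ q ∈ Finset.range n, G (envShift (x + q * d) ω)) / n) atTop
      (𝓝 (∫ ω, G ω ∂P)) := by
  have hmp := fun k => h.measurePreserving_envShift k
  have hmeas := fun k => hG.comp (measurable_envShift k)
  have hdep' : ∀ k : ℤ, EnvDep (Set.Icc (k - r) (k + r)) fun ω => G (envShift k ω) := by
    intro k ω ω' hω
    refine hdep _ _ fun a ha => hω _ ?_
    have h1 := ha.1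
    have h2 := ha.2
    constructor <;> omega
  have hid : ∀ k, IdentDistrib (fun ω => G (envShift k ω)) G P P := fun k =>
    ⟨(hmeas k).aemeasurable, hG.aemeasurable, by
      have : (fun ω => G (envShift k ω)) = G ∘ envShift k := rfl
      rw [this, ← Measure.map_map hG (measurable_envShift k), (hmp k).map_eq]⟩
  have hslln := strong_law_ae_real (μ := P) (fun (q : ℕ) ω => G (envShift (x + q * d) ω))
    ((hid _).integrable_iff.2 hint) ?_ (fun q => (hid _).trans (hid _).symm)
  · rw [(hid _).integral_eq] at hslln
    exact hslln
  · intro q q' hq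
    refine h.indepFun ?_ (hmeas _) (hmeas _) (hdep' _) (hdep' _)
    refine Set.disjoint_left.2 fun a h1 h2 => ?_
    obtain ⟨h3, h4⟩ := h1
    obtain ⟨h5, h6⟩ := h2
    rcases hq.lt_or_gt with hlt | hlt
    · have h7 : ((q : ℤ) + 1) * d ≤ q' * d :=
        mul_le_mul_of_nonneg_right (by exact_mod_cast hlt) (Int.natCast_nonneg d)
      rw [add_mul, one_mul] at h7
      omega
    · have h7 : ((q' : ℤ) + 1) * d ≤ q * d :=
        mul_le_mul_of_nonneg_right (by exact_mod_cast hlt) (Int.natCast_nonneg d)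
      rw [add_mul, one_mul] at h7
      omega

/-- A form of the arithmetic-geometric mean inequality, from `x ≤ ρ * exp (x / ρ - 1)`. -/
theorem prod_le_pow_of_sum_le {f : ℕ → ℝ} (hf : ∀ k, 0 ≤ f k) {ρ : ℝ} (hρ : 0 < ρ) {n : ℕ}
    (h : ∑ k ∈ Finset.range n, f k ≤ n * ρ) : ∏ k ∈ Finset.range n, f k ≤ ρ ^ n := by
  have h1 : ∀ k ∈ Finset.range n, f k ≤ ρ * Real.exp (f k / ρ - 1) := by
    intro k _
    have := Real.add_one_le_exp (f k / ρ - 1)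
    rw [sub_add_cancel, div_le_iff₀ hρ] at this
    linarith
  refine (Finset.prod_le_prod (fun k _ => hf k) h1).trans ?_
  rw [Finset.prod_mul_distrib, Finset.prod_const, Finset.card_range, ← Real.exp_sum]
  refine mul_le_of_le_one_right (pow_nonneg hρ.le n) (Real.exp_le_one_iff.2 ?_)
  rw [Finset.sum_sub_distrib, ← Finset.sum_div, Finset.sum_const, Finset.card_range, nsmul_eq_mul,
    mul_one, sub_nonpos, div_le_iff₀ hρ]
  exact h

theorem sum_range_mul_eq (f : ℕ → ℝ) (m n : ℕ) :
    ∑ k ∈ Finset.range (n * m), f k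
      = ∑ ρ ∈ Finset.range m, ∑ q ∈ Finset.range n, f (q * m + ρ) := by
  induction n with
  | zero => simp
  | succ n ih =>
    rw [Nat.succ_mul, Finset.sum_range_add, ih, ← Finset.sum_add_distrib]
    exact Finset.sum_congr rfl fun ρ _ => (Finset.sum_range_succ _ _).symm

/-- The walk enters `[k * K, ∞)` at one of `J` sites; the sum over `i` dominates the worst of them,
and the slack `J` in `quickPassage` absorbs the overshoot. -/
theorem passageGen_le_prod {z : ℝ≥0∞} (hz : z ≤ 1) {ω : Environment} {J : ℕ}
    (hω : ∀ x, ∀ᵐ X ∂(quenched ω x), ∀ n, |X (n + 1) - X n| ≤ (J : ℤ)) (hJ : 0 < J) (N K n : ℕ) :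
    passageGen z ω 0 ((n * K : ℕ) : ℤ) ≤ ∏ k ∈ Finset.range n, (z ^ N +
      ∑ i ∈ Finset.range J, quenched (envShift ((k * K + i : ℕ) : ℤ) ω) 0
        (quickPassageWithin N K J)) := by
  induction n with
  | zero => simpa using passageGen_le_one hz ω 0 0
  | succ n ih =>
    rw [Finset.prod_range_succ]
    refine le_trans (passageGen_le_mul (hω 0) hJ (L := ((n * K : ℕ) : ℤ)) (by positivity) ?_ ?_)
      (mul_le_mul_left ih _)
    · exact_mod_cast Nat.mul_le_mul_right K n.le_succ
    · intro y h1 h2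
      have h3 : y + K ≤ (((n + 1) * K : ℕ) : ℤ) + J := by
        rw [Nat.succ_mul]
        push_cast at h1 h2 ⊢
        omega
      refine (passageGen_le hz ω y _ N).trans (add_le_add le_rfl ?_)
      refine (quenched_quickPassage_le N K (hω y) h3).trans ?_
      have h4 : y = ((n * K + (y - (n * K : ℕ)).toNat : ℕ) : ℤ) := by
        push_cast at h1 h2 ⊢
        omega
      conv_lhs => rw [h4]
      exact Finset.single_le_sum (f := fun i : ℕ => quenched (envShift ((n * K + i : ℕ) : ℤ) ω) 0
        (quickPassageWithin N K J)) (fun _ _ => zero_le)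
        (Finset.mem_range.2 (by push_cast at h1 h2 ⊢; omega))

theorem envDep_quickPassageWithin (N K J : ℕ) :
    EnvDep (Set.Icc (-((N * J : ℕ) : ℤ)) (N * J : ℕ))
      fun ω => (quenched ω 0 (quickPassageWithin N K J)).toReal := by
  intro ω ω' hω
  refine congrArg ENNReal.toReal (quenched_local hω 0 (pastDet_quickPassageWithin N K J)
    fun X hX i hi => ?_)
  have := hX.2 i hi
  push_cast
  exact this

/-- If the local passage probabilities are small on average, the walk takes at least the time
`C K m n` to get to `K m n`, up to an exponentially small probability. -/
theorem quenched_fast_le {ω : Environment} {J : ℕ}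
    (hω : ∀ x, ∀ᵐ X ∂(quenched ω x), ∀ n, |X (n + 1) - X n| ≤ (J : ℤ)) (hJ : 0 < J) {C K : ℕ}
    (hC : 0 < C) (hK : 0 < K) {n : ℕ}
    (hn : ∑ k ∈ Finset.range n, (1 / 16 + ∑ i ∈ Finset.range J,
      (quenched (envShift ((k * K + i : ℕ) : ℤ) ω) 0
        (quickPassageWithin (2 * (C * K)) K J)).toReal) ≤ n * (1 / 8)) :
    quenched ω 0 {X | ∃ t < C * K * n, ((n * K : ℕ) : ℤ) ≤ X t} ≤ ENNReal.ofReal ((1 / 2) ^ n) := by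
  set f : ℕ → ℝ := fun k => 1 / 16 + ∑ i ∈ Finset.range J,
      (quenched (envShift ((k * K + i : ℕ) : ℤ) ω) 0
        (quickPassageWithin (2 * (C * K)) K J)).toReal with hf
  have hCK : C * K ≠ 0 := (Nat.mul_pos hC hK).ne'
  -- Chosen so that `z ^ (C * K) = 1 / 4`. Then the cutoff term is `1 / 16`, the product is at most
  -- `8⁻¹ ^ n`, and dividing by `z ^ (C * K * n) = 4⁻¹ ^ n` leaves `2⁻¹ ^ n`.
  set w : ℝ := (1 / 4 : ℝ) ^ (((C * K : ℕ) : ℝ)⁻¹) with hw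
  have hw0 : 0 ≤ w := by positivity
  have hw1 : w ≤ 1 := Real.rpow_le_one (by norm_num) (by norm_num) (by positivity)
  have hwp : w ^ (C * K) = 1 / 4 := Real.rpow_inv_natCast_pow (by norm_num) hCK
  set z := ENNReal.ofReal w
  have hz : z ≤ 1 := ENNReal.ofReal_le_one.2 hw1
  have hzN : z ^ (2 * (C * K)) = ENNReal.ofReal (1 / 16) := by
    rw [← ENNReal.ofReal_pow hw0, mul_comm, pow_mul, hwp]
    norm_num
  have hzT : z ^ (C * K * n) = ENNReal.ofReal ((1 / 4) ^ n) := by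
    rw [← ENNReal.ofReal_pow hw0, pow_mul, hwp]
  have hf0 : ∀ k, 0 ≤ f k := fun k =>
    add_nonneg (by norm_num) (Finset.sum_nonneg fun i _ => ENNReal.toReal_nonneg)
  have h1 := (pow_mul_le_passageGen hz ω 0 ((n * K : ℕ) : ℤ) (C * K * n)).trans
    (passageGen_le_prod hz hω hJ (2 * (C * K)) K n)
  have h2 : ∀ k, z ^ (2 * (C * K)) + ∑ i ∈ Finset.range J,
      quenched (envShift ((k * K + i : ℕ) : ℤ) ω) 0 (quickPassageWithin (2 * (C * K)) K J)
      = ENNReal.ofReal (f k) := by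
    intro k
    rw [hf, hzN, ENNReal.ofReal_add (by norm_num)
      (Finset.sum_nonneg fun i _ => ENNReal.toReal_nonneg),
      ENNReal.ofReal_sum_of_nonneg fun i _ => ENNReal.toReal_nonneg]
    congr 1
    exact Finset.sum_congr rfl fun i _ => (ENNReal.ofReal_toReal (measure_ne_top _ _)).symm
  simp only [h2] at h1
  rw [← ENNReal.ofReal_prod_of_nonneg fun k _ => hf0 k, hzT] at h1
  have h3 : ∏ k ∈ Finset.range n, f k ≤ (1 / 4) ^ n * (1 / 2) ^ n := by
    rw [← mul_pow]
    refine (prod_le_pow_of_sum_le hf0 (by norm_num) hn).trans_eq ?_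
    norm_num
  have h4 := h1.trans (ENNReal.ofReal_le_ofReal h3)
  rw [ENNReal.ofReal_mul (by positivity), ENNReal.mul_le_mul_iff_right
    (ENNReal.ofReal_pos.2 (by positivity)).ne' ENNReal.ofReal_ne_top] at h4
  exact h4

/-- Blocks `k` in one residue class modulo `m` look at disjoint windows of the environment, so the
strong law applies to each class and offset `i` separately. -/
theorem Admissible.ae_average {P : Measure Environment} {J : ℕ} (h : Admissible P J)
    {G : Environment → ℝ} (hG : Measurable G) (hint : Integrable G P) {r K m : ℕ}
    (hdep : EnvDep (Set.Icc (-(r : ℤ)) r) G) (hm : 2 * r < m) (hK : 0 < K) (c : ℝ) :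
    ∀ᵐ ω ∂P, Tendsto (fun n : ℕ => (∑ k ∈ Finset.range (n * m),
      (c + ∑ i ∈ Finset.range J, G (envShift ((k * K + i : ℕ) : ℤ) ω))) / n) atTop
      (𝓝 (m * (c + J * ∫ ω, G ω ∂P))) := by
  have h1 := ae_all_iff.2 fun ρ : ℕ => ae_all_iff.2 fun i : ℕ =>
    h.strong_law_envShift hG hint (d := m * K) hdep (hm.trans_le (Nat.le_mul_of_pos_right m hK))
      ((ρ * K + i : ℕ) : ℤ)
  filter_upwards [h1] with ω hω
  have h2 : ∀ ρ : ℕ, Tendsto (fun n : ℕ => (∑ q ∈ Finset.range n,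
      (c + ∑ i ∈ Finset.range J, G (envShift (((q * m + ρ) * K + i : ℕ) : ℤ) ω))) / n) atTop
      (𝓝 (c + J * ∫ ω, G ω ∂P)) := by
    intro ρ
    have h3 := (tendsto_finsetSum (Finset.range J) fun i _ => hω ρ i).const_add c
    rw [Finset.sum_const, Finset.card_range, nsmul_eq_mul] at h3
    refine h3.congr' ?_
    filter_upwards [eventually_gt_atTop 0] with n hn
    have hn' : (n : ℝ) ≠ 0 := by exact_mod_cast hn.ne'
    rw [Finset.sum_add_distrib, Finset.sum_const, Finset.card_range, nsmul_eq_mul, add_div,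
      mul_div_cancel_left₀ _ hn', Finset.sum_comm, Finset.sum_div]
    congr 1
    refine Finset.sum_congr rfl fun i _ => ?_
    congr 1
    refine Finset.sum_congr rfl fun q _ => ?_
    congr 2
    push_cast
    ring
  have h4 := tendsto_finsetSum (Finset.range m) fun ρ _ => h2 ρ
  rw [Finset.sum_const, Finset.card_range, nsmul_eq_mul] at h4
  refine h4.congr fun n => ?_
  rw [sum_range_mul_eq (fun k => c + ∑ i ∈ Finset.range J,
    G (envShift ((k * K + i : ℕ) : ℤ) ω)) m n, Finset.sum_div]

/-- Interpolation: with `q = t / (C * (m * K))`, the level `(q + 1) * m * K` has not been reached by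
time `t`. -/
theorem le_of_not_fast {X : Path} {C K m : ℕ} (hC : 0 < C) (hK : 0 < K) (hm : 0 < m)
    (h : ∀ᶠ n : ℕ in atTop, ¬ ∃ t < C * K * (n * m), ((n * m * K : ℕ) : ℤ) ≤ X t) :
    ∀ᶠ t : ℕ in atTop, (C : ℤ) * X t ≤ t + C * (m * K : ℕ) := by
  obtain ⟨n₀, hn₀⟩ := eventually_atTop.1 h
  have hpos : 0 < C * (m * K) := Nat.mul_pos hC (Nat.mul_pos hm hK)
  filter_upwards [eventually_ge_atTop (C * (m * K) * n₀)] with t ht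
  have h1 : n₀ ≤ t / (C * (m * K)) := (Nat.le_div_iff_mul_le hpos).2 (by rwa [mul_comm])
  set q := t / (C * (m * K)) with hq
  have h2 : t < C * (m * K) * (q + 1) := Nat.lt_mul_div_succ t hpos
  have h3 : C * (m * K) * q ≤ t := Nat.mul_div_le t _
  have h4 : X t < (((q + 1) * m * K : ℕ) : ℤ) := by
    by_contra hcon
    refine hn₀ (q + 1) (by omega) ⟨t, ?_, not_lt.1 hcon⟩
    calc t < C * (m * K) * (q + 1) := h2
      _ = C * K * ((q + 1) * m) := by ring
  have h5 : (C : ℤ) * X t ≤ C * (((q + 1) * m * K : ℕ) : ℤ) :=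
    mul_le_mul_of_nonneg_left h4.le (Int.natCast_nonneg C)
  have h6 : ((C * (m * K) * q : ℕ) : ℤ) ≤ t := by exact_mod_cast h3
  push_cast at h5 h6 ⊢
  calc (C : ℤ) * X t ≤ C * ((q + 1) * m * K) := h5
    _ = C * (m * K) * q + C * (m * K) := by ring
    _ ≤ _ := by linarith

/-- A recurrent walk has upper speed at most `1 / C`, for every `C`. -/
theorem Admissible.slow_of_recurrent {P : Measure Environment} {J : ℕ} (h : Admissible P J)
    (hrec : ∀ᵐ X ∂(pathLaw P 0), ∃ᶠ n in atTop, X n = 0) {C : ℕ} (hC : 0 < C) :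
    ∃ H : ℕ, ∀ᵐ X ∂(pathLaw P 0), ∀ᶠ t : ℕ in atTop, (C : ℤ) * X t ≤ t + C * H := by
  have := h.isProbabilityMeasure
  have hJ : (0 : ℝ) < J := by exact_mod_cast h.pos
  -- This `ε` makes `J` times the mean of `G` at most `1 / 32`, so the average factor is at most `1
  -- / 16 + 1 / 32 < 1 / 8`.
  obtain ⟨K, hK, hKε⟩ := h.exists_quickPassage_le hrec C (ε := ENNReal.ofReal (1 / (32 * J)))
    (ENNReal.ofReal_pos.2 (by positivity))
  set N := 2 * (C * K)
  have hQ := (pastDet_quickPassageWithin N K J).measurableSet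
  set G : Environment → ℝ := fun ω => (quenched ω 0 (quickPassageWithin N K J)).toReal with hGdef
  have hG : Measurable G := (measurable_quenched_apply 0 hQ).ennreal_toReal
  have hint : Integrable G P := by
    refine Integrable.of_bound hG.aestronglyMeasurable 1 (Eventually.of_forall fun ω => ?_)
    rw [Real.norm_of_nonneg ENNReal.toReal_nonneg]
    exact measureReal_le_one
  have hGle : ∫ ω, G ω ∂P ≤ 1 / (32 * J) := by
    rw [hGdef, integral_toReal (measurable_quenched_apply 0 hQ).aemeasurable
      (Eventually.of_forall fun ω => measure_lt_top _ _), ← pathLaw_apply P 0 hQ]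
    refine ENNReal.toReal_le_of_le_ofReal (by positivity) ?_
    exact (measure_mono Set.inter_subset_left).trans hKε
  -- One more than twice the radius `N * J` of the local window, as `ae_average` requires.
  set m := 2 * (N * J) + 1 with hm
  have hlt : (m : ℝ) * (1 / 16 + J * ∫ ω, G ω ∂P) < m * (1 / 8) := by
    have hm0 : (0 : ℝ) < m := by
      rw [hm]
      positivity
    refine mul_lt_mul_of_pos_left ?_ hm0
    have h1 : J * ∫ ω, G ω ∂P ≤ J * (1 / (32 * J)) := mul_le_mul_of_nonneg_left hGle hJ.le
    have h2 : (J : ℝ) * (1 / (32 * J)) = 1 / 32 := by field_simp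
    rw [h2] at h1
    linarith
  refine ⟨m * K, ?_⟩
  have hBm : MeasurableSet {X : Path | ∀ᶠ t : ℕ in atTop, (C : ℤ) * X t ≤ t + C * (m * K : ℕ)} := by
    have : {X : Path | ∀ᶠ t : ℕ in atTop, (C : ℤ) * X t ≤ t + C * (m * K : ℕ)}
        = ⋃ t₀ : ℕ, ⋂ t : ℕ, ⋂ _ : t₀ ≤ t,
          {X : Path | X t ∈ {y : ℤ | (C : ℤ) * y ≤ t + C * (m * K : ℕ)}} := by
      ext X
      simp only [Set.mem_iInter, Set.mem_iUnion]
      exact eventually_atTop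
    rw [this]
    exact MeasurableSet.iUnion fun _ => MeasurableSet.iInter fun t => MeasurableSet.iInter fun _ =>
      measurableSet_eval t _
  refine ae_pathLaw_of_ae hBm ?_
  filter_upwards [h.ae_average hG hint (envDep_quickPassageWithin N K J) (Nat.lt_succ_self _) hK
    (1 / 16), h.jumps] with ω h1 h2
  obtain ⟨n₀, hn₀⟩ := eventually_atTop.1
    ((h1.eventually (gt_mem_nhds hlt)).and (eventually_gt_atTop 0))
  have h3 : ∀ n, n₀ ≤ n → quenched ω 0 {X | ∃ t < C * K * (n * m), ((n * m * K : ℕ) : ℤ) ≤ X t}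
      ≤ ENNReal.ofReal ((1 / 2) ^ n) := by
    intro n hn
    obtain ⟨h4, h5⟩ := hn₀ n hn
    have hn' : (0 : ℝ) < n := by exact_mod_cast h5
    rw [div_lt_iff₀ hn'] at h4
    refine (quenched_fast_le h2 h.pos hC hK ?_).trans (ENNReal.ofReal_le_ofReal
      (pow_le_pow_of_le_one (by norm_num) (by norm_num)
        (Nat.le_mul_of_pos_right n (Nat.succ_pos _))))
    refine h4.le.trans_eq ?_
    push_cast
    ring
  -- The bound `h3` holds only from `n₀` on, so Borel-Cantelli is applied to the shifted sequence.
  have h6 : ∑' n : ℕ, quenched ω 0 {X | ∃ t < C * K * ((n + n₀) * m),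
      (((n + n₀) * m * K : ℕ) : ℤ) ≤ X t} ≠ ∞ := by
    have hs : Summable fun n : ℕ => (1 / 2 : ℝ) ^ (n + n₀) :=
      (summable_nat_add_iff n₀).2 (summable_geometric_of_lt_one (by norm_num) (by norm_num))
    refine ne_top_of_le_ne_top hs.tsum_ofReal_ne_top
      (ENNReal.tsum_le_tsum fun n => h3 _ (Nat.le_add_left _ _))
  filter_upwards [ae_eventually_notMem h6] with X hX
  refine le_of_not_fast hC hK (Nat.succ_pos _) ?_
  obtain ⟨n₁, hn₁⟩ := eventually_atTop.1 hX
  filter_upwards [eventually_ge_atTop (n₁ + n₀)] with n hn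
  have := hn₁ (n - n₀) (by omega)
  rw [Nat.sub_add_cancel (by omega)] at this
  exact this

/-! ### Reflection and the law of large numbers. -/

theorem measurable_path_neg : Measurable fun (X : Path) (n : ℕ) => -X n :=
  measurable_pi_lambda _ fun n => measurable_map_path (fun z => -z) n

theorem pathLaw_map_envFlip (P : Measure Environment) :
    pathLaw (P.map envFlip) 0 = (pathLaw P 0).map fun X n => -X n := by
  refine Measure.ext fun B hB => ?_
  rw [pathLaw_flip P hB, Measure.map_apply measurable_path_neg hB]
  rfl

/-- Choose `k` with `1 / (k + 1) < ε / 2`; the additive constants vanish after division by `t`. -/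
theorem tendsto_zero_of_slow {X : Path}
    (h1 : ∀ k : ℕ, ∃ H : ℕ, ∀ᶠ t : ℕ in atTop, ((k + 1 : ℕ) : ℤ) * X t ≤ t + (k + 1 : ℕ) * H)
    (h2 : ∀ k : ℕ, ∃ H : ℕ, ∀ᶠ t : ℕ in atTop, ((k + 1 : ℕ) : ℤ) * -X t ≤ t + (k + 1 : ℕ) * H) :
    X ∈ hasSpeed 0 := by
  refine Metric.tendsto_atTop.2 fun ε hε => ?_
  obtain ⟨k, hk⟩ := exists_nat_one_div_lt (half_pos hε)
  obtain ⟨H, hH⟩ := h1 k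
  obtain ⟨H', hH'⟩ := h2 k
  have hlim : Tendsto (fun t : ℕ => ((H : ℝ) + H') / t) atTop (𝓝 0) :=
    tendsto_const_nhds.div_atTop tendsto_natCast_atTop_atTop
  have hall := ((hH.and hH').and (hlim.eventually (gt_mem_nhds (half_pos hε)))).and
    (eventually_gt_atTop 0)
  obtain ⟨t₀, ht₀⟩ := eventually_atTop.1 hall
  refine ⟨t₀, fun t ht => ?_⟩
  obtain ⟨⟨⟨h3, h4⟩, h5⟩, h6⟩ := ht₀ t ht
  have ht' : (0 : ℝ) < t := by exact_mod_cast h6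
  have hk' : (0 : ℝ) < (k : ℝ) + 1 := by positivity
  have h3' : ((k : ℝ) + 1) * X t ≤ t + (k + 1) * H := by exact_mod_cast h3
  have h4' : ((k : ℝ) + 1) * -X t ≤ t + (k + 1) * H' := by exact_mod_cast h4
  have hb : |(X t : ℝ)| ≤ t * (1 / ((k : ℝ) + 1)) + (H + H') := by
    have e1 : (X t : ℝ) ≤ t * (1 / ((k : ℝ) + 1)) + H := by
      rw [← mul_le_mul_iff_right₀ hk']
      refine h3'.trans_eq ?_
      field_simp
    have e2 : -(X t : ℝ) ≤ t * (1 / ((k : ℝ) + 1)) + H' := by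
      rw [← mul_le_mul_iff_right₀ hk']
      refine h4'.trans_eq ?_
      field_simp
    have e3 : (0 : ℝ) ≤ H := Nat.cast_nonneg H
    have e4 : (0 : ℝ) ≤ H' := Nat.cast_nonneg H'
    exact abs_le.2 ⟨by linarith, by linarith⟩
  rw [Real.dist_eq, sub_zero, abs_div, abs_of_pos ht', div_lt_iff₀ ht']
  rw [div_lt_iff₀ ht'] at h5
  have h7 : (t : ℝ) * (1 / ((k : ℝ) + 1)) ≤ t * (ε / 2) :=
    mul_le_mul_of_nonneg_left hk.le ht'.le
  linarith

/-- A recurrent walk has speed zero. -/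
theorem Admissible.speed_of_recurrent {P : Measure Environment} {J : ℕ} (h : Admissible P J)
    (hrec : ∀ᵐ X ∂(pathLaw P 0), ∃ᶠ n in atTop, X n = 0) :
    ∀ᵐ X ∂(pathLaw P 0), X ∈ hasSpeed 0 := by
  have hrec' : ∀ᵐ X ∂(pathLaw (P.map envFlip) 0), ∃ᶠ n in atTop, X n = 0 := by
    rw [pathLaw_map_envFlip]
    refine (ae_map_iff measurable_path_neg.aemeasurable (measurableSet_frequently 0)).2 ?_
    filter_upwards [hrec] with X hX
    simpa using hX
  choose H hH using fun k : ℕ => h.slow_of_recurrent hrec k.succ_pos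
  choose H' hH' using fun k : ℕ => h.flip.slow_of_recurrent hrec' k.succ_pos
  rw [pathLaw_map_envFlip] at hH'
  have hH'' := fun k => ae_of_ae_map measurable_path_neg.aemeasurable (hH' k)
  filter_upwards [ae_all_iff.2 hH, ae_all_iff.2 hH''] with X h1 h2
  exact tendsto_zero_of_slow (fun k => ⟨H k, h1 k⟩) fun k => ⟨H' k, h2 k⟩

/-- The law of large numbers for the walk. -/
theorem Admissible.exists_speed {P : Measure Environment} {J : ℕ} (h : Admissible P J) :
    ∃ v : ℝ, ∀ᵐ X ∂(pathLaw P 0), X ∈ hasSpeed v := by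
  rcases h.trichotomy with hR | hL | hrec
  · exact h.speed_of_escapesRight hR
  · have hR : ∀ᵐ X ∂(pathLaw (P.map envFlip) 0), X ∈ escapesRight := by
      rw [pathLaw_map_envFlip]
      refine (ae_map_iff measurable_path_neg.aemeasurable measurableSet_escapesRight).2 ?_
      filter_upwards [hL] with X hX
      exact tendsto_neg_atBot_atTop.comp hX
    obtain ⟨v, hv⟩ := h.flip.speed_of_escapesRight hR
    refine ⟨-v, ?_⟩
    rw [pathLaw_map_envFlip] at hv
    filter_upwards [ae_of_ae_map measurable_path_neg.aemeasurable hv] with X hX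
    refine (Tendsto.neg hX).congr fun n => ?_
    push_cast
    ring
  · exact ⟨0, h.speed_of_recurrent hrec⟩

/-! ### Hitting times of half-lines. -/

theorem hittingGE_le {X : Path} {x : ℤ} {n : ℕ} (h : x ≤ X n) : hittingGE x X ≤ n := by
  have h1 : hitting (X n) X ≤ n :=
    iInf₂_le (f := fun (m : ℕ) (_ : X m = X n) => (m : ℕ∞)) n rfl
  exact (iInf₂_le (f := fun y (_ : y ∈ Set.Ici x) => hitting y X) (X n) h).trans h1

/-- Includes the case of an infinite hitting time, where the hypothesis is vacuous. -/
theorem le_hittingGE {X : Path} {x : ℤ} {a : ℝ≥0∞} (h : ∀ n : ℕ, x ≤ X n → a ≤ n) :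
    a ≤ ((hittingGE x X : ℕ∞) : ℝ≥0∞) := by
  by_cases hex : ∃ t, x ≤ X t
  · obtain ⟨t, ht⟩ := hex
    obtain ⟨n, -, h1, h2⟩ := exists_firstGE ht
    have h3 : (n : ℕ∞) ≤ hittingGE x X := by
      refine le_iInf₂ fun y hy => le_iInf₂ fun m hm => ?_
      rw [Nat.cast_le]
      by_contra hlt
      have h4 := h2 m (not_le.1 hlt)
      rw [hm] at h4
      exact absurd (Set.mem_Ici.1 hy) (not_le.2 h4)
    refine (h n h1).trans ?_
    exact_mod_cast ENat.toENNReal_le.2 h3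
  · have h1 : hittingGE x X = ⊤ := by
      refine top_le_iff.1 (le_iInf₂ fun y hy => le_iInf₂ fun m hm => ?_)
      exact (hex ⟨m, by rw [hm]; exact hy⟩).elim
    rw [h1]
    simp

/-- Eventually `X n < n / c`, so a level `x` reached at a late time `n` has `c * x ≤ n`. A level
above the maximum over the finitely many early times cannot be reached early. -/
theorem eventually_le_hittingGE_div {X : Path} {v : ℝ} (hX : X ∈ hasSpeed v) {c : ℝ} (hc : 0 < c)
    (hcv : c * v < 1) :
    ∀ᶠ x : ℕ in atTop, ENNReal.ofReal c ≤ ((hittingGE (x : ℤ) X : ℕ∞) : ℝ≥0∞) / (x : ℝ≥0∞) := by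
  have hv : v < 1 / c := by rwa [lt_div_iff₀ hc, mul_comm]
  obtain ⟨n₀, hn₀⟩ := eventually_atTop.1
    ((Tendsto.eventually hX (gt_mem_nhds hv)).and (eventually_gt_atTop 0))
  obtain ⟨b, hb⟩ : ∃ b : ℕ, ∀ n < n₀, X n ≤ b := by
    refine ⟨∑ i ∈ Finset.range n₀, (X i).natAbs, fun n hn => ?_⟩
    have := Finset.single_le_sum (f := fun i => (X i).natAbs) (fun _ _ => Nat.zero_le _)
      (Finset.mem_range.2 hn)
    exact Int.le_natAbs.trans (by exact_mod_cast this)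
  filter_upwards [eventually_gt_atTop b] with x hx
  have hx0 : (0 : ℝ) < x := by exact_mod_cast (Nat.zero_le b).trans_lt hx
  rw [ENNReal.le_div_iff_mul_le (Or.inl (by exact_mod_cast hx0.ne'))
    (Or.inl (ENNReal.natCast_ne_top x)), ← ENNReal.ofReal_natCast x, ← ENNReal.ofReal_mul hc.le]
  refine le_hittingGE fun n hn => ?_
  rw [← ENNReal.ofReal_natCast n]
  refine ENNReal.ofReal_le_ofReal ?_
  have hn1 : n₀ ≤ n := by
    by_contra hlt
    have := hb n (not_le.1 hlt)
    omega
  obtain ⟨h1, h2⟩ := hn₀ n hn1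
  have hn' : (0 : ℝ) < n := by exact_mod_cast h2
  rw [div_lt_iff₀ hn', one_div, inv_mul_eq_div, lt_div_iff₀ hc] at h1
  have h3 : (x : ℝ) ≤ X n := by exact_mod_cast hn
  nlinarith

theorem eventually_hittingGE_div_le {X : Path} {v : ℝ} (hX : X ∈ hasSpeed v) {c : ℝ} (hc : 0 < c)
    (hcv : 1 < c * v) :
    ∀ᶠ x : ℕ in atTop, ((hittingGE (x : ℤ) X : ℕ∞) : ℝ≥0∞) / (x : ℝ≥0∞) ≤ ENNReal.ofReal c := by
  have hv0 : 0 < v := by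
    by_contra hv
    nlinarith
  -- At time `n = ⌈c' * x⌉` the path is above `n / c' ≥ x`; the gap between `c'` and `c` absorbs the
  -- rounding once `x ≥ 1 / (c - c')`.
  obtain ⟨c', h1, h2⟩ : ∃ c', 1 / v < c' ∧ c' < c :=
    exists_between (by rwa [div_lt_iff₀ hv0])
  have hc' : 0 < c' := (by positivity : 0 < 1 / v).trans h1
  have hv : 1 / c' < v := by
    rw [div_lt_iff₀ hv0] at h1
    rw [div_lt_iff₀ hc']
    linarith
  obtain ⟨n₀, hn₀⟩ := eventually_atTop.1
    ((Tendsto.eventually hX (lt_mem_nhds hv)).and (eventually_gt_atTop 0))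
  filter_upwards [eventually_gt_atTop 0, eventually_ge_atTop ⌈(n₀ : ℝ) / c'⌉₊,
    eventually_ge_atTop ⌈1 / (c - c')⌉₊] with x hx hx1 hx2
  have hx0 : (0 : ℝ) < x := by exact_mod_cast hx
  have hx1' : (n₀ : ℝ) / c' ≤ x := Nat.ceil_le.1 hx1
  have hx2' : 1 / (c - c') ≤ x := Nat.ceil_le.1 hx2
  rw [div_le_iff₀ hc'] at hx1'
  rw [div_le_iff₀ (by linarith)] at hx2'
  set n := ⌈(x : ℝ) * c'⌉₊
  have hn : (x : ℝ) * c' ≤ n := Nat.le_ceil _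
  have hn1 : (n : ℝ) < x * c' + 1 := Nat.ceil_lt_add_one (by positivity)
  have hn2 : n₀ ≤ n := by exact_mod_cast hx1'.trans hn
  obtain ⟨h3, h4⟩ := hn₀ n hn2
  have hn' : (0 : ℝ) < n := by exact_mod_cast h4
  rw [lt_div_iff₀ hn', one_div, inv_mul_eq_div, div_lt_iff₀ hc'] at h3
  have h5 : (x : ℤ) ≤ X n := by
    have : (x : ℝ) ≤ X n := le_of_mul_le_mul_right (hn.trans h3.le) hc'
    exact_mod_cast this
  refine ENNReal.div_le_of_le_mul ?_
  have h6 := ENat.toENNReal_le.2 (hittingGE_le h5)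
  refine h6.trans ?_
  rw [ENat.toENNReal_coe, ← ENNReal.ofReal_natCast n, ← ENNReal.ofReal_natCast x,
    ← ENNReal.ofReal_mul hc.le]
  refine ENNReal.ofReal_le_ofReal ?_
  linarith

/-- The hitting times of half-lines grow at the inverse of the speed. -/
theorem tendsto_hittingGE_div {X : Path} {v : ℝ} (hX : X ∈ hasSpeed v) :
    Tendsto (fun x : ℕ => ((hittingGE (x : ℤ) X : ℕ∞) : ℝ≥0∞) / (x : ℝ≥0∞)) atTop
      (𝓝 (if 0 < v then ENNReal.ofReal (1 / v) else ∞)) := by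
  by_cases hv : 0 < v
  · rw [if_pos hv]
    have hv1 : 0 < 1 / v := by positivity
    refine tendsto_order.2 ⟨fun a ha => ?_, fun a ha => ?_⟩
    · have hatop : a ≠ ∞ := (ha.trans ENNReal.ofReal_lt_top).ne
      rw [ENNReal.lt_ofReal_iff_toReal_lt hatop] at ha
      obtain ⟨c, h1, h2⟩ := exists_between ha
      have hc : 0 < c := ENNReal.toReal_nonneg.trans_lt h1
      filter_upwards [eventually_le_hittingGE_div hX hc (by rwa [lt_div_iff₀ hv] at h2)] with x hx
      exact ((ENNReal.lt_ofReal_iff_toReal_lt hatop).2 h1).trans_le hx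
    · obtain ⟨b, h1, h2⟩ := exists_between ha
      have hb : b ≠ ∞ := h2.ne_top
      have h3 : 1 / v < b.toReal := (ENNReal.ofReal_lt_iff_lt_toReal hv1.le hb).1 h1
      filter_upwards [eventually_hittingGE_div_le hX (hv1.trans h3)
        (by rwa [div_lt_iff₀ hv] at h3)] with x hx
      rw [ENNReal.ofReal_toReal hb] at hx
      exact hx.trans_lt h2
  · rw [if_neg hv]
    refine ENNReal.tendsto_nhds_top fun n => ?_
    have hc : (0 : ℝ) < (n : ℝ) + 1 := by positivity
    filter_upwards [eventually_le_hittingGE_div hX hc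
      (by nlinarith [not_lt.1 hv])] with x hx
    refine lt_of_lt_of_le ?_ hx
    rw [← ENNReal.ofReal_natCast n]
    exact (ENNReal.ofReal_lt_ofReal_iff hc).2 (by linarith)

end RWRE

open RWRE in
theorem mainTheorem2 (P : Measure Environment) [IsProbabilityMeasure P]
    (hC1 : IsIID P) (hC2 : IsIrreducible P) (hC3 : HasBoundedJumps P) :
    ∃ v : ℝ,
      (∀ᵐ p ∂(annealed P 0), Tendsto (fun n : ℕ => (p.2 n : ℝ) / (n : ℝ)) atTop (𝓝 v)) ∧
      (∀ᵐ p ∂(annealed P 0),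
        Tendsto (fun x : ℕ => ((hittingGE (x : ℤ) p.2 : ℕ∞) : ℝ≥0∞) / (x : ℝ≥0∞)) atTop
          (𝓝 (if 0 < v then ENNReal.ofReal (1 / v) else ∞))) := by
  obtain ⟨J, h⟩ := admissible_of_hypotheses hC1 hC2 hC3
  obtain ⟨v, hv⟩ := h.exists_speed
  have hv' : ∀ᵐ p ∂(annealed P 0), p.2 ∈ hasSpeed v := ae_annealed_of_ae hv
  exact ⟨v, hv', hv'.mono fun p hp => tendsto_hittingGE_div hp⟩
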